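/- \textbf{Setting.} Let $A_i\in\mathbb R^{s_i\times d}$ ($i=1,\dots,m$, $s_i\ge 1$) be the blocks of rows of $A\in\mathbb R^{n\times d}$, $n=\sum_i s_i$, and put $p_i=s_i/n$, $M_i=A_i^\top A_i/s_i$, $M=A^\top A/n=\sum_i p_iM_i$. Let $\sigma_j(\cdot)$ be the $j$-th largest singular value, $\sigma_j=\sigma_j(M)$, $\kappa=\|M\|_2\|M^\dagger\|_2$, and let $V_k$, $V_k^{(i)}$ be the top-$k$ eigenspaces of $M$, $M_i$, where $k\ge 1$. Assume $\|M_i-M\|_2\le\eta\|M\|_2$ for all $i$ and $\eta\kappa\le 1/3$. The federated power method with $k$ columns (target rank equal to iteration rank), set of communication times $\mathcal I$ and baseline device $b$ starts from a common $Z_0^{(i)}=Z_0\in\mathbb R^{d\times k}$. In step $t\ge1$ device $i$ forms $Y_t^{(i)}=M_iZ_{t-1}^{(i)}$ if $t\notin\mathcal I$, whereas $Y_t^{(i)}=\sum_j p_j\big(M_jZ_{t-1}^{(j)}D_t^{(j)}+N_t^{(j)}\big)+N_t'$ for all $i$ if $t\in\mathcal I$. Then $Z_t^{(i)}=\mathrm{orth}(Y_t^{(i)})$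 is the $Q$-factor of a QR factorization whose triangular factor has nonnegative diagonal. Here $D_{t+1}^{(i)}$ minimizes $\|Z_t^{(i)}D-Z_t^{(b)}\|_F$ over all orthogonal $D$ (\emph{with} orthogonal Procrustes alignment), or $D_{t+1}^{(i)}=I_k$ (\emph{without} alignment). The matrices $Z_0$, $N_t^{(j)}$, $N_t'$ are arbitrary, so the theorem applies to every realization of Gaussian initialization and noise. Write $\nu_t=\|\sum_jp_jN_t^{(j)}+N_t'\|_2$. The residual error is $\rho_t=\max_i\|Z_t^{(i)}D_{t+1}^{(i)}-Z_t^{(b)}\|_2$. Let $\tau(t)$ be the last communication time that is at most $t$ (time $0$ counts as one), and $$C_t=\max_i\tan\theta_k\big(Z_{\tau(t)},V_k^{(i)}\big)\in[0,\infty],\qquad \gamma_k=\max\Big\{\max_i\tfrac{\sigma_{k+1}(M_i)}{\sigma_k(M_i)},\tfrac{\sigma_{k+1}}{\sigma_k}\Big\},$$ where $\theta_k$ is the largest principal angle (between column spaces). \textbf{Theorem.} (0) With or without alignment, for fixed $m,d,k,(s_i),M,b,\mathcal I,t$, the largest value of $\rho_t$ over all data with global matrix $M$ that satisfy $\|M_i-M\|_2\le\eta\|M\|_2$,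 and over all runs in which the matrices orthogonalized up to step $t$ have full column rank, is a nondecreasing function of $\eta$. There are absolute constants $c_0,c,K>0$ such that the following holds. (1) With alignment: let $p=t-\tau(t)$, suppose $p\eta\le1$, and suppose that the matrices $Y_u^{(i)}$, $1\le u\le t$, have full column rank. Then, with $\delta_k=c(\sigma_k-\sigma_{k+1})$, $$\rho_t\le\min\Big\{2e^2\kappa^pp\,\eta,\ \frac{\eta\sigma_1}{\delta_k}+2\gamma_k^{p/4}C_t\Big\}$$ (if $\delta_k=0$, the quotient is read as $\infty$ when $\eta\sigma_1>0$ and as $0$ when $\eta\sigma_1=0$; products $0\cdot\infty$ are $0$). (2) With alignment, suppose $\sigma_k>\sigma_{k+1}$. Let $\bar\nu,\bar\rho\ge0$ and $\chi>0$ satisfy $(1-p_b)\bar\rho<1$ and $\chi\max\{1,\|Z_0\|_2\}\|w\|\le\|P_{V_k}Z_0w\|$ for all $w\in\mathbb R^k$ ($P_{V_k}$ is the orthogonal projection), and suppose that $$\varepsilon'=\frac{\bar\nu+\sigma_1\big(\eta+(2+\eta)\bar\rho\big)}{(\sigma_k-\sigma_{k+1})\big(1-(1-p_b)\bar\rho\big)}\le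 c_0\min\{\tfrac12,\chi\}.$$ Then $\gamma_k<1$, and $\gamma_k>0$ if $\sigma_{k+1}>0$. If $\nu_u\le\bar\nu$ for all $u\in\mathcal I$ with $1\le u\le T$ and $\rho_u\le\bar\rho$ for all $u\le T$, then for every $t\le T$ both $C_t$ and $\rho_t$ are at most $$K\Big(\frac{\eta\sigma_1+\bar\nu}{\sigma_k-\sigma_{k+1}}+\frac1\chi\Big(1-\frac{\sigma_k-\sigma_{k+1}}{2\sigma_k}\Big)^{\tau(t)}\Big).$$ If $\mathcal I$ is infinite, these bounds on $\nu_u$ and $\rho_u$ hold for all times, and $\nu_u\le\nu'$ for all sufficiently large $u\in\mathcal I$, then $$\limsup_{t\to\infty}C_t\le\frac{K(\eta\sigma_1+\nu')}{\sigma_k-\sigma_{k+1}},\qquad \limsup_{t\to\infty}\rho_t\le\frac{K(\eta\sigma_1+\nu')}{\sigma_k-\sigma_{k+1}}.$$ In particular both are $O(\eta)$ when the noise is eventually $O(\eta)$ (for example absent), with a constant that does not depend on $p$ or $\mathcal I$. (3) Without alignment: let $p=t-\tau(t)$, suppose $p\eta\le1$, and suppose that the matrices $Y_u^{(i)}$,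 $1\le u\le t$, have full column rank. Then $\rho_t\le4e\sqrt k\,p\,\kappa^p\eta$. -/

import Mathlib

open Filter
open scoped ENNReal Matrix.Norms.L2Operator

namespace FedPower

noncomputable section

/-! Throughout, `‖X‖` is the spectral norm (the ℓ² operator norm) of a real matrix `X`. -/

/-- The Frobenius norm. -/
def frob {d k : ℕ} (X : Matrix (Fin d) (Fin k) ℝ) : ℝ :=
  √(∑ i, ∑ j, X i j ^ 2)

/-- `B` is the Moore-Penrose inverse of the real matrix `A`. -/
structure IsMoorePenrose {d e : ℕ} (A : Matrix (Fin d) (Fin e) ℝ)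
    (B : Matrix (Fin e) (Fin d) ℝ) : Prop where
  mul_mul_left : A * B * A = A
  mul_mul_right : B * A * B = B
  symm_left : (A * B).transpose = A * B
  symm_right : (B * A).transpose = B * A

/-- The `j`-th largest singular value (`j = 1, 2, …`); it is `0` when `j` exceeds the dimension. -/
def sigma {d : ℕ} (A : Matrix (Fin d) (Fin d) ℝ) (j : ℕ) : ℝ :=
  (Matrix.toEuclideanLin A).singularValues (j - 1)

/-- The column space of a matrix. -/
def colSpace {d k : ℕ} (X : Matrix (Fin d) (Fin k) ℝ) : Submodule ℝ (EuclideanSpace ℝ (Fin d)) :=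
  LinearMap.range (Matrix.toEuclideanLin X)

/-- The top-`k` eigenspace of a positive semidefinite matrix: the span of the eigenvectors whose
eigenvalue is at least the `k`-th largest one. -/
def topEigenspace {d : ℕ} (A : Matrix (Fin d) (Fin d) ℝ) (k : ℕ) :
    Submodule ℝ (EuclideanSpace ℝ (Fin d)) :=
  ⨆ μ : {μ : ℝ // sigma A k ≤ μ}, Module.End.eigenspace (Matrix.toEuclideanLin A) (μ : ℝ)

/-- The projection distance of two subspaces, which is the sine of their largest principal angle
(when they have the same dimension). -/
def sinTheta {d : ℕ} (U W : Submodule ℝ (EuclideanSpace ℝ (Fin d))) : ℝ :=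
  ‖U.starProjection - W.starProjection‖

/-- The tangent of the largest principal angle, with value `∞` at a right angle. -/
def tanTheta {d : ℕ} (U W : Submodule ℝ (EuclideanSpace ℝ (Fin d))) : ℝ≥0∞ :=
  ENNReal.ofReal (sinTheta U W) / ENNReal.ofReal (√(1 - sinTheta U W ^ 2))

/-- `Z = orth(Y)`: `Z` is a `Q`-factor of a QR factorization `Y = Z R`, where `R` is upper triangular
and is normalized by having a nonnegative diagonal. -/
def IsOrth {d k : ℕ} (Y Z : Matrix (Fin d) (Fin k) ℝ) : Prop :=
  Z.transpose * Z = 1 ∧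
    ∃ R : Matrix (Fin k) (Fin k) ℝ, R.BlockTriangular id ∧ (∀ j, 0 ≤ R j j) ∧ Y = Z * R

/-- The set of orthogonal `k × k` matrices. -/
def orthMat (k : ℕ) : Set (Matrix (Fin k) (Fin k) ℝ) :=
  {D | D.transpose * D = 1}

/-- `D` minimizes `‖Z D - Z₁‖_F` over the orthogonal matrices in `F`. -/
def IsAlignment {d k : ℕ} (F : Set (Matrix (Fin k) (Fin k) ℝ))
    (Z Z₁ : Matrix (Fin d) (Fin k) ℝ) (D : Matrix (Fin k) (Fin k) ℝ) : Prop :=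
  D ∈ F ∩ orthMat k ∧ ∀ D' ∈ F ∩ orthMat k, frob (Z * D - Z₁) ≤ frob (Z * D' - Z₁)

section Data

variable {m d : ℕ} {s : Fin m → ℕ}

/-- The fraction `s_i / n` of the rows held by device `i`, where `n = ∑ s_j`. -/
def weight (s : Fin m → ℕ) (i : Fin m) : ℝ :=
  (s i : ℝ) / ((∑ j, s j : ℕ) : ℝ)

/-- The local matrix `A_iᵀ A_i / s_i`. -/
def localGram (A : (i : Fin m) → Matrix (Fin (s i)) (Fin d) ℝ) (i : Fin m) :
    Matrix (Fin d) (Fin d) ℝ :=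
  (s i : ℝ)⁻¹ • ((A i).transpose * A i)

/-- The data matrix obtained by stacking the rows of all the `A_i`. -/
def stacked (A : (i : Fin m) → Matrix (Fin (s i)) (Fin d) ℝ) :
    Matrix ((i : Fin m) × Fin (s i)) (Fin d) ℝ :=
  fun r j => A r.1 r.2 j

/-- The global matrix `Aᵀ A / n`. -/
def gram (A : (i : Fin m) → Matrix (Fin (s i)) (Fin d) ℝ) : Matrix (Fin d) (Fin d) ℝ :=
  ((∑ j, s j : ℕ) : ℝ)⁻¹ • ((stacked A).transpose * stacked A)

/-- Every local matrix is within relative distance `η` of the global one. -/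
def LocalApprox (A : (i : Fin m) → Matrix (Fin (s i)) (Fin d) ℝ) (η : ℝ) : Prop :=
  ∀ i, ‖localGram A i - gram A‖ ≤ η * ‖gram A‖

/-- `γ_k`, the largest of the ratios `σ_{k+1} / σ_k` of the global and the local matrices. -/
def gammaRatio (A : (i : Fin m) → Matrix (Fin (s i)) (Fin d) ℝ) (k : ℕ) : ℝ :=
  max (⨆ i, sigma (localGram A i) (k + 1) / sigma (localGram A i) k)
    (sigma (gram A) (k + 1) / sigma (gram A) k)

variable {k : ℕ}

/-- A run of the federated power method with full participation. `Z t i` is the iterate of device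
`i` after step `t`, `Y t i` is the matrix it orthogonalizes in step `t`, `D t i` is the alignment
matrix it uses in step `t`, `I` is the set of communication times, and `b` is the baseline device.
`N t i` and `N' t` are the noise matrices added by device `i` and by the server when step `t` is
a communication. No law is imposed on them or on the initial matrix, so a run is an arbitrary
realization of the randomness. -/
structure IsRun (F : Set (Matrix (Fin k) (Fin k) ℝ))
    (A : (i : Fin m) → Matrix (Fin (s i)) (Fin d) ℝ) (b : Fin m) (I : Set ℕ)
    (Z Y : ℕ → Fin m → Matrix (Fin d) (Fin k) ℝ)
    (D : ℕ → Fin m → Matrix (Fin k) (Fin k) ℝ)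
    (N : ℕ → Fin m → Matrix (Fin d) (Fin k) ℝ)
    (N' : ℕ → Matrix (Fin d) (Fin k) ℝ) : Prop where
  init : ∀ i, Z 0 i = Z 0 b
  align : ∀ t i, IsAlignment F (Z t i) (Z t b) (D (t + 1) i)
  step_local : ∀ t, t + 1 ∉ I → ∀ i, Y (t + 1) i = localGram A i * Z t i
  step_sync : ∀ t, t + 1 ∈ I → ∀ i, Y (t + 1) i =
    (∑ j, weight s j • (localGram A j * Z t j * D (t + 1) j + N (t + 1) j)) + N' (t + 1)
  orth : ∀ t i, IsOrth (Y (t + 1) i) (Z (t + 1) i)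

/-- The spectral norm of the total noise added in the communication step `t`. -/
def noiseNorm (s : Fin m → ℕ) (N : ℕ → Fin m → Matrix (Fin d) (Fin k) ℝ)
    (N' : ℕ → Matrix (Fin d) (Fin k) ℝ) (t : ℕ) : ℝ :=
  ‖(∑ j, weight s j • N t j) + N' t‖

/-- All matrices orthogonalized in the steps `1, …, t` have full column rank. -/
def FullRankUpTo (Y : ℕ → Fin m → Matrix (Fin d) (Fin k) ℝ) (t : ℕ) : Prop :=
  ∀ u, 1 ≤ u → u ≤ t → ∀ i, (Y u i).rank = k

/-- The residual error `ρ_t`. -/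
def residual (b : Fin m) (Z : ℕ → Fin m → Matrix (Fin d) (Fin k) ℝ)
    (D : ℕ → Fin m → Matrix (Fin k) (Fin k) ℝ) (t : ℕ) : ℝ :=
  ⨆ i, ‖Z t i * D (t + 1) i - Z t b‖

open Classical in
/-- `τ(t)`, the latest communication time that is at most `t` (the start `0` counts as one). -/
def lastSync (I : Set ℕ) (t : ℕ) : ℕ :=
  Nat.findGreatest (fun u => u ∈ I) t

/-- `C_t`, the largest tangent of the angle between the last synchronized iterate and the top-`k`
eigenspace of a local matrix. -/
def angleTerm (A : (i : Fin m) → Matrix (Fin (s i)) (Fin d) ℝ) (I : Set ℕ)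
    (Z : ℕ → Fin m → Matrix (Fin d) (Fin k) ℝ) (t : ℕ) : ℝ≥0∞ :=
  ⨆ i, tanTheta (colSpace (Z (lastSync I t) i)) (topEigenspace (localGram A i) k)

/-- The error level `ε' = I₁ + I₂` of the convergence analysis, where `ν` is a bound on the spectral
norms of the noise and `ρmax` is a bound on the residual errors. -/
def epsPrime (A : (i : Fin m) → Matrix (Fin (s i)) (Fin d) ℝ) (b : Fin m) (k : ℕ)
    (η ν ρmax : ℝ) : ℝ :=
  (ν + sigma (gram A) 1 * (η + (2 + η) * ρmax)) /
    ((sigma (gram A) k - sigma (gram A) (k + 1)) * (1 - (1 - weight s b) * ρmax))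

end Data

/-- The largest value that the residual error at time `t` can take, over all data whose global matrix
is `M` and whose local matrices are within relative distance `η` of it, and over all runs on such
data in which the matrices being orthogonalized have full column rank. -/
def worstResidual {m d k : ℕ} (F : Set (Matrix (Fin k) (Fin k) ℝ)) (s : Fin m → ℕ)
    (M : Matrix (Fin d) (Fin d) ℝ) (b : Fin m) (I : Set ℕ) (t : ℕ) (η : ℝ) : ℝ≥0∞ :=
  sSup {x | ∃ (A : (i : Fin m) → Matrix (Fin (s i)) (Fin d) ℝ)
    (Z Y : ℕ → Fin m → Matrix (Fin d) (Fin k) ℝ)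
    (D : ℕ → Fin m → Matrix (Fin k) (Fin k) ℝ)
    (N : ℕ → Fin m → Matrix (Fin d) (Fin k) ℝ)
    (N' : ℕ → Matrix (Fin d) (Fin k) ℝ),
    gram A = M ∧ LocalApprox A η ∧ IsRun F A b I Z Y D N N' ∧ FullRankUpTo Y t ∧
      x = ENNReal.ofReal (residual b Z D t)}

end

end FedPower

/-!
Three facts carry the bounds on the residual error.

*Perturbation.* Between communications device `i` computes the `Q`-factor of `M_i ^ p Z` for a common
`Z`. The kernel of `M` lies in that of every `M_i`, and on the range of `M` the powers of `M_i` are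
bounded below (`norm_pinv_le`), so that after normalization the matrices of two devices differ by at
most about `2 p κ ^ p η` (`IsRun.exists_perturbation`). Without alignment one needs the change of the
`Q`-factor: if `X + F = Q R` with `X`, `Q` orthonormal, then `R - R⁻ᵀ = Qᵀ F + (F R⁻¹)ᵀ X`, and the two
triangular matrices on the left do not interact off the diagonal (`norm_qFactor_sub_le`); passing to
the Frobenius norm costs the factor `√k`.

*Alignment.* If `D` minimizes `‖X D - E‖_F`, then `Dᵀ Xᵀ E` is symmetric positive semidefinite, as one
sees by testing with reflections. Hence the aligned distance is `√(2 - 2 cos θ)` for the largest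
principal angle `θ` (`IsAlignment.norm_sq_le`), which is at most `√2 sin θ` and at most `tan θ`, and `D`
is also optimal for the spectral norm (`IsAlignment.norm_le`). Optimality makes the aligned distance a
metric, so two iterates can be compared through orthonormal bases of the eigenspaces: power steps
contract `tan θ` by the factor `σ_{k+1}(M_i) / σ_k(M_i)`, and the eigenspaces of the `M_i` are close by
the theorems of Weyl and Davis-Kahan (`IsRun.residual_le_angle`).

*Convergence.* Let `a` bound the tangents of the angles between all the iterates and the top eigenspace
of `M`. A communication averages vectors `z_j` that are nearly equal and all have components of relative
size at most `a` outside of the eigenspace. The misalignment therefore changes the average of these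
components only by a factor close to `1`, and is not an additive error (`averaged_step`). So the bound
obeys `a' = (1 - gap / (2 σ_k)) a + 4 (η σ₁ + ν) / σ_k`, whose fixed point does not involve the
misalignment or the number of local steps (`angleSeq_add_le`). Local steps are the case of an average
with one term, and the induction (`IsRun.nearSubspace`) also shows that all matrices keep full rank.
-/

namespace FedPower

open Matrix

/-! ### Matrices acting on Euclidean space, spectral and Frobenius norms -/

section MatrixNorms

variable {d e k : ℕ}

theorem toEuclideanLin_mul_apply {l m n : ℕ} (X : Matrix (Fin l) (Fin m) ℝ)
    (Y : Matrix (Fin m) (Fin n) ℝ) (v : EuclideanSpace ℝ (Fin n)) :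
    (X * Y).toEuclideanLin v = X.toEuclideanLin (Y.toEuclideanLin v) := by
  simp [Matrix.toLpLin_apply, Matrix.mulVec_mulVec]

theorem toEuclideanLin_one_apply {n : ℕ} (v : EuclideanSpace ℝ (Fin n)) :
    (1 : Matrix (Fin n) (Fin n) ℝ).toEuclideanLin v = v := by
  simp

theorem norm_toEuclideanLin_le (X : Matrix (Fin d) (Fin k) ℝ) (v : EuclideanSpace ℝ (Fin k)) :
    ‖X.toEuclideanLin v‖ ≤ ‖X‖ * ‖v‖ :=
  Matrix.l2_opNorm_mulVec X v

theorem l2_opNorm_le_bound {X : Matrix (Fin d) (Fin k) ℝ} {c : ℝ} (hc : 0 ≤ c)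
    (h : ∀ v, ‖X.toEuclideanLin v‖ ≤ c * ‖v‖) : ‖X‖ ≤ c := by
  rw [Matrix.l2_opNorm_def]
  exact ContinuousLinearMap.opNorm_le_bound _ hc h

theorem inner_toEuclideanLin_left (X : Matrix (Fin d) (Fin k) ℝ) (v : EuclideanSpace ℝ (Fin k))
    (w : EuclideanSpace ℝ (Fin d)) :
    inner ℝ (X.toEuclideanLin v) w = inner ℝ v (Xᵀ.toEuclideanLin w) := by
  rw [← Matrix.conjTranspose_eq_transpose_of_trivial, Matrix.toEuclideanLin_conjTranspose_eq_adjoint,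
    LinearMap.adjoint_inner_right]

theorem norm_transpose (X : Matrix (Fin d) (Fin k) ℝ) : ‖Xᵀ‖ = ‖X‖ := by
  rw [← Matrix.conjTranspose_eq_transpose_of_trivial, Matrix.l2_opNorm_conjTranspose]

theorem norm_mul_le' {l m n : ℕ} (X : Matrix (Fin l) (Fin m) ℝ) (Y : Matrix (Fin m) (Fin n) ℝ) :
    ‖X * Y‖ ≤ ‖X‖ * ‖Y‖ := Matrix.l2_opNorm_mul X Y

/-- A matrix with orthonormal columns acts isometrically. -/
theorem norm_toEuclideanLin_of_orthonormal {X : Matrix (Fin d) (Fin k) ℝ} (hX : Xᵀ * X = 1)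
    (v : EuclideanSpace ℝ (Fin k)) : ‖X.toEuclideanLin v‖ = ‖v‖ := by
  have h : ‖X.toEuclideanLin v‖ ^ 2 = ‖v‖ ^ 2 := by
    rw [← real_inner_self_eq_norm_sq, inner_toEuclideanLin_left, ← toEuclideanLin_mul_apply, hX,
      toEuclideanLin_one_apply, real_inner_self_eq_norm_sq]
  exact (sq_eq_sq₀ (norm_nonneg _) (norm_nonneg _)).mp h

theorem norm_le_one_of_orthonormal {X : Matrix (Fin d) (Fin k) ℝ} (hX : Xᵀ * X = 1) : ‖X‖ ≤ 1 :=
  l2_opNorm_le_bound zero_le_one fun v => by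
    rw [norm_toEuclideanLin_of_orthonormal hX, one_mul]

theorem frob_nonneg (X : Matrix (Fin d) (Fin k) ℝ) : 0 ≤ frob X := Real.sqrt_nonneg _

theorem frob_sq (X : Matrix (Fin d) (Fin k) ℝ) : frob X ^ 2 = (Xᵀ * X).trace := by
  rw [frob, Real.sq_sqrt (by positivity), Finset.sum_comm]
  simp [Matrix.trace, Matrix.mul_apply, sq]

theorem norm_le_frob (X : Matrix (Fin d) (Fin k) ℝ) : ‖X‖ ≤ frob X := by
  refine l2_opNorm_le_bound (frob_nonneg X) fun v => ?_
  refine le_of_sq_le_sq ?_ (by have := frob_nonneg X; positivity)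
  rw [mul_pow, frob, Real.sq_sqrt (by positivity), EuclideanSpace.real_norm_sq_eq,
    EuclideanSpace.real_norm_sq_eq, Finset.sum_mul]
  refine Finset.sum_le_sum fun i _ => ?_
  simp only [Matrix.toLpLin_apply, Matrix.mulVec, dotProduct]
  exact Finset.sum_mul_sq_le_sq_mul_sq _ _ _

theorem frob_sq_eq_sum_columns (X : Matrix (Fin d) (Fin k) ℝ) :
    frob X ^ 2 = ∑ j, ‖X.toEuclideanLin (EuclideanSpace.single j 1)‖ ^ 2 := by
  rw [frob, Real.sq_sqrt (by positivity), Finset.sum_comm]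
  refine Finset.sum_congr rfl fun j _ => ?_
  rw [EuclideanSpace.real_norm_sq_eq]
  simp

theorem frob_le_sqrt_mul_norm (X : Matrix (Fin d) (Fin k) ℝ) : frob X ≤ √k * ‖X‖ := by
  refine le_of_sq_le_sq ?_ (by positivity)
  rw [frob_sq_eq_sum_columns, mul_pow, Real.sq_sqrt (by positivity)]
  calc _ ≤ ∑ _j : Fin k, ‖X‖ ^ 2 := by
        refine Finset.sum_le_sum fun j _ => ?_
        have := norm_toEuclideanLin_le X (EuclideanSpace.single j 1)
        rw [PiLp.norm_single, norm_one, mul_one] at this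
        gcongr
    _ = _ := by simp

theorem frob_eq_zero_iff {X : Matrix (Fin d) (Fin k) ℝ} : frob X = 0 ↔ X = 0 := by
  refine ⟨fun h => norm_le_zero_iff.mp (h ▸ norm_le_frob X), ?_⟩
  rintro rfl
  simp [frob]

theorem norm_mul_orthogonal {D : Matrix (Fin k) (Fin k) ℝ} (hD : Dᵀ * D = 1)
    (X : Matrix (Fin d) (Fin k) ℝ) : ‖X * D‖ ≤ ‖X‖ := by
  calc _ ≤ ‖X‖ * ‖D‖ := norm_mul_le' _ _
    _ ≤ _ := mul_le_of_le_one_right (norm_nonneg _) (norm_le_one_of_orthonormal hD)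

end MatrixNorms

/-! ### Perturbation of the `Q`-factor -/

section QR

variable {d k : ℕ}

theorem inverse_diag_of_upperTriangular {R R' : Matrix (Fin k) (Fin k) ℝ}
    (hR : R.BlockTriangular id) (hR' : R'.BlockTriangular id) (h : R * R' = 1) (j : Fin k) :
    R j j * R' j j = 1 := by
  have := congr_fun (congr_fun h j) j
  rw [Matrix.mul_apply, Matrix.one_apply_eq, Finset.sum_eq_single j] at this
  · exact this
  · intro i _ hij
    rcases lt_or_gt_of_ne hij with h1 | h1
    · rw [hR h1, zero_mul]
    · rw [hR' h1, mul_zero]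
  · simp

/-- If `R` is upper triangular with nonnegative diagonal, its distance to the identity is controlled
by `R - R⁻ᵀ`: these two matrices are triangular of opposite kinds, so their off-diagonal entries do
not interact, and on the diagonal `|r - 1| ≤ |r - 1/r|`. -/
theorem frob_one_sub_le_of_upperTriangular {R R' : Matrix (Fin k) (Fin k) ℝ}
    (hR : R.BlockTriangular id) (hR' : R'.BlockTriangular id) (h : R * R' = 1)
    (hd : ∀ j, 0 ≤ R j j) : frob (1 - R) ≤ frob (R - R'ᵀ) := by
  refine Real.sqrt_le_sqrt (Finset.sum_le_sum fun i _ => Finset.sum_le_sum fun j _ => ?_)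
  simp only [Matrix.sub_apply, Matrix.transpose_apply]
  rcases lt_trichotomy i j with hij | rfl | hij
  · rw [Matrix.one_apply_ne hij.ne, hR' hij]
    simp
  · rw [Matrix.one_apply_eq]
    have h1 := inverse_diag_of_upperTriangular hR hR' h i
    have h0 := hd i
    rw [← neg_sq, neg_sub]
    refine sq_le_sq.mpr ?_
    have h2 : R i i - R' i i = (R i i - 1) + (1 - R' i i) := by ring
    have hpos : 0 < R i i := lt_of_le_of_ne h0 (by intro h3; rw [← h3] at h1; simp at h1)
    rw [h2]
    rcases le_total 1 (R i i) with h3 | h3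
    · have h4 : R' i i ≤ 1 := by nlinarith
      rw [abs_of_nonneg (by linarith), abs_of_nonneg (by linarith)]
      linarith
    · have h4 : 1 ≤ R' i i := by nlinarith
      rw [abs_of_nonpos (by linarith), abs_of_nonpos (by linarith)]
      linarith
  · rw [Matrix.one_apply_ne hij.ne', hR hij]
    rw [sub_zero, zero_pow two_ne_zero]
    exact sq_nonneg _

/-- Perturbation bound for the `Q`-factor. The matrix `X + F = Q R` has `Q`-factor `Q`, and `R` is
close to the identity since `R - R⁻ᵀ = Qᵀ F + (F R⁻¹)ᵀ X`. -/
theorem norm_qFactor_sub_le {X Q F : Matrix (Fin d) (Fin k) ℝ} {R R' : Matrix (Fin k) (Fin k) ℝ}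
    (hX : Xᵀ * X = 1) (hQ : Qᵀ * Q = 1)
    (hR : R.BlockTriangular id) (hR' : R'.BlockTriangular id) (h : R * R' = 1)
    (hd : ∀ j, 0 ≤ R j j) (hF : X + F = Q * R) :
    ‖Q - X‖ ≤ √k * (‖F‖ + ‖F * R'‖) + ‖F‖ := by
  have hK : R - R'ᵀ = Qᵀ * F + (F * R')ᵀ * X := by
    have h1 : R = Qᵀ * X + Qᵀ * F := by
      rw [← Matrix.mul_add, hF, ← Matrix.mul_assoc, hQ, Matrix.one_mul]
    have h2 : Q = X * R' + F * R' := by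
      rw [← Matrix.add_mul, hF, Matrix.mul_assoc, h, Matrix.mul_one]
    have h3 : Qᵀ * X = R'ᵀ + (F * R')ᵀ * X := by
      have h4 : Qᵀ = R'ᵀ * Xᵀ + (F * R')ᵀ := by
        conv_lhs => rw [h2]
        rw [Matrix.transpose_add, Matrix.transpose_mul]
      rw [h4, Matrix.add_mul, Matrix.mul_assoc, hX, Matrix.mul_one]
    rw [h3] at h1
    conv_lhs => rw [h1]
    abel
  have hKn : ‖R - R'ᵀ‖ ≤ ‖F‖ + ‖F * R'‖ := by
    rw [hK]
    refine (norm_add_le _ _).trans (add_le_add ?_ ?_)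
    · refine (norm_mul_le' _ _).trans (mul_le_of_le_one_left (norm_nonneg _) ?_)
      rw [norm_transpose]
      exact norm_le_one_of_orthonormal hQ
    · refine (norm_mul_le' _ _).trans ?_
      rw [norm_transpose]
      exact mul_le_of_le_one_right (norm_nonneg _) (norm_le_one_of_orthonormal hX)
  have h1 : Q - X = Q * (1 - R) + F := by
    rw [Matrix.mul_sub, Matrix.mul_one, ← hF]
    abel
  rw [h1]
  refine (norm_add_le _ _).trans (add_le_add ?_ le_rfl)
  calc ‖Q * (1 - R)‖ ≤ ‖Q‖ * ‖1 - R‖ := norm_mul_le' _ _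
    _ ≤ ‖1 - R‖ := mul_le_of_le_one_left (norm_nonneg _) (norm_le_one_of_orthonormal hQ)
    _ ≤ frob (1 - R) := norm_le_frob _
    _ ≤ frob (R - R'ᵀ) := frob_one_sub_le_of_upperTriangular hR hR' h hd
    _ ≤ √k * ‖R - R'ᵀ‖ := frob_le_sqrt_mul_norm _
    _ ≤ _ := by gcongr

end QR

/-! ### Orthogonal Procrustes alignment -/

section Alignment

variable {d k : ℕ}

/-- The reflection in the hyperplane orthogonal to a vector `v`. -/
noncomputable def reflectionMatrix (v : Fin k → ℝ) : Matrix (Fin k) (Fin k) ℝ :=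
  1 - (2 / (v ⬝ᵥ v)) • vecMulVec v v

theorem reflectionMatrix_transpose (v : Fin k → ℝ) :
    (reflectionMatrix v)ᵀ = reflectionMatrix v := by
  simp [reflectionMatrix, transpose_vecMulVec]

theorem reflectionMatrix_mul_self {v : Fin k → ℝ} (hv : v ⬝ᵥ v ≠ 0) :
    reflectionMatrix v * reflectionMatrix v = 1 := by
  have h : vecMulVec v v * vecMulVec v v = (v ⬝ᵥ v) • vecMulVec v v := by
    rw [vecMulVec_mul_vecMulVec]
    ext i j
    simp [vecMulVec_apply]
    ring
  simp only [reflectionMatrix, Matrix.mul_sub, Matrix.sub_mul, Matrix.mul_one, Matrix.one_mul,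
    Matrix.smul_mul, Matrix.mul_smul, h, smul_smul]
  have h2 : 2 / (v ⬝ᵥ v) * (v ⬝ᵥ v) = 2 := div_mul_cancel₀ 2 hv
  rw [h2, two_smul, smul_sub, smul_add]
  abel

theorem trace_vecMulVec_mul (u v : Fin k → ℝ) (H : Matrix (Fin k) (Fin k) ℝ) :
    (vecMulVec u v * H).trace = v ⬝ᵥ (H *ᵥ u) := by
  rw [vecMulVec_mul, trace_vecMulVec, dotProduct_comm, ← dotProduct_mulVec]

/-- A matrix whose trace is not increased by any orthogonal matrix is positive semidefinite in the
sense of quadratic forms: test with a single reflection. -/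
theorem dotProduct_mulVec_nonneg_of_trace_le {H : Matrix (Fin k) (Fin k) ℝ}
    (h : ∀ Q : Matrix (Fin k) (Fin k) ℝ, Qᵀ * Q = 1 → (Qᵀ * H).trace ≤ H.trace)
    (v : Fin k → ℝ) : 0 ≤ v ⬝ᵥ (H *ᵥ v) := by
  by_cases hv : v ⬝ᵥ v = 0
  · rw [dotProduct_self_eq_zero] at hv
    simp [hv]
  have hpos : 0 < v ⬝ᵥ v := lt_of_le_of_ne (by simpa using dotProduct_self_star_nonneg v) (Ne.symm hv)
  have h1 := h (reflectionMatrix v) (by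
    rw [reflectionMatrix_transpose, reflectionMatrix_mul_self hv])
  rw [reflectionMatrix_transpose, reflectionMatrix, Matrix.sub_mul, Matrix.one_mul, trace_sub,
    Matrix.smul_mul, trace_smul, trace_vecMulVec_mul, smul_eq_mul] at h1
  have h2 : 0 ≤ 2 / (v ⬝ᵥ v) * (v ⬝ᵥ (H *ᵥ v)) := by linarith
  exact nonneg_of_mul_nonneg_right h2 (by positivity)

/-- A matrix whose trace is not increased by any orthogonal matrix is symmetric: test with the
product of two reflections, in `eᵢ` and in `eᵢ + s eⱼ`, and let `s → 0`. -/
theorem transpose_eq_of_trace_le {H : Matrix (Fin k) (Fin k) ℝ}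
    (h : ∀ Q : Matrix (Fin k) (Fin k) ℝ, Qᵀ * Q = 1 → (Qᵀ * H).trace ≤ H.trace) : Hᵀ = H := by
  have key : ∀ i j, i ≠ j → ∀ s : ℝ, s * (H j i - H i j) ≤ s ^ 2 * (H i i + H j j) := by
    intro i j hij s
    set u : Fin k → ℝ := Pi.single i 1 with hu
    set v : Fin k → ℝ := Pi.single i 1 + s • Pi.single j 1 with hv
    have huu : u ⬝ᵥ u = 1 := by simp [hu]
    have huv : u ⬝ᵥ v = 1 := by simp [hu, hv, hij]
    have hvv : v ⬝ᵥ v = 1 + s ^ 2 := by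
      simp [hv, dotProduct_add, hij, hij.symm]
      ring
    have huH : u ⬝ᵥ (H *ᵥ u) = H i i := by simp [hu]
    have hvHu : v ⬝ᵥ (H *ᵥ u) = H i i + s * H j i := by
      simp [hu, hv, add_dotProduct]
    have hvH : v ⬝ᵥ (H *ᵥ v) = H i i + s * (H i j + H j i) + s ^ 2 * H j j := by
      simp [hv, add_dotProduct, mulVec_add, mulVec_smul]
      ring
    have hs : (1 + s ^ 2 : ℝ) ≠ 0 := by positivity
    have h1 := h (reflectionMatrix v * reflectionMatrix u) (by
      rw [transpose_mul, reflectionMatrix_transpose, reflectionMatrix_transpose, Matrix.mul_assoc,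
        ← Matrix.mul_assoc (reflectionMatrix v), reflectionMatrix_mul_self (by rw [hvv]; exact hs),
        Matrix.one_mul, reflectionMatrix_mul_self (by rw [huu]; exact one_ne_zero)])
    rw [transpose_mul, reflectionMatrix_transpose, reflectionMatrix_transpose] at h1
    simp only [reflectionMatrix, Matrix.mul_sub, Matrix.sub_mul, Matrix.mul_one, Matrix.one_mul,
      Matrix.smul_mul, Matrix.mul_smul, vecMulVec_mul_vecMulVec, trace_sub, trace_smul,
      trace_vecMulVec_mul, smul_eq_mul, huu, hvv, huv, one_smul, huH, hvH, hvHu] at h1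
    field_simp at h1
    nlinarith
  ext i j
  rw [transpose_apply]
  by_cases hij : i = j
  · rw [hij]
  have aux : ∀ i j, i ≠ j → H j i ≤ H i j := by
    intro i j hij
    by_contra hlt
    push Not at hlt
    have hi : 0 ≤ H i i := by
      simpa using dotProduct_mulVec_nonneg_of_trace_le h (Pi.single i 1)
    have hj : 0 ≤ H j j := by
      simpa using dotProduct_mulVec_nonneg_of_trace_le h (Pi.single j 1)
    have h1 := key i j hij ((H j i - H i j) / (H i i + H j j + 1))
    set x := H j i - H i j
    set y := H i i + H j j
    have hx : 0 < x := sub_pos.mpr hlt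
    have hy : 0 ≤ y := add_nonneg hi hj
    rw [div_pow, div_mul_eq_mul_div, div_mul_eq_mul_div, div_le_div_iff₀ (by positivity)
      (by positivity)] at h1
    have : x * x * (y + 1) * (y + 1) ≤ x * x * y * (y + 1) := by nlinarith
    have h3 : 0 < x * x * (y + 1) := by positivity
    nlinarith
  exact le_antisymm (aux i j hij) (aux j i (Ne.symm hij))

/-- A symmetric positive semidefinite matrix that expands norms by at least `c` is at least `c` as a
quadratic form. -/
theorem le_inner_of_le_norm {H : Matrix (Fin k) (Fin k) ℝ} (hs : Hᵀ = H)
    (hp : ∀ v : EuclideanSpace ℝ (Fin k), 0 ≤ inner ℝ v (H.toEuclideanLin v)) {c : ℝ}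
    (hc : ∀ v : EuclideanSpace ℝ (Fin k), c * ‖v‖ ≤ ‖H.toEuclideanLin v‖)
    (v : EuclideanSpace ℝ (Fin k)) : c * ‖v‖ ^ 2 ≤ inner ℝ v (H.toEuclideanLin v) := by
  have hsym : H.toEuclideanLin.IsSymmetric := fun x y => by
    rw [inner_toEuclideanLin_left, hs]
  have hn : Module.finrank ℝ (EuclideanSpace ℝ (Fin k)) = k := by simp
  set b := hsym.eigenvectorBasis hn with hb
  have hev : ∀ i, H.toEuclideanLin (b i) = hsym.eigenvalues hn i • b i := fun i =>
    hsym.apply_eigenvectorBasis hn i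
  have hlam : ∀ i, c ≤ hsym.eigenvalues hn i := by
    intro i
    have h1 := hp (b i)
    have h2 := hc (b i)
    rw [hev, inner_smul_right, real_inner_self_eq_norm_sq, b.norm_eq_one] at h1
    rw [hev, norm_smul, b.norm_eq_one, Real.norm_eq_abs, abs_of_nonneg (by simpa using h1)] at h2
    simpa using h2
  rw [← b.sum_inner_mul_inner v, ← real_inner_self_eq_norm_sq, ← b.sum_inner_mul_inner v v,
    Finset.mul_sum]
  refine Finset.sum_le_sum fun i _ => ?_
  have h3 : inner ℝ (b i) (H.toEuclideanLin v) = hsym.eigenvalues hn i * inner ℝ (b i) v := by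
    rw [← hsym, hev, inner_smul_left]
    simp
  rw [h3, real_inner_comm v (b i)]
  nlinarith [hlam i, mul_self_nonneg (inner ℝ v (b i))]

theorem transpose_mul_self_orthMat {D : Matrix (Fin k) (Fin k) ℝ} (hD : D ∈ orthMat k) :
    D * Dᵀ = 1 := mul_eq_one_comm.mp hD

theorem orthMat_mul {D D' : Matrix (Fin k) (Fin k) ℝ} (hD : D ∈ orthMat k) (hD' : D' ∈ orthMat k) :
    D * D' ∈ orthMat k := by
  change (D * D')ᵀ * (D * D') = 1
  rw [transpose_mul, Matrix.mul_assoc, ← Matrix.mul_assoc Dᵀ, show Dᵀ * D = 1 from hD,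
    Matrix.one_mul]
  exact hD'

theorem orthMat_transpose {D : Matrix (Fin k) (Fin k) ℝ} (hD : D ∈ orthMat k) : Dᵀ ∈ orthMat k := by
  change Dᵀᵀ * Dᵀ = 1
  rw [transpose_transpose]
  exact transpose_mul_self_orthMat hD

theorem orthonormal_mul_orthMat {X : Matrix (Fin d) (Fin k) ℝ} (hX : Xᵀ * X = 1)
    {D : Matrix (Fin k) (Fin k) ℝ} (hD : D ∈ orthMat k) : (X * D)ᵀ * (X * D) = 1 := by
  rw [transpose_mul, Matrix.mul_assoc, ← Matrix.mul_assoc Xᵀ, hX, Matrix.one_mul]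
  exact hD

theorem frob_sq_sub {X E : Matrix (Fin d) (Fin k) ℝ} (hX : Xᵀ * X = 1) (hE : Eᵀ * E = 1) :
    frob (X - E) ^ 2 = 2 * k - 2 * (Xᵀ * E).trace := by
  have h : (Eᵀ * X).trace = (Xᵀ * E).trace := by
    rw [← trace_transpose, transpose_mul, transpose_transpose]
  rw [frob_sq, transpose_sub, Matrix.sub_mul, Matrix.mul_sub, Matrix.mul_sub, hX, hE]
  simp only [trace_sub, trace_one, h, Fintype.card_fin]
  ring

theorem norm_sq_sub_toEuclideanLin {X E : Matrix (Fin d) (Fin k) ℝ} (hX : Xᵀ * X = 1)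
    (hE : Eᵀ * E = 1) (w : EuclideanSpace ℝ (Fin k)) :
    ‖(X - E).toEuclideanLin w‖ ^ 2 =
      2 * ‖w‖ ^ 2 - 2 * inner ℝ w ((Xᵀ * E).toEuclideanLin w) := by
  rw [map_sub, LinearMap.sub_apply, norm_sub_sq_real, norm_toEuclideanLin_of_orthonormal hX,
    norm_toEuclideanLin_of_orthonormal hE, inner_toEuclideanLin_left, ← toEuclideanLin_mul_apply]
  ring

variable {X E : Matrix (Fin d) (Fin k) ℝ} {D : Matrix (Fin k) (Fin k) ℝ}

theorem IsAlignment.trace_le (h : IsAlignment (orthMat k) X E D) (hX : Xᵀ * X = 1)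
    (hE : Eᵀ * E = 1) (Q : Matrix (Fin k) (Fin k) ℝ) (hQ : Qᵀ * Q = 1) :
    (Qᵀ * (Dᵀ * Xᵀ * E)).trace ≤ (Dᵀ * Xᵀ * E).trace := by
  have hDQ : D * Q ∈ orthMat k := orthMat_mul h.1.2 hQ
  have h1 := pow_le_pow_left₀ (frob_nonneg _) (h.2 (D * Q) ⟨hDQ, hDQ⟩) 2
  rw [frob_sq_sub (orthonormal_mul_orthMat hX h.1.2) hE,
    frob_sq_sub (orthonormal_mul_orthMat hX hDQ) hE] at h1
  simp only [transpose_mul, ← Matrix.mul_assoc] at h1 ⊢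
  linarith

/-- Procrustes: if the cosines of the principal angles between two orthonormal bases (the singular
values of `Xᵀ E`) are at least `c`, then the aligned bases are at distance at most `√(2 - 2c)`.
Indeed `Dᵀ Xᵀ E` is then the positive semidefinite polar factor of `Xᵀ E`. -/
theorem IsAlignment.norm_sq_le (h : IsAlignment (orthMat k) X E D) (hX : Xᵀ * X = 1)
    (hE : Eᵀ * E = 1) {c : ℝ} (hc1 : c ≤ 1)
    (hc : ∀ w, c * ‖w‖ ≤ ‖(Xᵀ * E).toEuclideanLin w‖) : ‖X * D - E‖ ^ 2 ≤ 2 - 2 * c := by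
  have htr := h.trace_le hX hE
  have hsym := transpose_eq_of_trace_le htr
  have hpos : ∀ v : EuclideanSpace ℝ (Fin k),
      0 ≤ inner ℝ v ((Dᵀ * Xᵀ * E).toEuclideanLin v) := by
    intro v
    have := dotProduct_mulVec_nonneg_of_trace_le htr v
    rw [PiLp.inner_apply]
    simpa [dotProduct, mul_comm, Matrix.mul_assoc] using this
  have hnorm : ∀ v : EuclideanSpace ℝ (Fin k),
      c * ‖v‖ ≤ ‖(Dᵀ * Xᵀ * E).toEuclideanLin v‖ := by
    intro v
    rw [Matrix.mul_assoc, toEuclideanLin_mul_apply,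
      norm_toEuclideanLin_of_orthonormal (orthMat_transpose h.1.2)]
    exact hc v
  have hlow := le_inner_of_le_norm hsym hpos hnorm
  have hb : ‖X * D - E‖ ≤ √(2 - 2 * c) := by
    refine l2_opNorm_le_bound (Real.sqrt_nonneg _) fun w => le_of_sq_le_sq ?_ (by positivity)
    rw [norm_sq_sub_toEuclideanLin (orthonormal_mul_orthMat hX h.1.2) hE, mul_pow,
      Real.sq_sqrt (by linarith), transpose_mul]
    linarith [hlow w]
  calc ‖X * D - E‖ ^ 2 ≤ √(2 - 2 * c) ^ 2 := by gcongr
    _ = _ := Real.sq_sqrt (by linarith)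

/-- Alignment in the Frobenius norm is also optimal in the spectral norm. -/
theorem IsAlignment.norm_le (h : IsAlignment (orthMat k) X E D) (hX : Xᵀ * X = 1)
    (hE : Eᵀ * E = 1) {D' : Matrix (Fin k) (Fin k) ℝ} (hD' : D' ∈ orthMat k) :
    ‖X * D - E‖ ≤ ‖X * D' - E‖ := by
  set r := ‖X * D' - E‖ with hr
  have h1 : ∀ w : EuclideanSpace ℝ (Fin k),
      (1 - r ^ 2 / 2) * ‖w‖ ≤ ‖(Xᵀ * E).toEuclideanLin w‖ := by
    intro w
    have h2 := norm_sq_sub_toEuclideanLin (orthonormal_mul_orthMat hX hD') hE w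
    have h3 := pow_le_pow_left₀ (norm_nonneg _) (norm_toEuclideanLin_le (X * D' - E) w) 2
    have h4 := real_inner_le_norm w (((X * D')ᵀ * E).toEuclideanLin w)
    rw [transpose_mul, Matrix.mul_assoc, toEuclideanLin_mul_apply] at h2 h4
    rw [norm_toEuclideanLin_of_orthonormal (orthMat_transpose hD')] at h4
    rw [← hr, mul_pow] at h3
    by_cases hw : ‖w‖ = 0
    · rw [hw]; simp
    have hw' : 0 < ‖w‖ := lt_of_le_of_ne (norm_nonneg _) (Ne.symm hw)
    refine le_of_mul_le_mul_left ?_ hw'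
    nlinarith
  have h5 := h.norm_sq_le hX hE (by nlinarith [sq_nonneg r]) h1
  exact le_of_sq_le_sq (by linarith) (norm_nonneg _)

theorem isCompact_orthMat : IsCompact (orthMat k) := by
  refine Metric.isCompact_of_isClosed_isBounded ?_ ?_
  · exact isClosed_eq (by fun_prop) continuous_const
  · refine (Metric.isBounded_closedBall (x := 0) (r := 1)).subset fun D hD => ?_
    rw [mem_closedBall_zero_iff]
    exact norm_le_one_of_orthonormal hD

theorem exists_isAlignment (X E : Matrix (Fin d) (Fin k) ℝ) :
    ∃ D, IsAlignment (orthMat k) X E D := by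
  have hc : Continuous fun D : Matrix (Fin k) (Fin k) ℝ => frob (X * D - E) := by
    unfold frob
    fun_prop
  obtain ⟨D, hD, hmin⟩ := isCompact_orthMat.exists_isMinOn ⟨1, by simp [orthMat]⟩ hc.continuousOn
  exact ⟨D, ⟨hD, hD⟩, fun D' hD' => hmin hD'.1⟩

end Alignment

/-! ### Alignment error and principal angles -/

section Subspaces

variable {d k : ℕ}

theorem toEuclideanLin_mem_colSpace (X : Matrix (Fin d) (Fin k) ℝ) (w : EuclideanSpace ℝ (Fin k)) :
    X.toEuclideanLin w ∈ colSpace X := LinearMap.mem_range_self _ w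

theorem norm_sq_eq_starProjection (V : Submodule ℝ (EuclideanSpace ℝ (Fin d)))
    (x : EuclideanSpace ℝ (Fin d)) :
    ‖x‖ ^ 2 = ‖V.starProjection x‖ ^ 2 + ‖x - V.starProjection x‖ ^ 2 := by
  rw [← Submodule.starProjection_orthogonal_val]
  exact Submodule.norm_sq_eq_add_norm_sq_starProjection x V

theorem norm_sub_starProjection_le (V : Submodule ℝ (EuclideanSpace ℝ (Fin d)))
    (x y : EuclideanSpace ℝ (Fin d)) (hy : y ∈ V) : ‖x - V.starProjection x‖ ≤ ‖x - y‖ := by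
  have h1 : V.starProjection y = y := Submodule.starProjection_eq_self_iff.mpr hy
  have h2 := norm_sq_eq_starProjection V (x - y)
  rw [map_sub, h1, sub_sub_sub_cancel_right] at h2
  refine le_of_sq_le_sq ?_ (norm_nonneg _)
  nlinarith [sq_nonneg ‖V.starProjection x - y‖]

theorem norm_sub_starProjection_le_norm (V : Submodule ℝ (EuclideanSpace ℝ (Fin d)))
    (x : EuclideanSpace ℝ (Fin d)) : ‖x - V.starProjection x‖ ≤ ‖x‖ := by
  simpa using norm_sub_starProjection_le V x 0 V.zero_mem

/-- For `E` with orthonormal columns, `Eᵀ` is the orthogonal projection onto the column space, in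
coordinates. -/
theorem norm_transpose_apply {E : Matrix (Fin d) (Fin k) ℝ} (hE : Eᵀ * E = 1)
    (x : EuclideanSpace ℝ (Fin d)) :
    ‖Eᵀ.toEuclideanLin x‖ = ‖(colSpace E).starProjection x‖ := by
  have h : (colSpace E).starProjection x = E.toEuclideanLin (Eᵀ.toEuclideanLin x) := by
    refine Submodule.eq_starProjection_of_mem_of_inner_eq_zero
      (toEuclideanLin_mem_colSpace E _) ?_
    rintro _ ⟨w, rfl⟩
    rw [real_inner_comm, inner_toEuclideanLin_left, map_sub, ← toEuclideanLin_mul_apply Eᵀ E, hE,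
      toEuclideanLin_one_apply, sub_self, inner_zero_right]
  rw [h, norm_toEuclideanLin_of_orthonormal hE]

theorem exists_orthonormal_colSpace_eq (V : Submodule ℝ (EuclideanSpace ℝ (Fin d)))
    (hV : Module.finrank ℝ V = k) :
    ∃ E : Matrix (Fin d) (Fin k) ℝ, Eᵀ * E = 1 ∧ colSpace E = V := by
  let b := (stdOrthonormalBasis ℝ V).reindex (finCongr hV)
  let f : EuclideanSpace ℝ (Fin k) →ₗ[ℝ] EuclideanSpace ℝ (Fin d) :=
    V.subtype ∘ₗ b.repr.symm.toLinearEquiv.toLinearMap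
  have hf : ∀ w, ‖f w‖ = ‖w‖ := fun w =>
    b.repr.symm.norm_map w
  refine ⟨Matrix.toEuclideanLin.symm f, ?_, ?_⟩
  · have hE : (Matrix.toEuclideanLin.symm f).toEuclideanLin = f := by simp
    set E := Matrix.toEuclideanLin.symm f with hEdef
    apply Matrix.toEuclideanLin.injective
    refine LinearMap.ext fun w => ext_inner_left ℝ fun v => ?_
    rw [toEuclideanLin_mul_apply, ← inner_toEuclideanLin_left, hE, toEuclideanLin_one_apply]
    exact LinearIsometry.inner_map_map ⟨f, hf⟩ v w
  · rw [colSpace]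
    simp only [LinearEquiv.apply_symm_apply]
    rw [LinearMap.range_comp_of_range_eq_top, Submodule.range_subtype]
    exact LinearEquiv.range _

variable {X E : Matrix (Fin d) (Fin k) ℝ} {D : Matrix (Fin k) (Fin k) ℝ}

/-- The alignment error is at most `√2` times the sine of the largest principal angle. -/
theorem IsAlignment.norm_le_sin (h : IsAlignment (orthMat k) X E D) (hX : Xᵀ * X = 1)
    (hE : Eᵀ * E = 1) {s : ℝ} (hs : 0 ≤ s)
    (hw : ∀ w, ‖E.toEuclideanLin w - (colSpace X).starProjection (E.toEuclideanLin w)‖ ≤ s * ‖w‖) :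
    ‖X * D - E‖ ≤ √2 * s := by
  have h1 : ‖X * D - E‖ ^ 2 ≤ 2 - 2 * (1 - s ^ 2) := by
    refine h.norm_sq_le hX hE (by nlinarith) fun w => ?_
    rw [toEuclideanLin_mul_apply, norm_transpose_apply hX]
    rcases le_total 1 (s ^ 2) with h2 | h2
    · exact (mul_nonpos_of_nonpos_of_nonneg (by linarith) (norm_nonneg _)).trans (norm_nonneg _)
    refine le_of_sq_le_sq ?_ (norm_nonneg _)
    have h3 := norm_sq_eq_starProjection (colSpace X) (E.toEuclideanLin w)
    rw [norm_toEuclideanLin_of_orthonormal hE] at h3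
    have h4 := pow_le_pow_left₀ (norm_nonneg _) (hw w) 2
    rw [mul_pow] at h4 ⊢
    have h5 : (1 - s ^ 2) ^ 2 ≤ 1 - s ^ 2 := by nlinarith
    nlinarith [mul_le_mul_of_nonneg_right h5 (sq_nonneg ‖w‖)]
  refine le_of_sq_le_sq ?_ (by positivity)
  rw [mul_pow, Real.sq_sqrt zero_le_two]
  linarith

/-- The alignment error is at most the tangent of the largest principal angle `θ`, because
`2 - 2 cos θ ≤ tan² θ`. -/
theorem IsAlignment.norm_le_tan (h : IsAlignment (orthMat k) X E D) (hX : Xᵀ * X = 1)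
    (hE : Eᵀ * E = 1) {τ : ℝ} (hτ : 0 ≤ τ)
    (hw : ∀ w, ‖E.toEuclideanLin w - (colSpace X).starProjection (E.toEuclideanLin w)‖ ≤
      τ * ‖(colSpace X).starProjection (E.toEuclideanLin w)‖) :
    ‖X * D - E‖ ≤ τ := by
  set c := (√(1 + τ ^ 2))⁻¹ with hc
  have hc0 : 0 < c := by positivity
  have hcc : c ^ 2 * (1 + τ ^ 2) = 1 := by
    rw [hc, inv_pow, Real.sq_sqrt (by positivity), inv_mul_cancel₀ (by positivity)]
  have hc1 : c ≤ 1 := by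
    refine le_of_sq_le_sq ?_ zero_le_one
    nlinarith [mul_nonneg (sq_nonneg c) (sq_nonneg τ)]
  have h1 : ‖X * D - E‖ ^ 2 ≤ 2 - 2 * c := by
    refine h.norm_sq_le hX hE hc1 fun w => ?_
    rw [toEuclideanLin_mul_apply, norm_transpose_apply hX]
    refine le_of_sq_le_sq ?_ (norm_nonneg _)
    have h3 := norm_sq_eq_starProjection (colSpace X) (E.toEuclideanLin w)
    rw [norm_toEuclideanLin_of_orthonormal hE] at h3
    have h4 := pow_le_pow_left₀ (norm_nonneg _) (hw w) 2
    rw [mul_pow] at h4 ⊢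
    set q := ‖(colSpace X).starProjection (E.toEuclideanLin w)‖ ^ 2
    have h5 : ‖w‖ ^ 2 ≤ (1 + τ ^ 2) * q := by linarith
    calc c ^ 2 * ‖w‖ ^ 2 ≤ c ^ 2 * ((1 + τ ^ 2) * q) := by gcongr
      _ = q := by rw [← mul_assoc, hcc, one_mul]
  refine le_of_sq_le_sq (h1.trans ?_) hτ
  have h6 : c ^ 2 * τ ^ 2 = 1 - c ^ 2 := by linarith
  have h7 : c ^ 2 * (2 - 2 * c) ≤ c ^ 2 * τ ^ 2 := by
    rw [h6]
    nlinarith [mul_nonneg (sub_nonneg.mpr hc1) (sub_nonneg.mpr hc1),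
      mul_nonneg hc0.le (mul_nonneg (sub_nonneg.mpr hc1) (sub_nonneg.mpr hc1))]
  exact le_of_mul_le_mul_left h7 (by positivity)

/-- Two matrices agree up to an orthogonal change of basis and an error of at most `r`. -/
def AlignedWithin (r : ℝ) (X E : Matrix (Fin d) (Fin k) ℝ) : Prop :=
  ∃ D ∈ orthMat k, ‖X * D - E‖ ≤ r

theorem AlignedWithin.symm {r : ℝ} (h : AlignedWithin r X E) : AlignedWithin r E X := by
  obtain ⟨D, hD, h⟩ := h
  refine ⟨Dᵀ, orthMat_transpose hD, ?_⟩
  have h1 : E * Dᵀ - X = (E - X * D) * Dᵀ := by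
    rw [Matrix.sub_mul, Matrix.mul_assoc X, transpose_mul_self_orthMat hD, Matrix.mul_one]
  rw [h1]
  refine (norm_mul_orthogonal (orthMat_transpose hD) _).trans ?_
  rwa [norm_sub_rev]

theorem AlignedWithin.trans {r s : ℝ} {W : Matrix (Fin d) (Fin k) ℝ} (h : AlignedWithin r X E)
    (h' : AlignedWithin s E W) : AlignedWithin (r + s) X W := by
  obtain ⟨D, hD, h⟩ := h
  obtain ⟨D', hD', h'⟩ := h'
  refine ⟨D * D', orthMat_mul hD hD', ?_⟩
  have h1 : X * (D * D') - W = (X * D - E) * D' + (E * D' - W) := by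
    rw [Matrix.sub_mul, Matrix.mul_assoc]
    abel
  rw [h1]
  exact (norm_add_le _ _).trans (add_le_add ((norm_mul_orthogonal hD' _).trans h) h')

theorem IsAlignment.norm_le_of_alignedWithin (h : IsAlignment (orthMat k) X E D) (hX : Xᵀ * X = 1)
    (hE : Eᵀ * E = 1) {r : ℝ} (hr : AlignedWithin r X E) : ‖X * D - E‖ ≤ r := by
  obtain ⟨D', hD', hr⟩ := hr
  exact (h.norm_le hX hE hD').trans hr

theorem alignedWithin_of_sin (hX : Xᵀ * X = 1) (hE : Eᵀ * E = 1) {s : ℝ} (hs : 0 ≤ s)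
    (hw : ∀ w, ‖X.toEuclideanLin w - (colSpace E).starProjection (X.toEuclideanLin w)‖ ≤ s * ‖w‖) :
    AlignedWithin (√2 * s) X E := by
  obtain ⟨D, hD⟩ := exists_isAlignment E X
  exact AlignedWithin.symm ⟨D, hD.1.2, hD.norm_le_sin hE hX hs hw⟩

theorem alignedWithin_of_tan (hX : Xᵀ * X = 1) (hE : Eᵀ * E = 1) {τ : ℝ} (hτ : 0 ≤ τ)
    (hw : ∀ w, ‖X.toEuclideanLin w - (colSpace E).starProjection (X.toEuclideanLin w)‖ ≤
      τ * ‖(colSpace E).starProjection (X.toEuclideanLin w)‖) :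
    AlignedWithin τ X E := by
  obtain ⟨D, hD⟩ := exists_isAlignment E X
  exact AlignedWithin.symm ⟨D, hD.1.2, hD.norm_le_tan hE hX hτ hw⟩

end Subspaces

/-! ### Sines and tangents of principal angles -/

section Angles

variable {d : ℕ} {U W : Submodule ℝ (EuclideanSpace ℝ (Fin d))}

/-- For subspaces of equal dimension, a bound `s < 1` on the distance of the unit vectors of `U` from
`W` also bounds the distance of the two projections. -/
theorem sinTheta_le (hdim : Module.finrank ℝ U = Module.finrank ℝ W) {s : ℝ} (hs0 : 0 ≤ s)
    (hs1 : s < 1) (h : ∀ u ∈ U, ‖u - W.starProjection u‖ ≤ s * ‖u‖) : sinTheta U W ≤ s := by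
  -- `P_W` maps `U` onto `W`, as it is injective there
  let f : U →ₗ[ℝ] W := W.orthogonalProjectionOnto.toLinearMap ∘ₗ U.subtype
  have hf : ∀ u : U, (f u : EuclideanSpace ℝ (Fin d)) = W.starProjection (u : _) := fun u => rfl
  have hinj : Function.Injective f := by
    rw [← LinearMap.ker_eq_bot, LinearMap.ker_eq_bot']
    intro u hu
    have h1 := h u u.2
    rw [← hf, hu, Submodule.coe_zero, sub_zero] at h1
    have h2 : ‖(u : EuclideanSpace ℝ (Fin d))‖ = 0 := by
      nlinarith [norm_nonneg (u : EuclideanSpace ℝ (Fin d))]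
    exact Subtype.ext (norm_eq_zero.mp h2)
  have hsurj : Function.Surjective f :=
    (LinearMap.injective_iff_surjective_of_finrank_eq_finrank hdim).mp hinj
  have hWU : ∀ w ∈ W, ‖w - U.starProjection w‖ ≤ s * ‖w‖ := by
    intro w hw
    obtain ⟨u, hu⟩ := hsurj ⟨w, hw⟩
    have hu' : W.starProjection (u : EuclideanSpace ℝ (Fin d)) = w := by
      rw [← hf, hu]
    have h1 := h u u.2
    have h2 := norm_sq_eq_starProjection W (u : EuclideanSpace ℝ (Fin d))
    rw [hu'] at h1 h2
    have h1' := pow_le_pow_left₀ (norm_nonneg _) h1 2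
    -- `⟪w, u⟫ = ‖w‖²`, so the multiple of `u` closest to `w` is already close enough
    have h3 : inner ℝ w (u : EuclideanSpace ℝ (Fin d)) = ‖w‖ ^ 2 := by
      have := Submodule.starProjection_inner_eq_zero (K := W) (u : EuclideanSpace ℝ (Fin d)) w hw
      rw [hu', inner_sub_left, real_inner_self_eq_norm_sq, real_inner_comm] at this
      linarith
    by_cases hw0 : ‖w‖ = 0
    · rw [norm_eq_zero.mp hw0]; simp
    set c := ‖w‖ ^ 2 / ‖(u : EuclideanSpace ℝ (Fin d))‖ ^ 2 with hc
    have hupos : 0 < ‖(u : EuclideanSpace ℝ (Fin d))‖ ^ 2 := by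
      have : 0 < ‖w‖ ^ 2 := by positivity
      nlinarith [sq_nonneg ‖(u : EuclideanSpace ℝ (Fin d)) - w‖]
    refine (norm_sub_starProjection_le U w (c • (u : _)) (U.smul_mem c u.2)).trans ?_
    refine le_of_sq_le_sq ?_ (by positivity)
    rw [norm_sub_sq_real, inner_smul_right, h3, norm_smul, mul_pow, Real.norm_eq_abs, sq_abs,
      mul_pow]
    have h4 : c * ‖(u : EuclideanSpace ℝ (Fin d))‖ ^ 2 = ‖w‖ ^ 2 := by
      rw [hc, div_mul_cancel₀ _ hupos.ne']
    have h5 : 1 - s ^ 2 ≤ c := by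
      rw [hc, le_div_iff₀ hupos]
      rw [mul_pow] at h1'
      linarith
    nlinarith [sq_nonneg ‖w‖]
  refine ContinuousLinearMap.opNorm_le_bound _ hs0 fun x => ?_
  -- `P_U - P_W = P_U (1 - P_W) - (1 - P_U) P_W`, and the two terms have orthogonal ranges
  have hUW : ∀ y, W.starProjection y = 0 → ‖U.starProjection y‖ ≤ s * ‖y‖ := by
    intro y hy
    set u := U.starProjection y with hu
    have hmem : u ∈ U := Submodule.starProjection_apply_mem U y
    have h1 : inner ℝ u u = inner ℝ (u - W.starProjection u) y := by
      have h2 := Submodule.starProjection_inner_eq_zero (K := U) y u hmem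
      have h3 : inner ℝ (W.starProjection u) y = 0 := by
        rw [Submodule.inner_starProjection_left_eq_right, hy, inner_zero_right]
      rw [inner_sub_left, h3, sub_zero]
      rw [← hu, inner_sub_left, real_inner_comm] at h2
      linarith
    rw [real_inner_self_eq_norm_sq] at h1
    have h4 : ‖u‖ ^ 2 ≤ s * ‖u‖ * ‖y‖ := by
      rw [h1]
      exact (real_inner_le_norm _ _).trans (mul_le_mul_of_nonneg_right (h u hmem) (norm_nonneg _))
    by_cases hu0 : ‖u‖ = 0
    · rw [hu0]; positivity
    have : 0 < ‖u‖ := by positivity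
    nlinarith
  set a := U.starProjection (x - W.starProjection x) with ha
  set b := W.starProjection x - U.starProjection (W.starProjection x) with hb
  have hWW : W.starProjection (W.starProjection x) = W.starProjection x :=
    Submodule.starProjection_eq_self_iff.mpr (Submodule.starProjection_apply_mem W x)
  have hab : (U.starProjection - W.starProjection) x = a - b := by
    rw [ha, hb, map_sub]
    simp
  have horth : inner ℝ a b = 0 := by
    rw [real_inner_comm]
    exact Submodule.starProjection_inner_eq_zero _ _ (Submodule.starProjection_apply_mem U _)
  have hA : ‖a‖ ≤ s * ‖x - W.starProjection x‖ := hUW _ (by rw [map_sub, hWW, sub_self])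
  have hB : ‖b‖ ≤ s * ‖W.starProjection x‖ := hWU _ (Submodule.starProjection_apply_mem W x)
  rw [hab]
  refine le_of_sq_le_sq ?_ (by positivity)
  rw [norm_sub_sq_real, horth, mul_pow, norm_sq_eq_starProjection W x]
  have hA2 := pow_le_pow_left₀ (norm_nonneg _) hA 2
  have hB2 := pow_le_pow_left₀ (norm_nonneg _) hB 2
  rw [mul_pow] at hA2 hB2
  linarith

/-- For subspaces of equal dimension, the tangent of the largest principal angle is bounded by any
`τ` with `‖P_{W⊥} u‖ ≤ τ ‖P_W u‖` on `U`. -/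
theorem tanTheta_le (hdim : Module.finrank ℝ U = Module.finrank ℝ W) {τ : ℝ} (hτ : 0 ≤ τ)
    (h : ∀ u ∈ U, ‖u - W.starProjection u‖ ≤ τ * ‖W.starProjection u‖) :
    tanTheta U W ≤ ENNReal.ofReal τ := by
  have h1 : sinTheta U W ≤ τ / √(1 + τ ^ 2) := by
    refine sinTheta_le hdim (by positivity) ?_ fun u hu => ?_
    · rw [div_lt_one (by positivity)]
      refine Real.lt_sqrt_of_sq_lt ?_
      linarith
    · refine le_of_sq_le_sq ?_ (by positivity)
      rw [mul_pow, div_pow, Real.sq_sqrt (by positivity), norm_sq_eq_starProjection W u,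
        div_mul_eq_mul_div, le_div_iff₀ (by positivity)]
      have h2 := pow_le_pow_left₀ (norm_nonneg _) (h u hu) 2
      rw [mul_pow] at h2
      linarith
  have h0 : 0 ≤ sinTheta U W := norm_nonneg _
  have h2 := pow_le_pow_left₀ h0 h1 2
  rw [div_pow, Real.sq_sqrt (by positivity), le_div_iff₀ (by positivity)] at h2
  have h3 : 0 < 1 - sinTheta U W ^ 2 := by
    by_contra h4
    nlinarith [sq_nonneg τ]
  refine ENNReal.div_le_of_le_mul ?_
  rw [← ENNReal.ofReal_mul hτ]
  refine ENNReal.ofReal_le_ofReal (le_of_sq_le_sq ?_ (by positivity))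
  rw [mul_pow, Real.sq_sqrt h3.le]
  linarith

/-- A finite tangent gives the corresponding inequality between the components of vectors of `U`. -/
theorem norm_sub_le_tanTheta (h : tanTheta U W ≠ ∞) {u : EuclideanSpace ℝ (Fin d)} (hu : u ∈ U) :
    ‖u - W.starProjection u‖ ≤ (tanTheta U W).toReal * ‖W.starProjection u‖ := by
  have h0 : 0 ≤ sinTheta U W := norm_nonneg _
  have h1 : ‖u - W.starProjection u‖ ≤ sinTheta U W * ‖u‖ := by
    have h2 := (U.starProjection - W.starProjection).le_opNorm u
    rw [_root_.sub_apply, Submodule.starProjection_eq_self_iff.mpr hu] at h2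
    exact h2
  have h3 : 0 < 1 - sinTheta U W ^ 2 := by
    by_contra h4
    apply h
    have h5 : 1 ≤ sinTheta U W := by nlinarith
    rw [tanTheta, Real.sqrt_eq_zero_of_nonpos (not_lt.mp h4), ENNReal.ofReal_zero,
      ENNReal.div_zero]
    exact (ENNReal.ofReal_pos.mpr (by linarith)).ne'
  rw [tanTheta, ENNReal.toReal_div, ENNReal.toReal_ofReal h0,
    ENNReal.toReal_ofReal (Real.sqrt_nonneg _)]
  refine le_of_sq_le_sq ?_ (by positivity)
  have h6 := pow_le_pow_left₀ (norm_nonneg _) h1 2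
  rw [mul_pow, norm_sq_eq_starProjection W u] at h6
  rw [mul_pow, div_pow, Real.sq_sqrt h3.le, div_mul_eq_mul_div, le_div_iff₀ h3]
  linarith

end Angles

/-! ### Singular values and top eigenspaces of positive semidefinite matrices -/

section Spectral

variable {d k : ℕ} {A B : Matrix (Fin d) (Fin d) ℝ}

theorem sigma_nonneg (A : Matrix (Fin d) (Fin d) ℝ) (j : ℕ) : 0 ≤ sigma A j :=
  LinearMap.singularValues_nonneg _ _

theorem sigma_anti (A : Matrix (Fin d) (Fin d) ℝ) {i j : ℕ} (h : i ≤ j) : sigma A j ≤ sigma A i :=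
  LinearMap.singularValues_antitone _ (Nat.sub_le_sub_right h 1)

theorem sigma_eq_zero_of_lt (A : Matrix (Fin d) (Fin d) ℝ) {j : ℕ} (h : d < j) : sigma A j = 0 :=
  LinearMap.singularValues_of_finrank_le _ (by simp; omega)

theorem inner_toEuclideanLin_symm (hA : Aᵀ = A) (x y : EuclideanSpace ℝ (Fin d)) :
    inner ℝ (A.toEuclideanLin x) y = inner ℝ x (A.toEuclideanLin y) := by
  rw [inner_toEuclideanLin_left, hA]

theorem PosSemidef.transpose_eq (hA : A.PosSemidef) : Aᵀ = A := by
  rw [← conjTranspose_eq_transpose_of_trivial]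
  exact hA.isHermitian

theorem PosSemidef.inner_nonneg (hA : A.PosSemidef) (x : EuclideanSpace ℝ (Fin d)) :
    0 ≤ inner ℝ x (A.toEuclideanLin x) := by
  have := (Matrix.isPositive_toEuclideanLin_iff.mpr hA).re_inner_nonneg_right x
  simpa using this

/-- A positive semidefinite matrix is diagonal in some orthonormal basis, with its singular values on
the diagonal: an eigenvector of `AᵀA = A²` with eigenvalue `σ²` is one of `A` with eigenvalue `σ`,
because `A + σ` is injective for `σ > 0`. -/
theorem exists_eigenbasis (hA : A.PosSemidef) :
    ∃ b : OrthonormalBasis (Fin d) ℝ (EuclideanSpace ℝ (Fin d)),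
      ∀ i, A.toEuclideanLin (b i) = sigma A (i + 1) • b i := by
  set T := A.toEuclideanLin with hT
  have hsym := PosSemidef.transpose_eq hA
  have hn : Module.finrank ℝ (EuclideanSpace ℝ (Fin d)) = d := by simp
  have hTT := T.isSymmetric_adjoint_comp_self
  have hadj : ∀ y, LinearMap.adjoint T y = T y := fun y => by
    rw [hT, ← Matrix.toEuclideanLin_conjTranspose_eq_adjoint,
      conjTranspose_eq_transpose_of_trivial, hsym]
  refine ⟨hTT.eigenvectorBasis hn, fun i => ?_⟩
  set b := hTT.eigenvectorBasis hn
  set s := sigma A (i + 1) with hs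
  have hs0 : 0 ≤ s := sigma_nonneg A _
  have h1 : T (T (b i)) = s ^ 2 • b i := by
    have h2 := hTT.apply_eigenvectorBasis hn i
    rw [LinearMap.comp_apply, ← T.sq_singularValues_fin hn i] at h2
    rw [← hadj (T (b i))]
    exact h2
  rcases hs0.eq_or_lt with h0 | h0
  · rw [← h0, zero_pow two_ne_zero, zero_smul] at h1
    rw [← h0, zero_smul, ← inner_self_eq_zero (𝕜 := ℝ), hT, inner_toEuclideanLin_symm hsym, ← hT, h1,
      inner_zero_right]
  · set y := T (b i) - s • b i with hy
    have h3 : T y = -(s • y) := by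
      rw [hy, map_sub, map_smul, h1, smul_sub, smul_smul, sq]
      abel
    have h4 := PosSemidef.inner_nonneg hA y
    rw [← hT, h3, inner_neg_right, inner_smul_right, real_inner_self_eq_norm_sq] at h4
    have h5 : ‖y‖ = 0 := by
      by_contra h6
      have : 0 < ‖y‖ ^ 2 := by positivity
      nlinarith
    exact sub_eq_zero.mp (norm_eq_zero.mp h5)

variable {b : OrthonormalBasis (Fin d) ℝ (EuclideanSpace ℝ (Fin d))}

theorem inner_eigenbasis (hA : Aᵀ = A)
    (hb : ∀ i, A.toEuclideanLin (b i) = sigma A (i + 1) • b i) (i : Fin d)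
    (x : EuclideanSpace ℝ (Fin d)) :
    inner ℝ (b i) (A.toEuclideanLin x) = sigma A (i + 1) * inner ℝ (b i) x := by
  rw [← inner_toEuclideanLin_symm hA, hb, inner_smul_left]
  simp

theorem norm_le_of_coords (hA : Aᵀ = A) (hb : ∀ i, A.toEuclideanLin (b i) = sigma A (i + 1) • b i)
    {x : EuclideanSpace ℝ (Fin d)} {c : ℝ} (hc : 0 ≤ c)
    (h : ∀ i, inner ℝ (b i) x ≠ 0 → sigma A (i + 1) ≤ c) : ‖A.toEuclideanLin x‖ ≤ c * ‖x‖ := by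
  refine le_of_sq_le_sq ?_ (by positivity)
  rw [mul_pow, ← b.sum_sq_inner_right, ← b.sum_sq_inner_right x, Finset.mul_sum]
  refine Finset.sum_le_sum fun i _ => ?_
  rw [inner_eigenbasis hA hb, mul_pow]
  by_cases h0 : inner ℝ (b i) x = 0
  · simp [h0]
  · have := h i h0
    have := sigma_nonneg A (i + 1)
    gcongr

theorem le_norm_of_coords (hA : Aᵀ = A) (hb : ∀ i, A.toEuclideanLin (b i) = sigma A (i + 1) • b i)
    {x : EuclideanSpace ℝ (Fin d)} {c : ℝ} (hc : 0 ≤ c)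
    (h : ∀ i, inner ℝ (b i) x ≠ 0 → c ≤ sigma A (i + 1)) : c * ‖x‖ ≤ ‖A.toEuclideanLin x‖ := by
  refine le_of_sq_le_sq ?_ (by positivity)
  rw [mul_pow, ← b.sum_sq_inner_right, ← b.sum_sq_inner_right (A.toEuclideanLin x), Finset.mul_sum]
  refine Finset.sum_le_sum fun i _ => ?_
  rw [inner_eigenbasis hA hb, mul_pow]
  by_cases h0 : inner ℝ (b i) x = 0
  · simp [h0]
  · have := h i h0
    gcongr

theorem norm_eq_sigma_one (hA : A.PosSemidef) : ‖A‖ = sigma A 1 := by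
  obtain ⟨b, hb⟩ := exists_eigenbasis hA
  have hs := PosSemidef.transpose_eq hA
  refine le_antisymm (l2_opNorm_le_bound (sigma_nonneg A 1) fun v =>
    norm_le_of_coords hs hb (sigma_nonneg A 1) fun i _ => sigma_anti A (by omega)) ?_
  rcases Nat.eq_zero_or_pos d with rfl | hd
  · rw [sigma_eq_zero_of_lt A one_pos]
    exact norm_nonneg _
  · have h := norm_toEuclideanLin_le A (b ⟨0, hd⟩)
    rw [hb, norm_smul, b.norm_eq_one, mul_one, mul_one, Real.norm_eq_abs,
      abs_of_nonneg (sigma_nonneg A _)] at h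
    exact h

/-- Weyl's inequality for the singular values of positive semidefinite matrices. -/
theorem sigma_le_sigma_add (hA : A.PosSemidef) (hB : B.PosSemidef) {j : ℕ} (hj : 1 ≤ j) :
    sigma A j ≤ sigma B j + ‖A - B‖ := by
  have h0 := sigma_nonneg B j
  rcases lt_or_ge d j with hd | hd
  · rw [sigma_eq_zero_of_lt A hd]
    positivity
  obtain ⟨a, ha⟩ := exists_eigenbasis hA
  obtain ⟨b, hb⟩ := exists_eigenbasis hB
  -- a nonzero vector in the span of the first `j` vectors of `a` that is orthogonal to the first
  -- `j - 1` vectors of `b`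
  let f : (Fin j → ℝ) →ₗ[ℝ] EuclideanSpace ℝ (Fin d) :=
    Fintype.linearCombination ℝ fun i : Fin j => a (Fin.castLE hd i)
  let g : (Fin j → ℝ) →ₗ[ℝ] (Fin (j - 1) → ℝ) :=
    LinearMap.pi fun i => (innerₛₗ ℝ (b ⟨i, by omega⟩)) ∘ₗ f
  obtain ⟨c, hc, hc0⟩ := Submodule.exists_mem_ne_zero_of_ne_bot
    (LinearMap.ker_ne_bot_of_finrank_lt (f := g) (by simp; omega))
  have hcoord : ∀ i, inner ℝ (a i) (f c) = if h : (i : ℕ) < j then c ⟨i, h⟩ else 0 := by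
    intro i
    simp only [f, Fintype.linearCombination_apply, inner_sum, inner_smul_right]
    split_ifs with h
    · rw [Finset.sum_eq_single ⟨i, h⟩]
      · rw [show Fin.castLE hd ⟨i, h⟩ = i from rfl, real_inner_self_eq_norm_sq, a.norm_eq_one]
        simp
      · intro l _ hl
        rw [a.inner_eq_zero (by rintro rfl; exact hl rfl), mul_zero]
      · simp
    · refine Finset.sum_eq_zero fun l _ => ?_
      rw [a.inner_eq_zero (by rintro rfl; exact h l.2), mul_zero]
  have hx0 : f c ≠ 0 := by
    intro h
    apply hc0
    ext i
    have := hcoord (Fin.castLE hd i)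
    rw [h, inner_zero_right] at this
    simpa using this.symm
  have hxb : ∀ i : Fin d, (i : ℕ) < j - 1 → inner ℝ (b i) (f c) = 0 := fun i hi =>
    congr_fun (LinearMap.mem_ker.mp hc) ⟨i, hi⟩
  set x := f c
  have h1 : sigma A j * ‖x‖ ≤ ‖A.toEuclideanLin x‖ := by
    refine le_norm_of_coords (PosSemidef.transpose_eq hA) ha (sigma_nonneg A j) fun i hi => ?_
    refine sigma_anti A ?_
    rw [hcoord] at hi
    by_contra h
    rw [dif_neg (by omega)] at hi
    exact hi rfl
  have h2 : ‖B.toEuclideanLin x‖ ≤ sigma B j * ‖x‖ := by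
    refine norm_le_of_coords (PosSemidef.transpose_eq hB) hb h0 fun i hi => sigma_anti B ?_
    by_contra h
    exact hi (hxb i (by omega))
  have h3 := norm_toEuclideanLin_le (A - B) x
  rw [map_sub, LinearMap.sub_apply] at h3
  have h4 := norm_sub_norm_le (A.toEuclideanLin x) (B.toEuclideanLin x)
  have hx : 0 < ‖x‖ := norm_pos_iff.mpr hx0
  refine le_of_mul_le_mul_right ?_ hx
  linarith

/-- With a gap after the `k`-th singular value, the top eigenspace consists of the vectors whose
coordinates beyond the `k`-th vanish. -/
theorem mem_topEigenspace_iff (hA : A.PosSemidef)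
    (hb : ∀ i, A.toEuclideanLin (b i) = sigma A (i + 1) • b i)
    (hgap : sigma A (k + 1) < sigma A k) (x : EuclideanSpace ℝ (Fin d)) :
    x ∈ topEigenspace A k ↔ ∀ i : Fin d, k ≤ i → inner ℝ (b i) x = 0 := by
  have hs := PosSemidef.transpose_eq hA
  constructor
  · intro hx i hi
    have hle : topEigenspace A k ≤ LinearMap.ker (innerₛₗ ℝ (b i)) := by
      refine iSup_le fun μ y hy => ?_
      rw [Module.End.mem_eigenspace_iff] at hy
      have h1 := inner_eigenbasis hs hb i y
      rw [hy, inner_smul_right] at h1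
      have h2 : sigma A (i + 1) < μ :=
        lt_of_le_of_lt (sigma_anti A (by omega)) (lt_of_lt_of_le hgap μ.2)
      have h3 : ((μ : ℝ) - sigma A (i + 1)) * inner ℝ (b i) y = 0 := by linarith
      exact (mul_eq_zero.mp h3).resolve_left (sub_pos.mpr h2).ne'
    exact hle hx
  · intro hx
    rw [← b.sum_repr' x]
    refine Submodule.sum_mem _ fun i _ => ?_
    by_cases hi : k ≤ i
    · rw [hx i hi, zero_smul]
      exact Submodule.zero_mem _
    · refine Submodule.smul_mem _ _ ?_
      refine Submodule.mem_iSup_of_mem ⟨sigma A (i + 1), sigma_anti A (by omega)⟩ ?_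
      rw [Module.End.mem_eigenspace_iff]
      exact hb i

theorem sigma_mul_norm_le (hA : A.PosSemidef)
    (hgap : sigma A (k + 1) < sigma A k) {x : EuclideanSpace ℝ (Fin d)} (hx : x ∈ topEigenspace A k) :
    sigma A k * ‖x‖ ≤ ‖A.toEuclideanLin x‖ := by
  obtain ⟨b, hb⟩ := exists_eigenbasis hA
  refine le_norm_of_coords (PosSemidef.transpose_eq hA) hb (sigma_nonneg A k) fun i hi => ?_
  refine sigma_anti A ?_
  by_contra h
  exact hi ((mem_topEigenspace_iff hA hb hgap x).mp hx i (by omega))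

theorem norm_le_sigma_mul (hA : A.PosSemidef)
    (hgap : sigma A (k + 1) < sigma A k) {x : EuclideanSpace ℝ (Fin d)} (hx : x ∈ (topEigenspace A k)ᗮ) :
    ‖A.toEuclideanLin x‖ ≤ sigma A (k + 1) * ‖x‖ := by
  obtain ⟨b, hb⟩ := exists_eigenbasis hA
  refine norm_le_of_coords (PosSemidef.transpose_eq hA) hb (sigma_nonneg A _) fun i hi => ?_
  refine sigma_anti A ?_
  by_contra h
  refine hi (Submodule.inner_right_of_mem_orthogonal ?_ hx)
  rw [mem_topEigenspace_iff hA hb hgap]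
  intro l hl
  exact b.inner_eq_zero (by rintro rfl; omega)

theorem toEuclideanLin_mem_topEigenspace (hA : A.PosSemidef)
    (hgap : sigma A (k + 1) < sigma A k) {x : EuclideanSpace ℝ (Fin d)}
    (hx : x ∈ topEigenspace A k) : A.toEuclideanLin x ∈ topEigenspace A k := by
  obtain ⟨b, hb⟩ := exists_eigenbasis hA
  rw [mem_topEigenspace_iff hA hb hgap] at hx ⊢
  intro i hi
  rw [inner_eigenbasis (PosSemidef.transpose_eq hA) hb, hx i hi, mul_zero]

theorem starProjection_topEigenspace_comm (hA : A.PosSemidef)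
    (hgap : sigma A (k + 1) < sigma A k) (x : EuclideanSpace ℝ (Fin d)) :
    (topEigenspace A k).starProjection (A.toEuclideanLin x) =
      A.toEuclideanLin ((topEigenspace A k).starProjection x) := by
  refine Submodule.eq_starProjection_of_mem_of_inner_eq_zero
    (toEuclideanLin_mem_topEigenspace hA hgap (Submodule.starProjection_apply_mem _ x)) ?_
  intro w hw
  rw [← map_sub, inner_toEuclideanLin_symm (PosSemidef.transpose_eq hA)]
  exact Submodule.starProjection_inner_eq_zero _ _ (toEuclideanLin_mem_topEigenspace hA hgap hw)

theorem sigma_mul_norm_starProjection_le (hA : A.PosSemidef)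
    (hgap : sigma A (k + 1) < sigma A k) (x : EuclideanSpace ℝ (Fin d)) :
    sigma A k * ‖(topEigenspace A k).starProjection x‖ ≤
      ‖(topEigenspace A k).starProjection (A.toEuclideanLin x)‖ := by
  rw [starProjection_topEigenspace_comm hA hgap]
  exact sigma_mul_norm_le hA hgap (Submodule.starProjection_apply_mem _ x)

theorem norm_sub_starProjection_le_sigma_mul (hA : A.PosSemidef)
    (hgap : sigma A (k + 1) < sigma A k) (x : EuclideanSpace ℝ (Fin d)) :
    ‖A.toEuclideanLin x - (topEigenspace A k).starProjection (A.toEuclideanLin x)‖ ≤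
      sigma A (k + 1) * ‖x - (topEigenspace A k).starProjection x‖ := by
  rw [starProjection_topEigenspace_comm hA hgap, ← map_sub]
  exact norm_le_sigma_mul hA hgap (Submodule.sub_starProjection_mem_orthogonal x)

theorem le_of_sigma_gap (hgap : sigma A (k + 1) < sigma A k) : k ≤ d := by
  by_contra h
  rw [sigma_eq_zero_of_lt A (not_le.mp h)] at hgap
  exact absurd (sigma_nonneg A (k + 1)) (not_le.mpr hgap)

theorem finrank_topEigenspace (hA : A.PosSemidef)
    (hgap : sigma A (k + 1) < sigma A k) : Module.finrank ℝ (topEigenspace A k) = k := by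
  obtain ⟨b, hb⟩ := exists_eigenbasis hA
  have hk := le_of_sigma_gap hgap
  have hspan : topEigenspace A k =
      Submodule.span ℝ (Set.range fun i : Fin k => b (Fin.castLE hk i)) := by
    apply le_antisymm
    · intro x hx
      rw [mem_topEigenspace_iff hA hb hgap] at hx
      rw [← b.sum_repr' x]
      refine Submodule.sum_mem _ fun i _ => ?_
      by_cases hi : k ≤ i
      · rw [hx i hi, zero_smul]
        exact Submodule.zero_mem _
      · exact Submodule.smul_mem _ _ (Submodule.subset_span ⟨⟨i, by omega⟩, rfl⟩)
    · rw [Submodule.span_le]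
      rintro _ ⟨i, rfl⟩
      rw [SetLike.mem_coe, mem_topEigenspace_iff hA hb hgap]
      intro l hl
      refine b.inner_eq_zero ?_
      rintro rfl
      simp only [Fin.val_castLE] at hl
      omega
  rw [hspan, finrank_span_eq_card]
  · simp
  · exact b.orthonormal.linearIndependent.comp _ (Fin.castLE_injective hk)

/-- The `sin Θ` theorem of Davis and Kahan for top eigenspaces. With `Q` the projection onto the
complement of the second eigenspace and `P` the one onto the first, the operator `X = Q P` satisfies
`σ_k(A) ‖X‖ ≤ ‖X A‖ ≤ ‖B X‖ + ‖A - B‖ ≤ σ_{k+1}(B) ‖X‖ + ‖A - B‖`. -/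
theorem davis_kahan {k : ℕ} (hA : A.PosSemidef) (hB : B.PosSemidef)
    (hgA : sigma A (k + 1) < sigma A k) (hgB : sigma B (k + 1) < sigma B k)
    {x : EuclideanSpace ℝ (Fin d)} (hx : x ∈ topEigenspace A k) :
    (sigma A k - sigma B (k + 1)) * ‖x - (topEigenspace B k).starProjection x‖ ≤
      ‖A - B‖ * ‖x‖ := by
  set P := (topEigenspace A k).starProjection with hP
  set P' := (topEigenspace B k).starProjection with hP'
  set X : EuclideanSpace ℝ (Fin d) →L[ℝ] EuclideanSpace ℝ (Fin d) := P - P' ∘L P with hX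
  have hXapp : ∀ y, X y = P y - P' (P y) := fun y => rfl
  have hsA : 0 < sigma A k := (sigma_nonneg A _).trans_lt hgA
  -- on the top eigenspace, `A` is invertible
  have hsurj : ∀ y ∈ topEigenspace A k, ∃ z ∈ topEigenspace A k, A.toEuclideanLin z = y := by
    let f : topEigenspace A k →ₗ[ℝ] topEigenspace A k := A.toEuclideanLin.restrict
      fun y hy => toEuclideanLin_mem_topEigenspace hA hgA hy
    have hinj : Function.Injective f := by
      rw [← LinearMap.ker_eq_bot, LinearMap.ker_eq_bot']
      intro y hy
      have h1 := sigma_mul_norm_le hA hgA y.2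
      have h2 : A.toEuclideanLin (y : EuclideanSpace ℝ (Fin d)) = 0 := congr_arg Subtype.val hy
      rw [h2, norm_zero] at h1
      have h3 : ‖(y : EuclideanSpace ℝ (Fin d))‖ = 0 :=
        le_antisymm (nonpos_of_mul_nonpos_right h1 hsA) (norm_nonneg _)
      exact Subtype.ext (norm_eq_zero.mp h3)
    intro y hy
    obtain ⟨z, hz⟩ := LinearMap.injective_iff_surjective.mp hinj ⟨y, hy⟩
    exact ⟨z, z.2, congr_arg Subtype.val hz⟩
  have hPid : ∀ y ∈ topEigenspace A k, P y = y := fun y hy =>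
    Submodule.starProjection_eq_self_iff.mpr hy
  have hstep : ∀ y ∈ topEigenspace A k,
      sigma A k * ‖y - P' y‖ ≤ (sigma B (k + 1) * ‖X‖ + ‖A - B‖) * ‖y‖ := by
    intro y hy
    obtain ⟨z, hz, rfl⟩ := hsurj y hy
    have h1 : A.toEuclideanLin z - P' (A.toEuclideanLin z) =
        (B.toEuclideanLin z - P' (B.toEuclideanLin z)) +
          ((A - B).toEuclideanLin z - P' ((A - B).toEuclideanLin z)) := by
      rw [map_sub Matrix.toEuclideanLin A B, LinearMap.sub_apply, map_sub]
      abel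
    have h2 := norm_sub_starProjection_le_sigma_mul hB hgB z
    have h3 := (norm_sub_starProjection_le_norm (topEigenspace B k)
      ((A - B).toEuclideanLin z)).trans (norm_toEuclideanLin_le (A - B) z)
    have h4 : ‖z - P' z‖ ≤ ‖X‖ * ‖z‖ := by
      have := X.le_opNorm z
      rwa [hXapp, hPid z hz] at this
    have h5 : ‖A.toEuclideanLin z - P' (A.toEuclideanLin z)‖ ≤
        (sigma B (k + 1) * ‖X‖ + ‖A - B‖) * ‖z‖ := by
      rw [h1]
      refine (norm_add_le _ _).trans ?_
      have := mul_le_mul_of_nonneg_left h4 (sigma_nonneg B (k + 1))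
      linarith
    calc _ ≤ sigma A k * ((sigma B (k + 1) * ‖X‖ + ‖A - B‖) * ‖z‖) := by gcongr
      _ = (sigma B (k + 1) * ‖X‖ + ‖A - B‖) * (sigma A k * ‖z‖) := by ring
      _ ≤ _ := by
        have := sigma_nonneg B (k + 1)
        have := sigma_mul_norm_le hA hgA hz
        gcongr
  have hnorm : sigma A k * ‖X‖ ≤ sigma B (k + 1) * ‖X‖ + ‖A - B‖ := by
    have hnn := sigma_nonneg B (k + 1)
    have h1 : ‖X‖ ≤ (sigma B (k + 1) * ‖X‖ + ‖A - B‖) / sigma A k := by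
      refine ContinuousLinearMap.opNorm_le_bound _ (by positivity) fun y => ?_
      rw [hXapp, div_mul_eq_mul_div, le_div_iff₀ hsA, mul_comm]
      refine (hstep _ (Submodule.starProjection_apply_mem _ y)).trans ?_
      gcongr
      exact Submodule.norm_starProjection_apply_le _ y
    rwa [le_div_iff₀ hsA, mul_comm] at h1
  rcases le_or_gt (sigma A k - sigma B (k + 1)) 0 with h | h
  · exact (mul_nonpos_of_nonpos_of_nonneg h (norm_nonneg _)).trans (by positivity)
  · have h4 := X.le_opNorm x
    rw [hXapp, hPid x hx] at h4
    calc _ ≤ (sigma A k - sigma B (k + 1)) * (‖X‖ * ‖x‖) := by gcongr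
      _ = ((sigma A k - sigma B (k + 1)) * ‖X‖) * ‖x‖ := by ring
      _ ≤ _ := by
        refine mul_le_mul_of_nonneg_right ?_ (norm_nonneg _)
        linarith

end Spectral

/-! ### Local and global Gram matrices -/

section Data

variable {m d k : ℕ} {s : Fin m → ℕ} {A : (i : Fin m) → Matrix (Fin (s i)) (Fin d) ℝ}

theorem weight_nonneg (s : Fin m → ℕ) (i : Fin m) : 0 ≤ weight s i := by
  unfold weight
  positivity

theorem sum_weight (hs : ∀ i, 0 < s i) (b : Fin m) : ∑ i, weight s i = 1 := by
  have h : 0 < ∑ j, s j := Finset.sum_pos (fun i _ => hs i) ⟨b, Finset.mem_univ b⟩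
  have h' : ((∑ j, s j : ℕ) : ℝ) ≠ 0 := by exact_mod_cast h.ne'
  simp only [weight]
  rw [← Finset.sum_div, ← Nat.cast_sum, div_self h']

theorem localGram_posSemidef (A : (i : Fin m) → Matrix (Fin (s i)) (Fin d) ℝ) (i : Fin m) :
    (localGram A i).PosSemidef := by
  rw [localGram, ← conjTranspose_eq_transpose_of_trivial]
  exact (posSemidef_conjTranspose_mul_self (A i)).smul (by positivity)

theorem gram_posSemidef (A : (i : Fin m) → Matrix (Fin (s i)) (Fin d) ℝ) :
    (gram A).PosSemidef := by
  rw [gram, ← conjTranspose_eq_transpose_of_trivial]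
  exact (posSemidef_conjTranspose_mul_self (stacked A)).smul (by positivity)

theorem gram_eq_sum (hs : ∀ i, 0 < s i) : gram A = ∑ i, weight s i • localGram A i := by
  ext p q
  simp only [gram, localGram, weight, stacked, Matrix.smul_apply, Matrix.mul_apply,
    Matrix.transpose_apply, Matrix.sum_apply, smul_eq_mul, Fintype.sum_sigma, Finset.mul_sum]
  refine Finset.sum_congr rfl fun i _ => Finset.sum_congr rfl fun r _ => ?_
  have : (s i : ℝ) ≠ 0 := by exact_mod_cast (hs i).ne'
  field_simp

/-- The kernel of the global matrix lies in those of the local ones, since it is a positive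
combination of them. -/
theorem localGram_apply_eq_zero (hs : ∀ i, 0 < s i) {x : EuclideanSpace ℝ (Fin d)}
    (hx : (gram A).toEuclideanLin x = 0) (i : Fin m) : (localGram A i).toEuclideanLin x = 0 := by
  have hnn : ∀ j, 0 ≤ weight s j * inner ℝ x ((localGram A j).toEuclideanLin x) := fun j =>
    mul_nonneg (weight_nonneg s j) (PosSemidef.inner_nonneg (localGram_posSemidef A j) x)
  have hsum : ∑ j, weight s j * inner ℝ x ((localGram A j).toEuclideanLin x) = 0 := by
    rw [gram_eq_sum hs] at hx
    have := congr_arg (inner ℝ x) hx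
    simpa [LinearMap.sum_apply, inner_sum, inner_smul_right] using this
  have h0 := (Finset.sum_eq_zero_iff_of_nonneg fun j _ => hnn j).mp hsum i (Finset.mem_univ i)
  have hw : 0 < weight s i := by
    have h : 0 < ∑ j, s j := Finset.sum_pos (fun i _ => hs i) ⟨i, Finset.mem_univ i⟩
    have := hs i
    unfold weight
    positivity
  have h1 := (mul_eq_zero.mp h0).resolve_left hw.ne'
  obtain ⟨b, hb⟩ := exists_eigenbasis (localGram_posSemidef A i)
  have hsym := PosSemidef.transpose_eq (localGram_posSemidef A i)
  rw [← b.sum_inner_mul_inner] at h1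
  have h2 : ∀ j, inner ℝ x (b j) * inner ℝ (b j) ((localGram A i).toEuclideanLin x) =
      sigma (localGram A i) (j + 1) * inner ℝ (b j) x ^ 2 := fun j => by
    rw [inner_eigenbasis hsym hb, real_inner_comm (b j) x]
    ring
  simp only [h2] at h1
  rw [Finset.sum_eq_zero_iff_of_nonneg fun j _ =>
    mul_nonneg (sigma_nonneg _ _) (sq_nonneg _)] at h1
  rw [← norm_eq_zero, ← sq_eq_zero_iff, ← b.sum_sq_inner_right]
  refine Finset.sum_eq_zero fun j _ => ?_
  rw [inner_eigenbasis hsym hb, mul_pow, sq (sigma _ _), mul_assoc, h1 j (Finset.mem_univ j),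
    mul_zero]

variable {Mdag : Matrix (Fin d) (Fin d) ℝ}

theorem localGram_mul_pinv (hs : ∀ i, 0 < s i) (hM : IsMoorePenrose (gram A) Mdag) (i : Fin m) :
    localGram A i * (Mdag * gram A) = localGram A i := by
  apply Matrix.toEuclideanLin.injective
  refine LinearMap.ext fun x => ?_
  rw [toEuclideanLin_mul_apply, ← sub_eq_zero, ← map_sub]
  refine localGram_apply_eq_zero hs ?_ i
  rw [map_sub, ← toEuclideanLin_mul_apply, ← Matrix.mul_assoc, hM.mul_mul_left, sub_self]

theorem pinv_mul_localGram (hs : ∀ i, 0 < s i) (hM : IsMoorePenrose (gram A) Mdag) (i : Fin m) :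
    (Mdag * gram A) * localGram A i = localGram A i := by
  have h := congr_arg transpose (localGram_mul_pinv hs hM i)
  rwa [transpose_mul, hM.symm_right, PosSemidef.transpose_eq (localGram_posSemidef A i)] at h

theorem localGram_pow_mul_pinv (hs : ∀ i, 0 < s i) (hM : IsMoorePenrose (gram A) Mdag) (i : Fin m)
    {p : ℕ} (hp : 1 ≤ p) : localGram A i ^ p * (Mdag * gram A) = localGram A i ^ p := by
  obtain ⟨q, rfl⟩ := Nat.exists_eq_add_of_le' hp
  rw [pow_succ, Matrix.mul_assoc, localGram_mul_pinv hs hM]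

/-- On the range of the global matrix, the powers of the local matrices are bounded below. -/
theorem norm_pinv_le (hs : ∀ i, 0 < s i) (hM : IsMoorePenrose (gram A) Mdag) {η : ℝ}
    (hη : LocalApprox A η) (hκ : η * (‖gram A‖ * ‖Mdag‖) ≤ 1) (i : Fin m) (p : ℕ) (hp : 1 ≤ p)
    (x : EuclideanSpace ℝ (Fin d)) :
    (1 - η * (‖gram A‖ * ‖Mdag‖)) ^ p * ‖(Mdag * gram A).toEuclideanLin x‖ ≤
      ‖Mdag‖ ^ p * ‖(localGram A i ^ p).toEuclideanLin x‖ := by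
  set Q := Mdag * gram A with hQ
  set κ := ‖gram A‖ * ‖Mdag‖ with hκd
  have hQQ : Q * Q = Q := by
    rw [hQ, ← Matrix.mul_assoc, hM.mul_mul_right]
  have hone : ∀ y, (1 - η * κ) * ‖Q.toEuclideanLin y‖ ≤
      ‖Mdag‖ * ‖(localGram A i).toEuclideanLin y‖ := by
    intro y
    set z := Q.toEuclideanLin y with hz
    have h1 : (localGram A i).toEuclideanLin y = (localGram A i).toEuclideanLin z := by
      rw [hz, ← toEuclideanLin_mul_apply, localGram_mul_pinv hs hM]
    have h2 : ‖z‖ ≤ ‖Mdag‖ * ‖(gram A).toEuclideanLin z‖ := by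
      have h3 : z = Mdag.toEuclideanLin ((gram A).toEuclideanLin z) := by
        rw [← toEuclideanLin_mul_apply, hz, ← toEuclideanLin_mul_apply, hQQ]
      conv_lhs => rw [h3]
      exact norm_toEuclideanLin_le _ _
    have h4 : ‖(localGram A i - gram A).toEuclideanLin z‖ ≤ η * ‖gram A‖ * ‖z‖ :=
      (norm_toEuclideanLin_le _ _).trans (mul_le_mul_of_nonneg_right (hη i) (norm_nonneg _))
    have h5 : ‖(gram A).toEuclideanLin z‖ ≤
        ‖(localGram A i).toEuclideanLin z‖ + η * ‖gram A‖ * ‖z‖ := by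
      have h6 := norm_sub_norm_le ((gram A).toEuclideanLin z) ((localGram A i).toEuclideanLin z)
      rw [map_sub, LinearMap.sub_apply, norm_sub_rev] at h4
      linarith
    rw [h1]
    have h7 := mul_le_mul_of_nonneg_left h5 (norm_nonneg Mdag)
    rw [hκd]
    linarith
  induction p, hp using Nat.le_induction generalizing x with
  | base => simpa using hone x
  | succ p hp ih =>
    have h1 := ih ((localGram A i).toEuclideanLin x)
    rw [← toEuclideanLin_mul_apply, pinv_mul_localGram hs hM, ← toEuclideanLin_mul_apply,
      ← pow_succ] at h1
    have h2 := mul_le_mul_of_nonneg_left (hone x) (pow_nonneg (sub_nonneg.mpr hκ) p)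
    calc _ = (1 - η * κ) ^ p * ((1 - η * κ) * ‖Q.toEuclideanLin x‖) := by ring
      _ ≤ ‖Mdag‖ * ((1 - η * κ) ^ p * ‖(localGram A i).toEuclideanLin x‖) := by linarith
      _ ≤ ‖Mdag‖ * (‖Mdag‖ ^ p * ‖(localGram A i ^ (p + 1)).toEuclideanLin x‖) := by gcongr
      _ = _ := by ring

theorem norm_pow_succ_sub_le {B C : Matrix (Fin d) (Fin d) ℝ} {L δ : ℝ} (hB : ‖B‖ ≤ L)
    (hC : ‖C‖ ≤ L) (h : ‖B - C‖ ≤ δ) (p : ℕ) :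
    ‖B ^ (p + 1) - C ^ (p + 1)‖ ≤ (p + 1) * L ^ p * δ := by
  have hL : 0 ≤ L := (norm_nonneg _).trans hB
  have hδ : 0 ≤ δ := (norm_nonneg _).trans h
  induction p with
  | zero => simpa using h
  | succ p ih =>
    have h1 : B ^ (p + 1 + 1) - C ^ (p + 1 + 1) =
        B ^ (p + 1) * (B - C) + (B ^ (p + 1) - C ^ (p + 1)) * C := by
      rw [pow_succ B (p + 1), pow_succ C (p + 1), mul_sub, sub_mul]
      abel
    have h2 : ‖B ^ (p + 1)‖ ≤ L ^ (p + 1) :=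
      (norm_pow_le' B p.succ_pos).trans (pow_le_pow_left₀ (norm_nonneg _) hB _)
    rw [h1]
    calc _ ≤ ‖B ^ (p + 1)‖ * ‖B - C‖ + ‖B ^ (p + 1) - C ^ (p + 1)‖ * ‖C‖ :=
          (norm_add_le _ _).trans (add_le_add (norm_mul_le' _ _) (norm_mul_le' _ _))
      _ ≤ L ^ (p + 1) * δ + (p + 1) * L ^ p * δ * L := by gcongr
      _ = _ := by push_cast; ring

theorem norm_localGram_le {η : ℝ} (hη : LocalApprox A η) (i : Fin m) :
    ‖localGram A i‖ ≤ (1 + η) * ‖gram A‖ := by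
  have h1 := norm_sub_norm_le (localGram A i) (gram A)
  linarith [hη i]

theorem norm_localGram_sub_le {η : ℝ} (hη : LocalApprox A η) (i j : Fin m) :
    ‖localGram A i - localGram A j‖ ≤ 2 * η * ‖gram A‖ := by
  have h1 := norm_sub_le (localGram A i - gram A) (localGram A j - gram A)
  rw [sub_sub_sub_cancel_right] at h1
  linarith [hη i, hη j]

theorem eta_nonneg {η : ℝ} (hη : LocalApprox A η) (b : Fin m) (h0 : gram A ≠ 0) : 0 ≤ η := by
  have h1 := (norm_nonneg _).trans (hη b)
  exact nonneg_of_mul_nonneg_left h1 (norm_pos_iff.mpr h0)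

theorem one_le_kappa (hM : IsMoorePenrose (gram A) Mdag) (h0 : gram A ≠ 0) :
    1 ≤ ‖gram A‖ * ‖Mdag‖ := by
  have h1 := norm_mul_le' (gram A * Mdag) (gram A)
  rw [hM.mul_mul_left] at h1
  have h2 := norm_mul_le' (gram A) Mdag
  have h3 : 0 < ‖gram A‖ := norm_pos_iff.mpr h0
  refine le_of_mul_le_mul_right ?_ h3
  nlinarith

/-- The size of the relative perturbation of `p` local power steps. Bernoulli's inequality absorbs the
factors `(1 + η)^(p-1)` and `(1 - ηκ)^(-p)` when `p κ^p η` is at most `1/4`. -/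
theorem power_perturbation_le {η σ μ : ℝ} {p : ℕ} (hη : 0 ≤ η) (hκ : 1 ≤ σ * μ)
    (hx : (p + 1) * (σ * μ) ^ (p + 1) * η ≤ 1 / 4) :
    (p + 1) * ((1 + η) * σ) ^ p * (2 * η * σ) * μ ^ (p + 1) ≤
      32 / 9 * ((p + 1) * (σ * μ) ^ (p + 1) * η) * (1 - η * (σ * μ)) ^ (p + 1) := by
  set κ := σ * μ with hκd
  have hκp : κ ≤ κ ^ (p + 1) := le_self_pow₀ hκ (by omega)
  have hp0 : (0 : ℝ) ≤ p := p.cast_nonneg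
  have h1 : (p + 1) * (η * κ) ≤ 1 / 4 := by
    refine le_trans ?_ hx
    calc ((p : ℝ) + 1) * (η * κ) = (p + 1) * κ * η := by ring
      _ ≤ _ := by gcongr
  have hηκ : η ≤ η * κ := le_mul_of_one_le_right hη hκ
  have hηκ0 : 0 ≤ η * κ := hη.trans hηκ
  have hηκ1 : η * κ ≤ 1 / 4 := by nlinarith
  have h2 : p * η ≤ 1 / 4 := by nlinarith
  have h3 : 3 / 4 ≤ (1 - η * κ) ^ (p + 1) := by
    have := one_add_mul_le_pow (a := -(η * κ)) (by linarith) (p + 1)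
    push_cast at this
    rw [← sub_eq_add_neg] at this
    linarith
  have h4 : 3 / 4 ≤ (1 - η) ^ p := by
    have := one_add_mul_le_pow (a := -η) (by linarith) p
    rw [← sub_eq_add_neg] at this
    linarith
  have h5 : (1 + η) ^ p * (1 - η) ^ p ≤ 1 := by
    rw [← mul_pow]
    exact pow_le_one₀ (by nlinarith) (by nlinarith)
  have h6 : (1 + η) ^ p ≤ 4 / 3 := by
    have : 0 < (1 + η) ^ p := by positivity
    nlinarith
  have hx0 : 0 ≤ (p + 1) * κ ^ (p + 1) * η := by positivity
  calc _ = 2 * ((p + 1) * κ ^ (p + 1) * η) * (1 + η) ^ p := by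
        rw [hκd, mul_pow _ σ p]; ring
    _ ≤ 2 * ((p + 1) * κ ^ (p + 1) * η) * (4 / 3) := by gcongr
    _ = 32 / 9 * ((p + 1) * κ ^ (p + 1) * η) * (3 / 4) := by ring
    _ ≤ _ := by gcongr

end Data

/-! ### Uniqueness of the `Q`-factor -/

section UpperTriangular

variable {d k : ℕ}

/-- `R` and `R'` are mutually inverse upper triangular matrices with nonnegative diagonals. -/
structure IsTriangularPair (R R' : Matrix (Fin k) (Fin k) ℝ) : Prop where
  upper : R.BlockTriangular id
  upper' : R'.BlockTriangular id
  mul_eq : R * R' = 1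
  diag : ∀ j, 0 ≤ R j j
  diag' : ∀ j, 0 ≤ R' j j

theorem IsTriangularPair.one : IsTriangularPair (1 : Matrix (Fin k) (Fin k) ℝ) 1 where
  upper := blockTriangular_one
  upper' := blockTriangular_one
  mul_eq := Matrix.mul_one 1
  diag j := by simp
  diag' j := by simp

theorem mul_diag_of_upperTriangular {R S : Matrix (Fin k) (Fin k) ℝ} (hR : R.BlockTriangular id)
    (hS : S.BlockTriangular id) (j : Fin k) : (R * S) j j = R j j * S j j := by
  rw [Matrix.mul_apply, Finset.sum_eq_single j]
  · intro i _ hij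
    rcases lt_or_gt_of_ne hij with h1 | h1
    · rw [hR h1, zero_mul]
    · rw [hS h1, mul_zero]
  · simp

theorem IsTriangularPair.symm {R R' : Matrix (Fin k) (Fin k) ℝ} (h : IsTriangularPair R R') :
    IsTriangularPair R' R :=
  ⟨h.upper', h.upper, mul_eq_one_comm.mp h.mul_eq, h.diag', h.diag⟩

theorem IsTriangularPair.mul {R R' S S' : Matrix (Fin k) (Fin k) ℝ} (h : IsTriangularPair R R')
    (h' : IsTriangularPair S S') : IsTriangularPair (R * S) (S' * R') where
  upper := h.upper.mul h'.upper
  upper' := h'.upper'.mul h.upper'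
  mul_eq := by
    rw [Matrix.mul_assoc, ← Matrix.mul_assoc S, h'.mul_eq, Matrix.one_mul, h.mul_eq]
  diag j := by
    rw [mul_diag_of_upperTriangular h.upper h'.upper]
    exact mul_nonneg (h.diag j) (h'.diag j)
  diag' j := by
    rw [mul_diag_of_upperTriangular h'.upper' h.upper']
    exact mul_nonneg (h'.diag' j) (h.diag' j)

/-- The triangular factor of an injective matrix is invertible. -/
theorem IsOrth.exists_triangularPair {Y Z : Matrix (Fin d) (Fin k) ℝ} (h : IsOrth Y Z)
    (hY : ∀ w, Y.toEuclideanLin w = 0 → w = 0) :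
    ∃ R R' : Matrix (Fin k) (Fin k) ℝ, IsTriangularPair R R' ∧ Y = Z * R := by
  obtain ⟨-, R, hR, hd, hYR⟩ := h
  have hdet : R.det ≠ 0 := by
    intro h0
    obtain ⟨v, hv0, hv⟩ := exists_mulVec_eq_zero_iff.mpr h0
    refine hv0 (congr_arg WithLp.ofLp (hY (WithLp.toLp 2 v) ?_))
    have hR0 : R.toEuclideanLin (WithLp.toLp 2 v) = 0 := congr_arg (WithLp.toLp 2) hv
    rw [hYR, toEuclideanLin_mul_apply, hR0, map_zero]
  let _ := R.invertibleOfIsUnitDet (isUnit_iff_ne_zero.mpr hdet)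
  have hmul : R * R⁻¹ = 1 := Matrix.mul_nonsing_inv R (isUnit_iff_ne_zero.mpr hdet)
  have hR' : R⁻¹.BlockTriangular id := blockTriangular_inv_of_blockTriangular hR
  refine ⟨R, R⁻¹, ⟨hR, hR', hmul, hd, fun j => ?_⟩, hYR⟩
  have h1 := inverse_diag_of_upperTriangular hR hR' hmul j
  by_contra h2
  nlinarith [hd j]

theorem injective_of_rank_eq {Y : Matrix (Fin d) (Fin k) ℝ} (h : Y.rank = k)
    (w : EuclideanSpace ℝ (Fin k)) (hw : Y.toEuclideanLin w = 0) : w = 0 := by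
  have h1 := LinearMap.finrank_range_add_finrank_ker Y.mulVecLin
  rw [← Matrix.rank, h, Module.finrank_fin_fun] at h1
  have h2 : LinearMap.ker Y.mulVecLin = ⊥ := Submodule.finrank_eq_zero.mp (by omega)
  have h3 : w.ofLp ∈ LinearMap.ker Y.mulVecLin := congr_arg WithLp.ofLp hw
  rw [h2, Submodule.mem_bot] at h3
  exact PiLp.ext fun i => congr_fun h3 i

/-- The `Q`-factor of an injective matrix is unique. -/
theorem IsOrth.unique {Y Z Z' : Matrix (Fin d) (Fin k) ℝ} (h : IsOrth Y Z) (h' : IsOrth Y Z')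
    (hY : ∀ w, Y.toEuclideanLin w = 0 → w = 0) : Z = Z' := by
  obtain ⟨R, R', hR, hYR⟩ := h.exists_triangularPair hY
  obtain ⟨S, S', hS, hYS⟩ := h'.exists_triangularPair hY
  have hp := hR.mul hS.symm
  have h1 : Z' + 0 = Z * (R * S') := by
    rw [← Matrix.mul_assoc, ← hYR, hYS, Matrix.mul_assoc, hS.mul_eq, Matrix.mul_one, add_zero]
  have h2 := norm_qFactor_sub_le h'.1 h.1 hp.upper hp.upper' hp.mul_eq hp.diag h1
  simp only [norm_zero, Matrix.zero_mul, add_zero, mul_zero] at h2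
  exact sub_eq_zero.mp (norm_le_zero_iff.mp h2)

end UpperTriangular

/-! ### Residual error after local steps from a common iterate -/

section Runs

variable {m d k : ℕ} {s : Fin m → ℕ} {F : Set (Matrix (Fin k) (Fin k) ℝ)}
  {A : (i : Fin m) → Matrix (Fin (s i)) (Fin d) ℝ} {b : Fin m} {I : Set ℕ}
  {Z Y : ℕ → Fin m → Matrix (Fin d) (Fin k) ℝ} {D : ℕ → Fin m → Matrix (Fin k) (Fin k) ℝ}
  {N : ℕ → Fin m → Matrix (Fin d) (Fin k) ℝ} {N' : ℕ → Matrix (Fin d) (Fin k) ℝ} {t : ℕ}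

theorem lastSync_le (I : Set ℕ) (t : ℕ) : lastSync I t ≤ t := by
  classical exact Nat.findGreatest_le t

theorem lastSync_mem {I : Set ℕ} (h : lastSync I t ≠ 0) : lastSync I t ∈ I := by
  classical exact Nat.findGreatest_of_ne_zero rfl h

theorem notMem_of_lastSync_lt {I : Set ℕ} {u : ℕ} (h : lastSync I t < u) (hu : u ≤ t) : u ∉ I := by
  classical exact Nat.findGreatest_is_greatest h hu

theorem le_lastSync {I : Set ℕ} {u : ℕ} (h : u ∈ I) (hu : u ≤ t) : u ≤ lastSync I t := by
  classical exact Nat.le_findGreatest hu h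

theorem IsRun.orthonormal (h : IsRun F A b I Z Y D N N') (ht : 1 ≤ t) (i : Fin m) :
    (Z t i)ᵀ * Z t i = 1 := by
  obtain ⟨u, rfl⟩ := Nat.exists_eq_add_of_le' ht
  exact (h.orth u i).1

theorem residual_le (hb : Fin m) {r : ℝ} (h : ∀ i, ‖Z t i * D (t + 1) i - Z t b‖ ≤ r) :
    residual b Z D t ≤ r := by
  have : Nonempty (Fin m) := ⟨hb⟩
  exact ciSup_le h

theorem le_residual (i : Fin m) : ‖Z t i * D (t + 1) i - Z t b‖ ≤ residual b Z D t :=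
  le_ciSup (f := fun i => ‖Z t i * D (t + 1) i - Z t b‖) (Set.finite_range _).bddAbove i

/-- The iterates of all devices agree at the last communication. -/
theorem IsRun.synced (h : IsRun F A b I Z Y D N N') (hr : FullRankUpTo Y t) (i : Fin m) :
    Z (lastSync I t) i = Z (lastSync I t) b := by
  by_cases h0 : lastSync I t = 0
  · rw [h0]
    exact h.init i
  obtain ⟨u, hu⟩ := Nat.exists_eq_succ_of_ne_zero h0
  have hI := lastSync_mem h0
  have hle := lastSync_le I t
  rw [hu, Nat.succ_eq_add_one] at hI hle ⊢
  have hY : Y (u + 1) i = Y (u + 1) b := by rw [h.step_sync u hI i, h.step_sync u hI b]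
  have h1 := h.orth u i
  rw [hY] at h1
  exact h1.unique (h.orth u b) (injective_of_rank_eq (hr (u + 1) (by omega) hle b))

/-- Between communications each device runs a power iteration with its local matrix. -/
theorem IsRun.local_power (h : IsRun F A b I Z Y D N N') (hr : FullRankUpTo Y t) (i : Fin m)
    (p : ℕ) (hp : lastSync I t + p ≤ t) :
    ∃ S S' : Matrix (Fin k) (Fin k) ℝ, IsTriangularPair S S' ∧
      localGram A i ^ p * Z (lastSync I t) b = Z (lastSync I t + p) i * S := by
  induction p with
  | zero =>
    refine ⟨1, 1, IsTriangularPair.one, ?_⟩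
    rw [pow_zero, Matrix.one_mul, Matrix.mul_one, add_zero, h.synced hr i]
  | succ p ih =>
    obtain ⟨S, S', hS, hSeq⟩ := ih (by omega)
    have hY := h.step_local (lastSync I t + p)
      (notMem_of_lastSync_lt (by omega) (show _ ≤ t by omega)) i
    obtain ⟨R, R', hR, hReq⟩ := (h.orth (lastSync I t + p) i).exists_triangularPair
      (injective_of_rank_eq (hr _ (by omega) (show _ ≤ t by omega) i))
    refine ⟨R * S, S' * R', hR.mul hS, ?_⟩
    rw [pow_succ', Matrix.mul_assoc, hSeq, ← Matrix.mul_assoc, ← hY, hReq, Matrix.mul_assoc]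
    rfl

theorem mul_eq_self_of_isAlignment {E : Matrix (Fin d) (Fin k) ℝ} {Q : Matrix (Fin k) (Fin k) ℝ}
    (h1 : (1 : Matrix (Fin k) (Fin k) ℝ) ∈ F) (h : IsAlignment F E E Q) : E * Q = E := by
  have h2 := h.2 1 ⟨h1, by simp [orthMat]⟩
  rw [Matrix.mul_one, sub_self, frob_eq_zero_iff.mpr rfl] at h2
  exact sub_eq_zero.mp (frob_eq_zero_iff.mp (le_antisymm h2 (frob_nonneg _)))

/-- The residual error vanishes when all the iterates agree. -/
theorem IsRun.residual_eq_zero (h : IsRun F A b I Z Y D N N')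
    (h1 : (1 : Matrix (Fin k) (Fin k) ℝ) ∈ F) (hz : ∀ i, Z t i = Z t b) :
    residual b Z D t ≤ 0 := by
  refine residual_le b fun i => ?_
  have h2 := h.align t i
  rw [hz i] at h2 ⊢
  rw [mul_eq_self_of_isAlignment h1 h2, sub_self, norm_zero]

theorem IsRun.residual_eq_zero_of_sync (h : IsRun F A b I Z Y D N N')
    (h1 : (1 : Matrix (Fin k) (Fin k) ℝ) ∈ F) (hr : FullRankUpTo Y t) (ht : lastSync I t = t) :
    residual b Z D t ≤ 0 := by
  refine h.residual_eq_zero h1 fun i => ?_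
  have := h.synced hr i
  rwa [ht] at this

theorem IsRun.gram_ne_zero (h : IsRun F A b I Z Y D N N') (hk : 1 ≤ k) {η : ℝ}
    (hη : LocalApprox A η) (hr : FullRankUpTo Y t) (ht : lastSync I t < t) : gram A ≠ 0 := by
  intro h0
  obtain ⟨u, hu⟩ := Nat.exists_eq_add_of_le' (show 1 ≤ t by omega)
  have h1 := hη b
  rw [h0, norm_zero, mul_zero, sub_zero, norm_le_zero_iff] at h1
  have h2 := h.step_local u (hu ▸ notMem_of_lastSync_lt ht le_rfl) b
  rw [h1, Matrix.zero_mul, ← hu] at h2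
  have h3 := hr t (by omega) le_rfl b
  rw [h2, Matrix.rank_zero] at h3
  omega

variable {Mdag : Matrix (Fin d) (Fin d) ℝ} {η : ℝ}

/-- After `p` local steps from a common iterate, the iterates of two devices are `Q`-factors of
matrices that differ by about `p κ^p η`. The perturbation is formed on the range of the global
matrix, where the powers of the local matrices are bounded below. -/
theorem IsRun.exists_perturbation (h : IsRun F A b I Z Y D N N') (hs : ∀ i, 0 < s i)
    (hM : IsMoorePenrose (gram A) Mdag) (h0 : gram A ≠ 0) (hη : LocalApprox A η)
    (hr : FullRankUpTo Y t) {p : ℕ} (hp : lastSync I t + (p + 1) = t)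
    (hx : (p + 1) * (‖gram A‖ * ‖Mdag‖) ^ (p + 1) * η ≤ 1 / 4) (i j : Fin m) :
    ∃ (E : Matrix (Fin d) (Fin k) ℝ) (R R' : Matrix (Fin k) (Fin k) ℝ), IsTriangularPair R R' ∧
      Z t j + E = Z t i * R ∧
      ‖E‖ ≤ 32 / 9 * ((p + 1) * (‖gram A‖ * ‖Mdag‖) ^ (p + 1) * η) ∧
      ‖E * R'‖ ≤ 32 / 9 * ((p + 1) * (‖gram A‖ * ‖Mdag‖) ^ (p + 1) * η) := by
  set κ := ‖gram A‖ * ‖Mdag‖ with hκd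
  set x := (p + 1) * κ ^ (p + 1) * η with hxd
  have hη0 := eta_nonneg hη b h0
  have hκ1 := one_le_kappa hM h0
  have hηκ : η * κ ≤ 1 / 4 := by
    refine le_trans ?_ hx
    have h1 : κ ≤ κ ^ (p + 1) := le_self_pow₀ hκ1 (by omega)
    have h2 : (1 : ℝ) ≤ p + 1 := by linarith [(p.cast_nonneg : (0 : ℝ) ≤ p)]
    calc η * κ ≤ η * κ ^ (p + 1) := by gcongr
      _ ≤ (p + 1) * (η * κ ^ (p + 1)) := le_mul_of_one_le_left (by positivity) h2
      _ = x := by rw [hxd]; ring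
  have hx0 : 0 ≤ x := by positivity
  have hZ : ∀ i, (Z t i)ᵀ * Z t i = 1 := fun i => h.orthonormal (by omega) i
  have hpow : ∀ i, ∃ S S' : Matrix (Fin k) (Fin k) ℝ, IsTriangularPair S S' ∧
      localGram A i ^ (p + 1) * Z (lastSync I t) b = Z t i * S := by
    intro i
    have := h.local_power hr i (p + 1) hp.le
    rwa [hp] at this
  obtain ⟨S, S', hS, hSeq⟩ := hpow i
  obtain ⟨T, T', hT, hTeq⟩ := hpow j
  set Q := Mdag * gram A with hQ
  set Δ := localGram A i ^ (p + 1) - localGram A j ^ (p + 1) with hΔ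
  have hbound : ∀ (l : Fin m) (U U' : Matrix (Fin k) (Fin k) ℝ), IsTriangularPair U U' →
      localGram A l ^ (p + 1) * Z (lastSync I t) b = Z t l * U →
      ‖Δ * (Q * (Z (lastSync I t) b * U'))‖ ≤ 32 / 9 * x := by
    intro l U U' hU hUeq
    have hΔn : ‖Δ‖ ≤ (p + 1) * ((1 + η) * ‖gram A‖) ^ p * (2 * η * ‖gram A‖) :=
      norm_pow_succ_sub_le (norm_localGram_le hη i) (norm_localGram_le hη j)
        (norm_localGram_sub_le hη i j) p
    have hpos : 0 < (1 - η * κ) ^ (p + 1) := pow_pos (by linarith) _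
    have hW : ‖Q * (Z (lastSync I t) b * U')‖ ≤ ‖Mdag‖ ^ (p + 1) / (1 - η * κ) ^ (p + 1) := by
      refine l2_opNorm_le_bound (by positivity) fun w => ?_
      rw [div_mul_eq_mul_div, le_div_iff₀ hpos, mul_comm, toEuclideanLin_mul_apply]
      refine (norm_pinv_le hs hM hη (by linarith) l (p + 1) (by omega) _).trans ?_
      rw [← toEuclideanLin_mul_apply, ← Matrix.mul_assoc, hUeq, Matrix.mul_assoc, hU.mul_eq,
        Matrix.mul_one, norm_toEuclideanLin_of_orthonormal (hZ l)]
    refine (norm_mul_le' _ _).trans ?_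
    calc _ ≤ ((p + 1) * ((1 + η) * ‖gram A‖) ^ p * (2 * η * ‖gram A‖)) *
          (‖Mdag‖ ^ (p + 1) / (1 - η * κ) ^ (p + 1)) := by gcongr
      _ ≤ _ := by
        rw [← mul_div_assoc, div_le_iff₀ hpos]
        exact power_perturbation_le hη0 hκ1 hx
  refine ⟨Δ * (Q * (Z (lastSync I t) b * T')), S * T', T * S', hS.mul hT.symm, ?_,
    hbound j T T' hT hTeq, ?_⟩
  · have h1 : Δ * (Q * (Z (lastSync I t) b * T')) = Z t i * (S * T') - Z t j := by
      rw [← Matrix.mul_assoc Δ, hΔ, Matrix.sub_mul, hQ, localGram_pow_mul_pinv hs hM i (by omega),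
        localGram_pow_mul_pinv hs hM j (by omega), Matrix.sub_mul, ← Matrix.mul_assoc,
        ← Matrix.mul_assoc, hSeq, hTeq, Matrix.mul_assoc, Matrix.mul_assoc, hT.mul_eq,
        Matrix.mul_one]
    rw [h1]
    abel
  · have h1 : Δ * (Q * (Z (lastSync I t) b * T')) * (T * S') =
        Δ * (Q * (Z (lastSync I t) b * S')) := by
      simp only [Matrix.mul_assoc]
      rw [← Matrix.mul_assoc T' T, mul_eq_one_comm.mp hT.mul_eq, Matrix.one_mul]
    rw [h1]
    exact hbound i S S' hS hSeq

/-- Without alignment, the residual error is controlled by the perturbation of the `Q`-factor. -/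
theorem IsRun.residual_le_of_unaligned (h : IsRun {1} A b I Z Y D N N') (hk : 1 ≤ k)
    (hs : ∀ i, 0 < s i) (hM : IsMoorePenrose (gram A) Mdag) (hη : LocalApprox A η)
    (hr : FullRankUpTo Y t) :
    residual b Z D t ≤ 4 * Real.exp 1 * √k * ((t - lastSync I t : ℕ) : ℝ) *
      (‖gram A‖ * ‖Mdag‖) ^ (t - lastSync I t) * η := by
  rcases (lastSync_le I t).eq_or_lt with ht | ht
  · rw [ht, Nat.sub_self]
    simpa using h.residual_eq_zero_of_sync rfl hr ht
  obtain ⟨p, hp⟩ := Nat.exists_eq_add_of_lt ht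
  have hp' : lastSync I t + (p + 1) = t := by omega
  rw [show t - lastSync I t = p + 1 by omega]
  have h0 := h.gram_ne_zero hk hη hr ht
  have hη0 := eta_nonneg hη b h0
  have hκ1 := one_le_kappa hM h0
  set x := (p + 1) * (‖gram A‖ * ‖Mdag‖) ^ (p + 1) * η with hx
  have hx0 : 0 ≤ x := by positivity
  have hk1 : 1 ≤ √k := Real.one_le_sqrt.mpr (by exact_mod_cast hk)
  have he : 2.7 ≤ Real.exp 1 := by linarith [Real.exp_one_gt_d9]
  have hrhs : 4 * Real.exp 1 * √k * ((p + 1 : ℕ) : ℝ) * (‖gram A‖ * ‖Mdag‖) ^ (p + 1) * η =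
      4 * Real.exp 1 * √k * x := by
    rw [hx]; push_cast; ring
  rw [hrhs]
  have hlow : 10.8 * (√k * x) ≤ 4 * Real.exp 1 * √k * x := by
    have : 0 ≤ √k * x := by positivity
    nlinarith
  have hkx : x ≤ √k * x := le_mul_of_one_le_left hx0 hk1
  refine residual_le b fun i => ?_
  have hD : D (t + 1) i = 1 := (h.align t i).1.1
  rw [hD, Matrix.mul_one]
  have hZ : ∀ i, (Z t i)ᵀ * Z t i = 1 := fun i => h.orthonormal (by omega) i
  rcases le_or_gt x (1 / 4) with hx4 | hx4
  · obtain ⟨E, R, R', hR, hE, hE1, hE2⟩ := h.exists_perturbation hs hM h0 hη hr hp' hx4 i b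
    have h1 := norm_qFactor_sub_le (hZ b) (hZ i) hR.upper hR.upper' hR.mul_eq hR.diag hE
    rw [← hx] at hE1 hE2
    have h2 : √k * (‖E‖ + ‖E * R'‖) ≤ √k * (32 / 9 * x + 32 / 9 * x) := by gcongr
    linarith
  · have h1 := norm_sub_le (Z t i) (Z t b)
    have h2 := norm_le_one_of_orthonormal (hZ i)
    have h3 := norm_le_one_of_orthonormal (hZ b)
    linarith

/-- With alignment, the residual error is controlled by the sine of the largest principal angle. -/
theorem IsRun.residual_le_of_aligned (h : IsRun (orthMat k) A b I Z Y D N N') (hk : 1 ≤ k)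
    (hs : ∀ i, 0 < s i) (hM : IsMoorePenrose (gram A) Mdag) (hη : LocalApprox A η)
    (hr : FullRankUpTo Y t) :
    residual b Z D t ≤ 2 * Real.exp 1 ^ 2 * (‖gram A‖ * ‖Mdag‖) ^ (t - lastSync I t) *
      ((t - lastSync I t : ℕ) : ℝ) * η := by
  rcases (lastSync_le I t).eq_or_lt with ht | ht
  · rw [ht, Nat.sub_self]
    simpa using h.residual_eq_zero_of_sync (by simp [orthMat]) hr ht
  obtain ⟨p, hp⟩ := Nat.exists_eq_add_of_lt ht
  have hp' : lastSync I t + (p + 1) = t := by omega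
  rw [show t - lastSync I t = p + 1 by omega]
  have h0 := h.gram_ne_zero hk hη hr ht
  have hη0 := eta_nonneg hη b h0
  have hκ1 := one_le_kappa hM h0
  set x := (p + 1) * (‖gram A‖ * ‖Mdag‖) ^ (p + 1) * η with hx
  have hx0 : 0 ≤ x := by positivity
  have he : 2.7 ≤ Real.exp 1 := by linarith [Real.exp_one_gt_d9]
  have hrhs : 2 * Real.exp 1 ^ 2 * (‖gram A‖ * ‖Mdag‖) ^ (p + 1) * ((p + 1 : ℕ) : ℝ) * η =
      2 * Real.exp 1 ^ 2 * x := by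
    rw [hx]; push_cast; ring
  rw [hrhs]
  have hlow : 14 * x ≤ 2 * Real.exp 1 ^ 2 * x := by
    refine mul_le_mul_of_nonneg_right ?_ hx0
    nlinarith
  refine residual_le b fun i => ?_
  have hZ : ∀ i, (Z t i)ᵀ * Z t i = 1 := fun i => h.orthonormal (by omega) i
  have h2 : √2 ≤ 2 := by
    rw [Real.sqrt_le_left (by norm_num)]; norm_num
  rcases le_or_gt x (1 / 4) with hx4 | hx4
  · obtain ⟨E, R, R', hR, hE, hE1, hE2⟩ := h.exists_perturbation hs hM h0 hη hr hp' hx4 i b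
    rw [← hx] at hE1
    have h1 := (h.align t i).norm_le_sin (hZ i) (hZ b) (s := 32 / 9 * x) (by positivity) fun w => by
      refine (norm_sub_starProjection_le _ _ _
        (toEuclideanLin_mem_colSpace (Z t i) (R.toEuclideanLin w))).trans ?_
      rw [← toEuclideanLin_mul_apply, ← hE, map_add, LinearMap.add_apply, sub_add_cancel_left,
        norm_neg]
      exact (norm_toEuclideanLin_le E w).trans (by gcongr)
    have h3 : √2 * (32 / 9 * x) ≤ 2 * (32 / 9 * x) := by gcongr
    linarith
  · have h1 := (h.align t i).norm_le_sin (hZ i) (hZ b) zero_le_one fun w => by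
      rw [one_mul]
      refine (norm_sub_starProjection_le_norm _ _).trans ?_
      rw [norm_toEuclideanLin_of_orthonormal (hZ b)]
    linarith

end Runs

/-! ### Spectral gaps of the local matrices -/

section Gap

variable {m d k : ℕ} {s : Fin m → ℕ} {A : (i : Fin m) → Matrix (Fin (s i)) (Fin d) ℝ} {η : ℝ}

theorem sigma_localGram_le (hη : LocalApprox A η) {j : ℕ} (hj : 1 ≤ j) (i : Fin m) :
    sigma (localGram A i) j ≤ sigma (gram A) j + η * ‖gram A‖ :=
  (sigma_le_sigma_add (localGram_posSemidef A i) (gram_posSemidef A) hj).trans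
    (by linarith [hη i])

theorem le_sigma_localGram (hη : LocalApprox A η) {j : ℕ} (hj : 1 ≤ j) (i : Fin m) :
    sigma (gram A) j - η * ‖gram A‖ ≤ sigma (localGram A i) j := by
  have h := sigma_le_sigma_add (gram_posSemidef A) (localGram_posSemidef A i) hj
  rw [norm_sub_rev] at h
  linarith [hη i]

/-- The local matrices inherit the spectral gap. -/
theorem sigma_localGram_gap (hk : 1 ≤ k) (hη : LocalApprox A η)
    (hgap : 2 * (η * ‖gram A‖) < sigma (gram A) k - sigma (gram A) (k + 1)) (i : Fin m) :
    sigma (localGram A i) (k + 1) < sigma (localGram A i) k := by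
  have h1 := sigma_localGram_le hη (show 1 ≤ k + 1 by omega) i
  have h2 := le_sigma_localGram hη hk i
  linarith

theorem ratio_le_gammaRatio (i : Fin m) :
    sigma (localGram A i) (k + 1) / sigma (localGram A i) k ≤ gammaRatio A k :=
  (le_ciSup (f := fun i => sigma (localGram A i) (k + 1) / sigma (localGram A i) k)
    (Set.finite_range _).bddAbove i).trans (le_max_left _ _)

theorem gammaRatio_nonneg : 0 ≤ gammaRatio A k :=
  le_max_of_le_right (div_nonneg (sigma_nonneg _ _) (sigma_nonneg _ _))

theorem gammaRatio_lt_one (b : Fin m) (hk : 1 ≤ k) (hη : LocalApprox A η)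
    (hgap : 2 * (η * ‖gram A‖) < sigma (gram A) k - sigma (gram A) (k + 1))
    (hgap0 : 0 < sigma (gram A) k - sigma (gram A) (k + 1)) : gammaRatio A k < 1 := by
  have : Nonempty (Fin m) := ⟨b⟩
  refine max_lt ?_ ?_
  · obtain ⟨i, hi⟩ := exists_eq_ciSup_of_finite
      (f := fun i => sigma (localGram A i) (k + 1) / sigma (localGram A i) k)
    rw [← hi]
    have h := sigma_localGram_gap hk hη hgap i
    exact (div_lt_one ((sigma_nonneg _ _).trans_lt h)).mpr h
  · exact (div_lt_one ((sigma_nonneg _ _).trans_lt (sub_pos.mp hgap0))).mpr (sub_pos.mp hgap0)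

/-- The top eigenspaces of two local matrices are close. -/
theorem davis_kahan_localGram (hk : 1 ≤ k) (hη : LocalApprox A η)
    (hgap : 8 * (η * ‖gram A‖) ≤ sigma (gram A) k - sigma (gram A) (k + 1))
    (hgap0 : 0 < sigma (gram A) k - sigma (gram A) (k + 1)) (i j : Fin m)
    {x : EuclideanSpace ℝ (Fin d)} (hx : x ∈ topEigenspace (localGram A i) k) :
    ‖x - (topEigenspace (localGram A j) k).starProjection x‖ ≤
      4 * (η * ‖gram A‖ / (sigma (gram A) k - sigma (gram A) (k + 1))) * ‖x‖ := by
  set g := sigma (gram A) k - sigma (gram A) (k + 1) with hg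
  have h2 : 2 * (η * ‖gram A‖) < g := by linarith
  have h1 := davis_kahan (localGram_posSemidef A i) (localGram_posSemidef A j)
    (sigma_localGram_gap hk hη h2 i) (sigma_localGram_gap hk hη h2 j) hx
  have h3 := sigma_localGram_le hη (show 1 ≤ k + 1 by omega) j
  have h4 := le_sigma_localGram hη hk i
  set y := ‖x - (topEigenspace (localGram A j) k).starProjection x‖
  have h5 : g / 2 * y ≤ 2 * η * ‖gram A‖ * ‖x‖ := by
    calc g / 2 * y ≤ _ := mul_le_mul_of_nonneg_right (by linarith) (norm_nonneg _)
      _ ≤ _ := h1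
      _ ≤ _ := mul_le_mul_of_nonneg_right (norm_localGram_sub_le hη i j) (norm_nonneg _)
  have h6 : 4 * (η * ‖gram A‖ / g) * ‖x‖ = 2 * η * ‖gram A‖ * ‖x‖ / (g / 2) := by
    field_simp
    ring
  rw [h6, le_div_iff₀ (by linarith)]
  linarith

/-- The top eigenspace of a local matrix is close to the one of the global matrix. -/
theorem davis_kahan_gram (hk : 1 ≤ k) (hη : LocalApprox A η)
    (hgap : 8 * (η * ‖gram A‖) ≤ sigma (gram A) k - sigma (gram A) (k + 1))
    (hgap0 : 0 < sigma (gram A) k - sigma (gram A) (k + 1)) (i : Fin m)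
    {x : EuclideanSpace ℝ (Fin d)} (hx : x ∈ topEigenspace (gram A) k) :
    ‖x - (topEigenspace (localGram A i) k).starProjection x‖ ≤
      2 * (η * ‖gram A‖ / (sigma (gram A) k - sigma (gram A) (k + 1))) * ‖x‖ := by
  set g := sigma (gram A) k - sigma (gram A) (k + 1) with hg
  have h1 := davis_kahan (gram_posSemidef A) (localGram_posSemidef A i)
    (sub_pos.mp hgap0) (sigma_localGram_gap hk hη (by linarith) i) hx
  have h3 := sigma_localGram_le hη (show 1 ≤ k + 1 by omega) i
  set y := ‖x - (topEigenspace (localGram A i) k).starProjection x‖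
  have h5 : g / 2 * y ≤ η * ‖gram A‖ * ‖x‖ := by
    calc g / 2 * y ≤ _ := mul_le_mul_of_nonneg_right (by linarith) (norm_nonneg _)
      _ ≤ _ := h1
      _ ≤ _ := by
        rw [norm_sub_rev]
        exact mul_le_mul_of_nonneg_right (hη i) (norm_nonneg _)
  have h6 : 2 * (η * ‖gram A‖ / g) * ‖x‖ = η * ‖gram A‖ * ‖x‖ / (g / 2) := by
    field_simp
  rw [h6, le_div_iff₀ (by linarith)]
  linarith

end Gap

/-! ### Contraction of angles by powers of a matrix -/

section LocalConvergence

variable {d k : ℕ} {B : Matrix (Fin d) (Fin d) ℝ}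

theorem norm_sub_starProjection_pow_le (hB : B.PosSemidef) (hgap : sigma B (k + 1) < sigma B k)
    (p : ℕ) (x : EuclideanSpace ℝ (Fin d)) :
    ‖(B ^ p).toEuclideanLin x - (topEigenspace B k).starProjection ((B ^ p).toEuclideanLin x)‖ ≤
      sigma B (k + 1) ^ p * ‖x - (topEigenspace B k).starProjection x‖ := by
  induction p with
  | zero => simp
  | succ p ih =>
    rw [pow_succ' B, toEuclideanLin_mul_apply, pow_succ' (sigma _ _), mul_assoc]
    exact (norm_sub_starProjection_le_sigma_mul hB hgap _).trans
      (mul_le_mul_of_nonneg_left ih (sigma_nonneg _ _))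

theorem pow_mul_norm_starProjection_le (hB : B.PosSemidef) (hgap : sigma B (k + 1) < sigma B k)
    (p : ℕ) (x : EuclideanSpace ℝ (Fin d)) :
    sigma B k ^ p * ‖(topEigenspace B k).starProjection x‖ ≤
      ‖(topEigenspace B k).starProjection ((B ^ p).toEuclideanLin x)‖ := by
  induction p with
  | zero => simp
  | succ p ih =>
    rw [pow_succ' B, toEuclideanLin_mul_apply, pow_succ' (sigma _ _), mul_assoc]
    exact (mul_le_mul_of_nonneg_left ih (sigma_nonneg _ _)).trans
      (sigma_mul_norm_starProjection_le hB hgap _)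

/-- A power of a matrix contracts the tangent of the angle to its top eigenspace. -/
theorem tan_pow_le (hB : B.PosSemidef) (hgap : sigma B (k + 1) < sigma B k) (p : ℕ) {τ : ℝ}
    (hτ : 0 ≤ τ) {x : EuclideanSpace ℝ (Fin d)}
    (hx : ‖x - (topEigenspace B k).starProjection x‖ ≤
      τ * ‖(topEigenspace B k).starProjection x‖) :
    ‖(B ^ p).toEuclideanLin x - (topEigenspace B k).starProjection ((B ^ p).toEuclideanLin x)‖ ≤
      (sigma B (k + 1) / sigma B k) ^ p * τ *
        ‖(topEigenspace B k).starProjection ((B ^ p).toEuclideanLin x)‖ := by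
  have h1 := norm_sub_starProjection_pow_le hB hgap p x
  have h2 := pow_mul_norm_starProjection_le hB hgap p x
  have h0 := sigma_nonneg B (k + 1)
  have hpos : 0 < sigma B k ^ p := pow_pos (h0.trans_lt hgap) p
  set c := sigma B (k + 1) ^ p
  have hc : 0 ≤ c := pow_nonneg h0 p
  rw [div_pow, div_mul_eq_mul_div, div_mul_eq_mul_div, le_div_iff₀ hpos]
  calc _ ≤ c * (τ * ‖(topEigenspace B k).starProjection x‖) * sigma B k ^ p := by
        refine mul_le_mul_of_nonneg_right (h1.trans ?_) hpos.le
        exact mul_le_mul_of_nonneg_left hx hc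
    _ = c * τ * (sigma B k ^ p * ‖(topEigenspace B k).starProjection x‖) := by ring
    _ ≤ _ := mul_le_mul_of_nonneg_left h2 (by positivity)

end LocalConvergence

/-! ### Residual error and angles to the local eigenspaces -/

section AngleBound

variable {m d k : ℕ} {s : Fin m → ℕ}
  {A : (i : Fin m) → Matrix (Fin (s i)) (Fin d) ℝ} {b : Fin m} {I : Set ℕ}
  {Z Y : ℕ → Fin m → Matrix (Fin d) (Fin k) ℝ} {D : ℕ → Fin m → Matrix (Fin k) (Fin k) ℝ}
  {N : ℕ → Fin m → Matrix (Fin d) (Fin k) ℝ} {N' : ℕ → Matrix (Fin d) (Fin k) ℝ} {t : ℕ}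
  {Mdag : Matrix (Fin d) (Fin d) ℝ} {η : ℝ}

/-- During local steps, the iterate of each device approaches the top eigenspace of its own matrix.
If `γ_k = 0` it lies in that eigenspace after one step, whatever the initial angle is. -/
theorem IsRun.exists_tan_bound (h : IsRun (orthMat k) A b I Z Y D N N') (hk : 1 ≤ k)
    (hr : FullRankUpTo Y t) (ht : lastSync I t < t) (hη : LocalApprox A η)
    (hgap : 2 * (η * ‖gram A‖) < sigma (gram A) k - sigma (gram A) (k + 1))
    (hgap0 : 0 < sigma (gram A) k - sigma (gram A) (k + 1))
    (hC : gammaRatio A k = 0 ∨ angleTerm A I Z t ≠ ∞) :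
    ∃ T : ℝ, 0 ≤ T ∧ ENNReal.ofReal T ≤
        ENNReal.ofReal (gammaRatio A k ^ (((t - lastSync I t : ℕ) : ℝ) / 4)) * angleTerm A I Z t ∧
      ∀ i w, ‖(Z t i).toEuclideanLin w -
          (topEigenspace (localGram A i) k).starProjection ((Z t i).toEuclideanLin w)‖ ≤
        T * ‖(topEigenspace (localGram A i) k).starProjection ((Z t i).toEuclideanLin w)‖ := by
  set p := t - lastSync I t with hp
  have hg0 : 0 ≤ gammaRatio A k := gammaRatio_nonneg
  have hg1 := gammaRatio_lt_one b hk hη hgap hgap0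
  have hvec : ∀ i w, ∃ x ∈ colSpace (Z (lastSync I t) i),
      (Z t i).toEuclideanLin w = (localGram A i ^ p).toEuclideanLin x := by
    intro i w
    obtain ⟨S, S', hS, hSeq⟩ := h.local_power hr i p (by omega)
    rw [show lastSync I t + p = t by omega] at hSeq
    refine ⟨(Z (lastSync I t) i).toEuclideanLin (S'.toEuclideanLin w),
      toEuclideanLin_mem_colSpace _ _, ?_⟩
    rw [← toEuclideanLin_mul_apply, ← toEuclideanLin_mul_apply, h.synced hr i,
      hSeq, Matrix.mul_assoc, hS.mul_eq, Matrix.mul_one]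
  by_cases hγ : gammaRatio A k = 0
  · refine ⟨0, le_rfl, by simp, fun i w => ?_⟩
    obtain ⟨x, -, hx⟩ := hvec i w
    have hgi := sigma_localGram_gap hk hη hgap i
    have hs0 : sigma (localGram A i) (k + 1) = 0 := by
      have h1 := ratio_le_gammaRatio (A := A) (k := k) i
      rw [hγ, div_le_iff₀ ((sigma_nonneg _ _).trans_lt hgi), zero_mul] at h1
      exact le_antisymm h1 (sigma_nonneg _ _)
    have h2 := norm_sub_starProjection_pow_le (localGram_posSemidef A i) hgi p x
    rw [hs0, zero_pow (by omega), zero_mul] at h2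
    rwa [hx, zero_mul]
  · have hC' := hC.resolve_left hγ
    have hgpos : 0 < gammaRatio A k := lt_of_le_of_ne hg0 (Ne.symm hγ)
    refine ⟨gammaRatio A k ^ ((p : ℝ) / 4) * (angleTerm A I Z t).toReal, by positivity, ?_, ?_⟩
    · rw [ENNReal.ofReal_mul (by positivity), ENNReal.ofReal_toReal hC']
    intro i w
    obtain ⟨x, hx, hxe⟩ := hvec i w
    have hgi := sigma_localGram_gap hk hη hgap i
    have hle : tanTheta (colSpace (Z (lastSync I t) i)) (topEigenspace (localGram A i) k) ≤
        angleTerm A I Z t := le_iSup (fun i => tanTheta (colSpace (Z (lastSync I t) i))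
          (topEigenspace (localGram A i) k)) i
    have h1 := norm_sub_le_tanTheta (ne_top_of_le_ne_top hC' hle) hx
    rw [hxe]
    refine (tan_pow_le (localGram_posSemidef A i) hgi p ENNReal.toReal_nonneg h1).trans ?_
    have h2 : (sigma (localGram A i) (k + 1) / sigma (localGram A i) k) ^ p ≤
        gammaRatio A k ^ ((p : ℝ) / 4) := by
      calc _ ≤ gammaRatio A k ^ p := pow_le_pow_left₀
            (div_nonneg (sigma_nonneg _ _) (sigma_nonneg _ _)) (ratio_le_gammaRatio i) p
        _ = gammaRatio A k ^ (p : ℝ) := (Real.rpow_natCast _ _).symm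
        _ ≤ _ := by
          refine Real.rpow_le_rpow_of_exponent_ge hgpos hg1.le ?_
          linarith [(p.cast_nonneg : (0 : ℝ) ≤ p)]
    have h3 := ENNReal.toReal_mono hC' hle
    have := ENNReal.toReal_nonneg
      (a := tanTheta (colSpace (Z (lastSync I t) i)) (topEigenspace (localGram A i) k))
    gcongr

/-- The bound on the residual error by the angles to the local eigenspaces: the orthonormal bases of
two iterates are compared through bases of the two local eigenspaces. -/
theorem IsRun.residual_le_angle (h : IsRun (orthMat k) A b I Z Y D N N') (hk : 1 ≤ k)
    (hs : ∀ i, 0 < s i) (hM : IsMoorePenrose (gram A) Mdag) (hη : LocalApprox A η)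
    (hr : FullRankUpTo Y t) :
    ENNReal.ofReal (residual b Z D t) ≤
      ENNReal.ofReal (η * ‖gram A‖) /
          ENNReal.ofReal (1 / 16 * (sigma (gram A) k - sigma (gram A) (k + 1))) +
        2 * ENNReal.ofReal (gammaRatio A k ^ (((t - lastSync I t : ℕ) : ℝ) / 4)) *
          angleTerm A I Z t := by
  set g := sigma (gram A) k - sigma (gram A) (k + 1) with hg
  set e := η * ‖gram A‖ with he
  rcases (lastSync_le I t).eq_or_lt with ht | ht
  · rw [ENNReal.ofReal_of_nonpos (h.residual_eq_zero_of_sync (by simp [orthMat]) hr ht)]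
    exact zero_le
  have h0 := h.gram_ne_zero hk hη hr ht
  have hη0 := eta_nonneg hη b h0
  have hσ : 0 < ‖gram A‖ := norm_pos_iff.mpr h0
  have he0 : 0 ≤ e := mul_nonneg hη0 hσ.le
  have hg0 : 0 ≤ g := sub_nonneg.mpr (sigma_anti _ (by omega))
  have hZ : ∀ i, (Z t i)ᵀ * Z t i = 1 := fun i => h.orthonormal (by omega) i
  have h2 : √2 ≤ 2 := by
    rw [Real.sqrt_le_left (by norm_num)]; norm_num
  rcases hη0.eq_or_lt with hη1 | hη1
  · have h3 := h.residual_le_of_aligned hk hs hM hη hr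
    rw [← hη1, mul_zero] at h3
    rw [ENNReal.ofReal_of_nonpos h3]
    exact zero_le
  rcases hg0.eq_or_lt with hg1 | hg1
  · rw [← hg1, mul_zero, ENNReal.ofReal_zero,
      ENNReal.div_zero (ENNReal.ofReal_pos.mpr (mul_pos hη1 hσ)).ne', top_add]
    exact le_top
  rw [← ENNReal.ofReal_div_of_pos (by positivity)]
  rcases lt_or_ge g (8 * e) with h8 | h8
  · refine le_add_right (ENNReal.ofReal_le_ofReal ?_)
    have h3 : residual b Z D t ≤ √2 * 1 := residual_le b fun i =>
      (h.align t i).norm_le_sin (hZ i) (hZ b) zero_le_one fun w => by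
        rw [one_mul]
        refine (norm_sub_starProjection_le_norm _ _).trans ?_
        rw [norm_toEuclideanLin_of_orthonormal (hZ b)]
    rw [le_div_iff₀ (by positivity)]
    nlinarith
  by_cases hC : gammaRatio A k = 0 ∨ angleTerm A I Z t ≠ ∞
  swap
  · push Not at hC
    have hpos : 0 < gammaRatio A k := lt_of_le_of_ne gammaRatio_nonneg (Ne.symm hC.1)
    rw [hC.2, ENNReal.mul_top, add_top]
    · exact le_top
    · refine mul_ne_zero two_ne_zero (ENNReal.ofReal_pos.mpr ?_).ne'
      positivity
  obtain ⟨T, hT0, hTle, hT⟩ := h.exists_tan_bound hk hr ht hη (by linarith) hg1 hC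
  have hres : residual b Z D t ≤ T + √2 * (4 * (e / g)) + T := by
    have hE : ∀ i, ∃ E : Matrix (Fin d) (Fin k) ℝ, Eᵀ * E = 1 ∧
        colSpace E = topEigenspace (localGram A i) k := fun i =>
      exists_orthonormal_colSpace_eq _ (finrank_topEigenspace (localGram_posSemidef A i)
        (sigma_localGram_gap hk hη (by linarith) i))
    refine residual_le b fun i => ?_
    obtain ⟨E, hE1, hE2⟩ := hE i
    obtain ⟨E', hE1', hE2'⟩ := hE b
    refine (h.align t i).norm_le_of_alignedWithin (hZ i) (hZ b) ?_
    refine AlignedWithin.trans (AlignedWithin.trans (E := E) (W := E') ?_ ?_) ?_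
    · refine alignedWithin_of_tan (hZ i) hE1 hT0 fun w => ?_
      rw [hE2]
      exact hT i w
    · refine alignedWithin_of_sin hE1 hE1' (by positivity) fun w => ?_
      rw [hE2', ← norm_toEuclideanLin_of_orthonormal hE1 w]
      exact davis_kahan_localGram hk hη h8 hg1 i b (hE2 ▸ toEuclideanLin_mem_colSpace E w)
    · refine (alignedWithin_of_tan (hZ b) hE1' hT0 fun w => ?_).symm
      rw [hE2']
      exact hT b w
  have hlast : residual b Z D t ≤ e / (1 / 16 * g) + 2 * T := by
    have h4 : e / (1 / 16 * g) = 16 * (e / g) := by field_simp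
    have h5 : 0 ≤ e / g := by positivity
    have h6 : √2 * (4 * (e / g)) ≤ 2 * (4 * (e / g)) := by gcongr
    rw [h4]
    linarith
  refine (ENNReal.ofReal_le_ofReal hlast).trans ?_
  rw [ENNReal.ofReal_add (by positivity) (by positivity), ENNReal.ofReal_mul zero_le_two,
    ENNReal.ofReal_ofNat, mul_assoc]
  gcongr

end AngleBound

/-! ### One noisy averaged power step -/

section Step

variable {d k : ℕ} {M : Matrix (Fin d) (Fin d) ℝ}

/-- Arithmetic of one step: the perturbed growth factors of the two components give the contraction
of the tangent by `1 - g / (2α)`, where `g = α - β` is the gap. -/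
theorem contraction_arith {α β a e ν r : ℝ} (hβ : 0 ≤ β) (hαβ : β < α) (ha : 0 ≤ a) (he : 0 ≤ e)
    (hν : 0 ≤ ν) (hr : 0 ≤ r) (h1 : α * r ≤ 3 / 40 * (α - β))
    (h2 : (e + ν) * (1 + a) ≤ 3 / 20 * (α - β)) (h3 : e + ν ≤ 1 / 40 * (α - β)) :
    5 / 8 * α ≤ α * (1 - r) - e * (1 + a) * (1 + r) - ν * (1 + a) ∧
      (β * a + e * (1 + a)) * (1 + r) + ν * (1 + a) ≤
        ((1 - (α - β) / (2 * α)) * a + 4 * (e + ν) / α) *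
          (α * (1 - r) - e * (1 + a) * (1 + r) - ν * (1 + a)) := by
  have hα : 0 < α := hβ.trans_lt hαβ
  set g := α - β with hg
  have hg0 : 0 < g := sub_pos.mpr hαβ
  have hgα : g ≤ α := by linarith
  have hr1 : r ≤ 1 := by nlinarith
  have hβr : β * r ≤ 3 / 40 * g := by nlinarith
  have hea : 0 ≤ e * (1 + a) := by positivity
  have hνa : 0 ≤ ν * (1 + a) := by positivity
  have her : e * (1 + a) * (1 + r) ≤ 2 * (e * (1 + a)) := by nlinarith
  have hden : α - 3 / 8 * g ≤ α * (1 - r) - e * (1 + a) * (1 + r) - ν * (1 + a) := by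
    linarith
  refine ⟨by linarith, ?_⟩
  have hq : g / (2 * α) ≤ 1 / 2 := by
    rw [div_le_iff₀ (by positivity)]
    linarith
  have hcoef : 0 ≤ (1 - g / (2 * α)) * a + 4 * (e + ν) / α := by
    have : 0 ≤ 1 - g / (2 * α) := by linarith
    positivity
  refine le_trans ?_ (mul_le_mul_of_nonneg_left hden hcoef)
  have hnum : (β * a + e * (1 + a)) * (1 + r) + ν * (1 + a) ≤
      (α - 7 / 8 * g) * a + 2 * (e + ν) := by
    have h4 : β * r * a ≤ 3 / 40 * g * a := mul_le_mul_of_nonneg_right hβr ha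
    have h5 : (e + ν) * a ≤ 1 / 40 * g * a := mul_le_mul_of_nonneg_right h3 ha
    have h6 : β * a = (α - g) * a := by rw [hg]; ring
    linarith
  refine hnum.trans ?_
  have hid : ((1 - g / (2 * α)) * a + 4 * (e + ν) / α) * (α - 3 / 8 * g) =
      (α - 7 / 8 * g) * a + 3 / 16 * g * (g / α) * a +
        4 * (e + ν) * (1 - 3 / 8 * (g / α)) := by
    field_simp
    ring
  rw [hid]
  have h7 : g / α ≤ 1 := (div_le_one hα).mpr hgα
  have h8 : 0 ≤ 3 / 16 * g * (g / α) * a := by positivity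
  have h9 : (e + ν) * (g / α) ≤ e + ν := mul_le_of_le_one_right (by positivity) h7
  linarith

/-- One noisy averaged power step. The vectors `z j` are close to `z₀`, are almost in the top
eigenspace of `M`, and are multiplied by matrices close to `M`. The misalignment `ρ` enters the new
angle only multiplicatively, since every `z j` has a small component outside the eigenspace. -/
theorem averaged_step (hM : M.PosSemidef) (hgap : sigma M (k + 1) < sigma M k)
    {ι : Type} [Fintype ι] {q : ι → ℝ} (hq0 : ∀ j, 0 ≤ q j) (hq1 : ∑ j, q j = 1)
    {B : ι → Matrix (Fin d) (Fin d) ℝ} {e : ℝ} (hB : ∀ j, ‖B j - M‖ ≤ e)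
    {z : ι → EuclideanSpace ℝ (Fin d)} {z₀ n y : EuclideanSpace ℝ (Fin d)} {a ν ρ ω : ℝ}
    (ha : 0 ≤ a) (he : 0 ≤ e) (hν : 0 ≤ ν) (hρ : 0 ≤ ρ)
    (hz : ∀ j, ‖z j - (topEigenspace M k).starProjection (z j)‖ ≤
      a * ‖(topEigenspace M k).starProjection (z j)‖)
    (hzz : ∀ j, ‖z j - z₀‖ ≤ ρ * ω) (hn : ‖n‖ ≤ ν * ω)
    (hω : ω ≤ (1 + a) * ‖(topEigenspace M k).starProjection z₀‖)
    (hy : y = ∑ j, q j • (B j).toEuclideanLin (z j) + n)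
    (h1 : sigma M k * (ρ * (1 + a)) ≤ 3 / 40 * (sigma M k - sigma M (k + 1)))
    (h2 : (e + ν) * (1 + a) ≤ 3 / 20 * (sigma M k - sigma M (k + 1)))
    (h3 : e + ν ≤ 1 / 40 * (sigma M k - sigma M (k + 1))) :
    5 / 8 * sigma M k * ‖(topEigenspace M k).starProjection z₀‖ ≤
        ‖(topEigenspace M k).starProjection y‖ ∧
      ‖y - (topEigenspace M k).starProjection y‖ ≤
        ((1 - (sigma M k - sigma M (k + 1)) / (2 * sigma M k)) * a + 4 * (e + ν) / sigma M k) *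
          ‖(topEigenspace M k).starProjection y‖ := by
  set V := topEigenspace M k with hV
  set P := V.starProjection with hP
  set α := sigma M k with hα
  set β := sigma M (k + 1) with hβ
  set x := ‖P z₀‖ with hx
  set r := ρ * (1 + a) with hr
  have hβ0 : 0 ≤ β := sigma_nonneg M _
  have hα0 : 0 < α := hβ0.trans_lt hgap
  have hx0 : 0 ≤ x := norm_nonneg _
  have hr0 : 0 ≤ r := by positivity
  obtain ⟨hA1, hA2⟩ := contraction_arith hβ0 hgap ha he hν hr0 h1 h2 h3
  have hPle : ∀ v, ‖P v‖ ≤ ‖v‖ := fun v => Submodule.norm_starProjection_apply_le V v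
  have hρω : ρ * ω ≤ r * x := by
    calc ρ * ω ≤ ρ * ((1 + a) * x) := by gcongr
      _ = r * x := by rw [hr]; ring
  have hνω : ‖n‖ ≤ ν * (1 + a) * x := by
    calc ‖n‖ ≤ ν * ((1 + a) * x) := hn.trans (by gcongr)
      _ = _ := by ring
  have hPz : ∀ j, ‖P (z j)‖ ≤ (1 + r) * x := by
    intro j
    have h4 : P (z j) = P z₀ + P (z j - z₀) := by rw [← map_add]; congr 1; abel
    rw [h4]
    refine (norm_add_le _ _).trans ?_
    linarith [hPle (z j - z₀), hzz j]
  have hznorm : ∀ j, ‖z j‖ ≤ (1 + a) * ‖P (z j)‖ := by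
    intro j
    have h4 : ‖z j‖ ≤ ‖P (z j)‖ + ‖z j - P (z j)‖ := by
      have := norm_add_le (P (z j)) (z j - P (z j))
      rwa [add_sub_cancel] at this
    linarith [hz j]
  have herr : ∀ j, ‖(B j - M).toEuclideanLin (z j)‖ ≤ e * (1 + a) * ((1 + r) * x) := by
    intro j
    calc _ ≤ ‖B j - M‖ * ‖z j‖ := norm_toEuclideanLin_le _ _
      _ ≤ e * ((1 + a) * ((1 + r) * x)) := by
        refine mul_le_mul (hB j) ((hznorm j).trans ?_) (norm_nonneg _) he
        exact mul_le_mul_of_nonneg_left (hPz j) (by linarith)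
      _ = _ := by ring
  have hsplit : ∀ j, (B j).toEuclideanLin (z j) =
      M.toEuclideanLin (z j) + (B j - M).toEuclideanLin (z j) := by
    intro j
    rw [map_sub, LinearMap.sub_apply]
    abel
  -- a weighted sum is bounded by a common bound of its terms
  have hsum : ∀ (f : ι → EuclideanSpace ℝ (Fin d)) (c : ℝ), (∀ j, ‖f j‖ ≤ c) →
      ‖∑ j, q j • f j‖ ≤ c := by
    intro f c hf
    calc _ ≤ ∑ j, q j * c := by
          refine norm_sum_le_of_le _ fun j _ => ?_
          rw [norm_smul, Real.norm_eq_abs, abs_of_nonneg (hq0 j)]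
          exact mul_le_mul_of_nonneg_left (hf j) (hq0 j)
      _ = c := by rw [← Finset.sum_mul, hq1, one_mul]
  have hPy : (α * (1 - r) - e * (1 + a) * (1 + r) - ν * (1 + a)) * x ≤ ‖P y‖ := by
    set zb := ∑ j, q j • z j with hzb
    have h4 : y = M.toEuclideanLin zb + ∑ j, q j • (B j - M).toEuclideanLin (z j) + n := by
      rw [hy, hzb, map_sum, ← Finset.sum_add_distrib]
      congr 1
      refine Finset.sum_congr rfl fun j _ => ?_
      rw [hsplit j, smul_add, map_smul]
    have h5 : ‖zb - z₀‖ ≤ r * x := by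
      have h6 : zb - z₀ = ∑ j, q j • (z j - z₀) := by
        simp only [smul_sub, Finset.sum_sub_distrib, ← Finset.sum_smul, hq1, one_smul, hzb]
      rw [h6]
      exact hsum _ _ fun j => (hzz j).trans hρω
    have h7 : (1 - r) * x ≤ ‖P zb‖ := by
      have h8 := norm_sub_norm_le (P z₀) (P zb)
      rw [← map_sub] at h8
      have h9 := hPle (z₀ - zb)
      rw [norm_sub_rev z₀ zb] at h9
      linarith
    have h10 : α * ((1 - r) * x) ≤ ‖P (M.toEuclideanLin zb)‖ :=
      (mul_le_mul_of_nonneg_left h7 hα0.le).trans (sigma_mul_norm_starProjection_le hM hgap zb)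
    have h11 := (hPle _).trans (hsum _ _ herr)
    have h12 := (hPle n).trans hνω
    rw [h4, map_add, map_add, add_assoc]
    have h13 := norm_sub_norm_le (P (M.toEuclideanLin zb))
      (-(P (∑ j, q j • (B j - M).toEuclideanLin (z j)) + P n))
    rw [sub_neg_eq_add, norm_neg] at h13
    have h14 := norm_add_le (P (∑ j, q j • (B j - M).toEuclideanLin (z j))) (P n)
    linarith
  have hQy : ‖y - P y‖ ≤ ((β * a + e * (1 + a)) * (1 + r) + ν * (1 + a)) * x := by
    have h4 : y - P y = ∑ j, q j • ((B j).toEuclideanLin (z j) - P ((B j).toEuclideanLin (z j))) +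
        (n - P n) := by
      rw [hy, map_add, map_sum]
      simp only [smul_sub, Finset.sum_sub_distrib, map_smul]
      abel
    have h5 : ∀ j, ‖(B j).toEuclideanLin (z j) - P ((B j).toEuclideanLin (z j))‖ ≤
        (β * a + e * (1 + a)) * ((1 + r) * x) := by
      intro j
      have h6 : (B j).toEuclideanLin (z j) - P ((B j).toEuclideanLin (z j)) =
          (M.toEuclideanLin (z j) - P (M.toEuclideanLin (z j))) +
            ((B j - M).toEuclideanLin (z j) - P ((B j - M).toEuclideanLin (z j))) := by
        rw [hsplit j, map_add P]
        abel
      rw [h6]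
      have h7 := norm_sub_starProjection_le_sigma_mul hM hgap (z j)
      have h8 := (norm_sub_starProjection_le_norm V _).trans (herr j)
      have h9 : β * ‖z j - P (z j)‖ ≤ β * (a * ((1 + r) * x)) :=
        mul_le_mul_of_nonneg_left ((hz j).trans (mul_le_mul_of_nonneg_left (hPz j) ha)) hβ0
      refine (norm_add_le _ _).trans ?_
      linarith
    rw [h4]
    have h10 := hsum _ _ h5
    have h11 := (norm_sub_starProjection_le_norm V n).trans hνω
    refine (norm_add_le _ _).trans ?_
    linarith
  refine ⟨(mul_le_mul_of_nonneg_right hA1 hx0).trans hPy, ?_⟩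
  have hcoef : 0 ≤ (1 - (α - β) / (2 * α)) * a + 4 * (e + ν) / α := by
    have : (α - β) / (2 * α) ≤ 1 := by
      rw [div_le_one (by positivity)]
      linarith
    have : 0 ≤ 1 - (α - β) / (2 * α) := by linarith
    positivity
  calc _ ≤ _ := hQy
    _ ≤ _ := mul_le_mul_of_nonneg_right hA2 hx0
    _ ≤ _ := by
      rw [mul_assoc]
      exact mul_le_mul_of_nonneg_left hPy hcoef

end Step

/-! ### The recursion for the angles -/

section Recursion

/-- The solution of the recursion `a' = (1 - g / (2α)) a + 4 (e + n) / α` that bounds the tangents of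
the angles, where `n` is the size of the noise. -/
noncomputable def angleSeq (χ g α e : ℝ) (n : ℕ → ℝ) : ℕ → ℝ
  | 0 => 1 / χ
  | t + 1 => (1 - g / (2 * α)) * angleSeq χ g α e n t + 4 * (e + n (t + 1)) / α

variable {χ g α e ν : ℝ} {n : ℕ → ℝ}

theorem angleSeq_nonneg (hχ : 0 < χ) (hα : 0 < α) (hg : g ≤ α) (he : 0 ≤ e) (hn : ∀ u, 0 ≤ n u)
    (t : ℕ) : 0 ≤ angleSeq χ g α e n t := by
  induction t with
  | zero => exact (one_div_pos.mpr hχ).le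
  | succ t ih =>
    have h1 : g / (2 * α) ≤ 1 := by
      rw [div_le_one (by positivity)]
      linarith
    have h2 : 0 ≤ 1 - g / (2 * α) := by linarith
    have := hn (t + 1)
    rw [angleSeq]
    positivity

/-- The fixed point of the recursion with constant noise `ν` is `8 (e + ν) / g`. -/
theorem angleSeq_add_le (hα : 0 < α) (hg0 : 0 < g) (hg : g ≤ α) (he : 0 ≤ e) (hν : 0 ≤ ν)
    (t₀ j : ℕ) (hn : ∀ u, t₀ < u → u ≤ t₀ + j → n u ≤ ν) :
    angleSeq χ g α e n (t₀ + j) ≤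
      (1 - g / (2 * α)) ^ j * angleSeq χ g α e n t₀ + 8 * ((e + ν) / g) := by
  have h1 : g / (2 * α) ≤ 1 := by
    rw [div_le_one (by positivity)]
    linarith
  have h2 : 0 ≤ 1 - g / (2 * α) := by linarith
  induction j with
  | zero =>
    have : 0 ≤ 8 * ((e + ν) / g) := by positivity
    simpa using this
  | succ j ih =>
    have h3 := mul_le_mul_of_nonneg_left (ih fun u hu hu' => hn u hu (by omega)) h2
    have h4 : 4 * (e + n (t₀ + (j + 1))) / α ≤ 4 * (e + ν) / α := by
      have := hn (t₀ + (j + 1)) (by omega) le_rfl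
      gcongr
    have h5 : 4 * (e + ν) / α = g / (2 * α) * (8 * ((e + ν) / g)) := by
      field_simp
      ring
    rw [← add_assoc, angleSeq, pow_succ]
    rw [← add_assoc] at h4
    linarith

end Recursion

/-! ### Convergence of runs with alignment -/

section Convergence

variable {m d k : ℕ} {s : Fin m → ℕ}
  {A : (i : Fin m) → Matrix (Fin (s i)) (Fin d) ℝ} {b : Fin m} {I : Set ℕ}
  {Z Y : ℕ → Fin m → Matrix (Fin d) (Fin k) ℝ} {D : ℕ → Fin m → Matrix (Fin k) (Fin k) ℝ}
  {N : ℕ → Fin m → Matrix (Fin d) (Fin k) ℝ} {N' : ℕ → Matrix (Fin d) (Fin k) ℝ}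
  {η χ ν ρ : ℝ}

/-- The tangent of the angle between the columns of `X` and `V` is at most `a`, and `X` does not
shrink vectors much in the direction of `V`. For orthonormal columns the second part follows from the
first; it is stated separately for the sake of an initial matrix that is not orthonormal. -/
structure NearSubspace (V : Submodule ℝ (EuclideanSpace ℝ (Fin d))) (a : ℝ)
    (X : Matrix (Fin d) (Fin k) ℝ) : Prop where
  tan_le : ∀ w, ‖X.toEuclideanLin w - V.starProjection (X.toEuclideanLin w)‖ ≤
    a * ‖V.starProjection (X.toEuclideanLin w)‖
  norm_le : ∀ w, ‖w‖ ≤ (1 + a) * ‖V.starProjection (X.toEuclideanLin w)‖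

theorem NearSubspace.injective {V : Submodule ℝ (EuclideanSpace ℝ (Fin d))} {a : ℝ}
    {X : Matrix (Fin d) (Fin k) ℝ} (h : NearSubspace V a X) (w : EuclideanSpace ℝ (Fin k))
    (hw : X.toEuclideanLin w = 0) : w = 0 := by
  have h1 := h.norm_le w
  rw [hw, map_zero, norm_zero, mul_zero] at h1
  exact norm_le_zero_iff.mp h1

theorem NearSubspace.finrank_colSpace {V : Submodule ℝ (EuclideanSpace ℝ (Fin d))} {a : ℝ}
    {X : Matrix (Fin d) (Fin k) ℝ} (h : NearSubspace V a X) :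
    Module.finrank ℝ (colSpace X) = k := by
  have hinj : Function.Injective X.toEuclideanLin := by
    rw [← LinearMap.ker_eq_bot, LinearMap.ker_eq_bot']
    exact h.injective
  rw [colSpace, LinearMap.finrank_range_of_inj hinj, finrank_euclideanSpace_fin]

/-- Orthogonalization keeps the column space, hence its angle to `V`. -/
theorem NearSubspace.of_isOrth {V : Submodule ℝ (EuclideanSpace ℝ (Fin d))} {a : ℝ}
    {Y Z : Matrix (Fin d) (Fin k) ℝ} (h : IsOrth Y Z)
    (hinj : ∀ w, Y.toEuclideanLin w = 0 → w = 0)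
    (hY : ∀ w, ‖Y.toEuclideanLin w - V.starProjection (Y.toEuclideanLin w)‖ ≤
      a * ‖V.starProjection (Y.toEuclideanLin w)‖) : NearSubspace V a Z := by
  obtain ⟨R, R', hR, hYR⟩ := h.exists_triangularPair hinj
  have htan : ∀ w, ‖Z.toEuclideanLin w - V.starProjection (Z.toEuclideanLin w)‖ ≤
      a * ‖V.starProjection (Z.toEuclideanLin w)‖ := by
    intro w
    have h1 : Z.toEuclideanLin w = Y.toEuclideanLin (R'.toEuclideanLin w) := by
      rw [← toEuclideanLin_mul_apply, hYR, Matrix.mul_assoc, hR.mul_eq, Matrix.mul_one]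
    rw [h1]
    exact hY _
  refine ⟨htan, fun w => ?_⟩
  have h2 := norm_add_le (V.starProjection (Z.toEuclideanLin w))
    (Z.toEuclideanLin w - V.starProjection (Z.toEuclideanLin w))
  rw [add_sub_cancel, norm_toEuclideanLin_of_orthonormal h.1] at h2
  linarith [htan w]

/-- The noise that enters the recursion for the angles: it is present at communications only. -/
noncomputable def stepNoise (s : Fin m → ℕ) (I : Set ℕ)
    (N : ℕ → Fin m → Matrix (Fin d) (Fin k) ℝ) (N' : ℕ → Matrix (Fin d) (Fin k) ℝ) (u : ℕ) : ℝ :=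
  open Classical in if u ∈ I then noiseNorm s N N' u else 0

theorem stepNoise_nonneg (u : ℕ) : 0 ≤ stepNoise s I N N' u := by
  unfold stepNoise
  split_ifs
  · exact norm_nonneg _
  · exact le_rfl

theorem stepNoise_le {u : ℕ} (hν : 0 ≤ ν) (h : u ∈ I → noiseNorm s N N' u ≤ ν) :
    stepNoise s I N N' u ≤ ν := by
  unfold stepNoise
  split_ifs with hu
  · exact h hu
  · exact hν

/-- The smallness conditions under which the angles contract. -/
structure SmallError (A : (i : Fin m) → Matrix (Fin (s i)) (Fin d) ℝ) (k : ℕ) (η χ ν ρ : ℝ) :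
    Prop where
  gap_pos : 0 < sigma (gram A) k - sigma (gram A) (k + 1)
  eta_nonneg : 0 ≤ η
  chi_pos : 0 < χ
  chi_le : χ ≤ 1
  noise_nonneg : 0 ≤ ν
  rho_nonneg : 0 ≤ ρ
  le_half : η * ‖gram A‖ + ν ≤ 1 / 40 * (sigma (gram A) k - sigma (gram A) (k + 1))
  le_chi : η * ‖gram A‖ + ν ≤ 1 / 20 * χ * (sigma (gram A) k - sigma (gram A) (k + 1))
  rho_le : ‖gram A‖ * ρ ≤ 1 / 40 * χ * (sigma (gram A) k - sigma (gram A) (k + 1))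

theorem chi_le_one (hk : 1 ≤ k) (V : Submodule ℝ (EuclideanSpace ℝ (Fin d)))
    (X : Matrix (Fin d) (Fin k) ℝ)
    (h : ∀ w : EuclideanSpace ℝ (Fin k), χ * max 1 ‖X‖ * ‖w‖ ≤
      ‖V.starProjection (X.toEuclideanLin w)‖) : χ ≤ 1 := by
  have h1 := (h (EuclideanSpace.single ⟨0, hk⟩ 1)).trans
    ((Submodule.norm_starProjection_apply_le V _).trans (norm_toEuclideanLin_le X _))
  rw [PiLp.norm_single, norm_one, mul_one, mul_one] at h1
  have h2 : ‖X‖ ≤ max 1 ‖X‖ := le_max_right _ _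
  have h3 : 1 ≤ max 1 ‖X‖ := le_max_left _ _
  nlinarith

/-- The hypothesis on `ε'` bounds the data discrepancy, the noise and the misalignment. -/
theorem smallError_of_epsPrime (hk : 1 ≤ k) (hs : ∀ i, 0 < s i) (hη : LocalApprox A η)
    (hgap : 0 < sigma (gram A) k - sigma (gram A) (k + 1)) (hχ : 0 < χ) (hχ1 : χ ≤ 1)
    (hν : 0 ≤ ν) (hρ : 0 ≤ ρ) (hρ1 : (1 - weight s b) * ρ < 1)
    (hε : epsPrime A b k η ν ρ ≤ 1 / 20 * min (1 / 2) χ) : SmallError A k η χ ν ρ := by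
  set g := sigma (gram A) k - sigma (gram A) (k + 1) with hg
  have h0 : gram A ≠ 0 := by
    intro h
    have h2 : ‖gram A‖ = 0 := by rw [h, norm_zero]
    have h1 := sigma_anti (gram A) hk
    rw [← norm_eq_sigma_one (gram_posSemidef A), h2] at h1
    linarith [sigma_nonneg (gram A) (k + 1)]
  have hη0 := eta_nonneg hη b h0
  have hw1 : weight s b ≤ 1 := by
    rw [← sum_weight hs b]
    exact Finset.single_le_sum (fun i _ => weight_nonneg s i) (Finset.mem_univ b)
  have hden : 0 < 1 - (1 - weight s b) * ρ := by linarith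
  rw [epsPrime, ← norm_eq_sigma_one (gram_posSemidef A), ← hg, div_le_iff₀ (by positivity)] at hε
  have hmin : 0 < min (1 / 2) χ := lt_min (by norm_num) hχ
  have h4 : g * (1 - (1 - weight s b) * ρ) ≤ g := by
    have : 0 ≤ (1 - weight s b) * ρ := mul_nonneg (by linarith) hρ
    nlinarith
  have h5 : ν + ‖gram A‖ * (η + (2 + η) * ρ) ≤ 1 / 20 * min (1 / 2) χ * g :=
    hε.trans (mul_le_mul_of_nonneg_left h4 (by positivity))
  have hσ : 0 ≤ ‖gram A‖ := norm_nonneg _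
  have h6 : 0 ≤ ‖gram A‖ * (η * ρ) := by positivity
  have h7 : 0 ≤ ‖gram A‖ * ρ := by positivity
  have h8 : 0 ≤ η * ‖gram A‖ := by positivity
  have h9 : 1 / 20 * min (1 / 2) χ * g ≤ 1 / 40 * g := by
    refine mul_le_mul_of_nonneg_right ?_ hgap.le
    linarith [min_le_left (1 / 2) χ]
  have h10 : 1 / 20 * min (1 / 2) χ * g ≤ 1 / 20 * χ * g := by
    refine mul_le_mul_of_nonneg_right ?_ hgap.le
    linarith [min_le_right (1 / 2) χ]
  have h11 : ‖gram A‖ * (η + (2 + η) * ρ) =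
      η * ‖gram A‖ + 2 * (‖gram A‖ * ρ) + ‖gram A‖ * (η * ρ) := by ring
  exact ⟨hgap, hη0, hχ, hχ1, hν, hρ, by linarith, by linarith, by linarith⟩

/-- The sequence of upper bounds for the tangents of the angles between the iterates and the top
eigenspace of the global matrix. -/
noncomputable def angleBound (A : (i : Fin m) → Matrix (Fin (s i)) (Fin d) ℝ) (I : Set ℕ)
    (N : ℕ → Fin m → Matrix (Fin d) (Fin k) ℝ) (N' : ℕ → Matrix (Fin d) (Fin k) ℝ) (η χ : ℝ) :
    ℕ → ℝ :=
  angleSeq χ (sigma (gram A) k - sigma (gram A) (k + 1)) (sigma (gram A) k) (η * ‖gram A‖)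
    (stepNoise s I N N')

theorem SmallError.sigma_pos (h : SmallError A k η χ ν ρ) : 0 < sigma (gram A) k := by
  linarith [h.gap_pos, sigma_nonneg (gram A) (k + 1)]

theorem SmallError.error_nonneg (h : SmallError A k η χ ν ρ) : 0 ≤ η * ‖gram A‖ :=
  mul_nonneg h.eta_nonneg (norm_nonneg _)

theorem SmallError.gap_le (_h : SmallError A k η χ ν ρ) :
    sigma (gram A) k - sigma (gram A) (k + 1) ≤ sigma (gram A) k := by
  linarith [sigma_nonneg (gram A) (k + 1)]

theorem SmallError.rate_nonneg (h : SmallError A k η χ ν ρ) :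
    0 ≤ 1 - (sigma (gram A) k - sigma (gram A) (k + 1)) / (2 * sigma (gram A) k) := by
  have h1 := h.sigma_pos
  rw [sub_nonneg, div_le_one (by positivity)]
  linarith [h.gap_le]

theorem SmallError.rate_lt_one (h : SmallError A k η χ ν ρ) :
    1 - (sigma (gram A) k - sigma (gram A) (k + 1)) / (2 * sigma (gram A) k) < 1 := by
  have h1 := h.sigma_pos
  have h2 := h.gap_pos
  have : 0 < (sigma (gram A) k - sigma (gram A) (k + 1)) / (2 * sigma (gram A) k) := by positivity
  linarith

theorem SmallError.angleBound_nonneg (h : SmallError A k η χ ν ρ) (t : ℕ) :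
    0 ≤ angleBound A I N N' η χ t :=
  angleSeq_nonneg h.chi_pos h.sigma_pos h.gap_le h.error_nonneg stepNoise_nonneg t

theorem SmallError.angleBound_le (h : SmallError A k η χ ν ρ) {T : ℕ}
    (hN : ∀ u ∈ I, 1 ≤ u → u ≤ T → noiseNorm s N N' u ≤ ν) {t : ℕ} (ht : t ≤ T) :
    angleBound A I N N' η χ t ≤
      (1 - (sigma (gram A) k - sigma (gram A) (k + 1)) / (2 * sigma (gram A) k)) ^ t / χ +
        8 * ((η * ‖gram A‖ + ν) / (sigma (gram A) k - sigma (gram A) (k + 1))) := by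
  have h1 := angleSeq_add_le (χ := χ) (n := stepNoise s I N N') h.sigma_pos h.gap_pos h.gap_le
    h.error_nonneg h.noise_nonneg 0 t fun u hu hut =>
      stepNoise_le h.noise_nonneg fun hI => hN u hI hu (by omega)
  rw [zero_add, angleSeq, mul_one_div] at h1
  exact h1

theorem SmallError.one_add_angleBound_le (h : SmallError A k η χ ν ρ) {T : ℕ}
    (hN : ∀ u ∈ I, 1 ≤ u → u ≤ T → noiseNorm s N N' u ≤ ν) {t : ℕ} (ht : t ≤ T) :
    (1 + angleBound A I N N' η χ t) * χ ≤ 3 := by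
  have h1 := h.angleBound_le hN ht
  have h2 := pow_le_one₀ (n := t) h.rate_nonneg h.rate_lt_one.le
  have hχ := h.chi_pos
  have h3 : (η * ‖gram A‖ + ν) / (sigma (gram A) k - sigma (gram A) (k + 1)) ≤ 1 / 40 := by
    rw [div_le_iff₀ h.gap_pos]
    exact h.le_half
  have h4 := div_le_div_of_nonneg_right h2 hχ.le
  have h5 : angleBound A I N N' η χ t ≤ 1 / χ + 1 / 5 := by linarith
  have h6 : (1 + angleBound A I N N' η χ t) * χ ≤ (1 + (1 / χ + 1 / 5)) * χ :=
    mul_le_mul_of_nonneg_right (by linarith) hχ.le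
  have h7 : (1 + (1 / χ + 1 / 5)) * χ = 6 / 5 * χ + 1 := by
    field_simp
    ring
  linarith [h.chi_le]

/-- All the iterates stay close to the top eigenspace of the global matrix, at the rate of the
recursion. In particular all the matrices being orthogonalized have full column rank. -/
theorem IsRun.nearSubspace (h : IsRun (orthMat k) A b I Z Y D N N') (hk : 1 ≤ k) (hs : ∀ i, 0 < s i)
    (hη : LocalApprox A η) (hsm : SmallError A k η χ ν ρ)
    (hχ : ∀ w : EuclideanSpace ℝ (Fin k), χ * max 1 ‖Z 0 b‖ * ‖w‖ ≤
      ‖(topEigenspace (gram A) k).starProjection ((Z 0 b).toEuclideanLin w)‖) {T : ℕ}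
    (hN : ∀ u ∈ I, 1 ≤ u → u ≤ T → noiseNorm s N N' u ≤ ν)
    (hρ : ∀ u ≤ T, residual b Z D u ≤ ρ) (t : ℕ) (ht : t ≤ T) (i : Fin m) :
    NearSubspace (topEigenspace (gram A) k) (angleBound A I N N' η χ t) (Z t i) := by
  set V := topEigenspace (gram A) k with hV
  have hχ0 := hsm.chi_pos
  induction t generalizing i with
  | zero =>
    rw [h.init i]
    have h1 : ∀ w, ‖w‖ ≤ 1 / χ * ‖V.starProjection ((Z 0 b).toEuclideanLin w)‖ := by
      intro w
      rw [one_div, ← div_eq_inv_mul, le_div_iff₀ hχ0]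
      refine le_trans ?_ (hχ w)
      calc ‖w‖ * χ = χ * 1 * ‖w‖ := by ring
        _ ≤ _ := by gcongr; exact le_max_left _ _
    refine ⟨fun w => ?_, fun w => (h1 w).trans ?_⟩
    · refine (norm_sub_starProjection_le_norm V _).trans ((norm_toEuclideanLin_le _ w).trans ?_)
      change _ ≤ 1 / χ * _
      rw [one_div, ← div_eq_inv_mul, le_div_iff₀ hχ0]
      refine le_trans ?_ (hχ w)
      calc ‖Z 0 b‖ * ‖w‖ * χ = χ * ‖Z 0 b‖ * ‖w‖ := by ring
        _ ≤ _ := by gcongr; exact le_max_right _ _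
    · refine mul_le_mul_of_nonneg_right ?_ (norm_nonneg _)
      change _ ≤ 1 + 1 / χ
      linarith
  | succ t ih =>
    set a := angleBound A I N N' η χ t with ha
    have ha0 : 0 ≤ a := hsm.angleBound_nonneg t
    have hα := hsm.sigma_pos
    have hgap := sub_pos.mp hsm.gap_pos
    have hM := gram_posSemidef A
    have hIH : ∀ j, NearSubspace V a (Z t j) := fun j => ih (by omega) j
    have haχ := hsm.one_add_angleBound_le hN (show t ≤ T by omega)
    rw [← ha] at haχ
    set n := stepNoise s I N N' (t + 1) with hn
    have hn0 : 0 ≤ n := stepNoise_nonneg _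
    have hnν : n ≤ ν := stepNoise_le hsm.noise_nonneg fun hI => hN _ hI (by omega) ht
    set g := sigma (gram A) k - sigma (gram A) (k + 1) with hg
    have hg0 : 0 < g := hsm.gap_pos
    have hcond1 : sigma (gram A) k * (ρ * (1 + a)) ≤ 3 / 40 * g := by
      have h1 : sigma (gram A) k ≤ ‖gram A‖ := by
        rw [norm_eq_sigma_one hM]
        exact sigma_anti _ hk
      have h2 := hsm.rho_nonneg
      calc _ ≤ ‖gram A‖ * (ρ * (1 + a)) := by gcongr
        _ = ‖gram A‖ * ρ * (1 + a) := by ring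
        _ ≤ 1 / 40 * χ * g * (1 + a) := by
          refine mul_le_mul_of_nonneg_right hsm.rho_le (by linarith)
        _ = 1 / 40 * g * ((1 + a) * χ) := by ring
        _ ≤ 1 / 40 * g * 3 := by gcongr
        _ = _ := by ring
    have hcond2 : (η * ‖gram A‖ + n) * (1 + a) ≤ 3 / 20 * g := by
      calc _ ≤ (1 / 20 * χ * g) * (1 + a) := by
            refine mul_le_mul_of_nonneg_right ?_ (by linarith)
            linarith [hsm.le_chi]
        _ = 1 / 20 * g * ((1 + a) * χ) := by ring
        _ ≤ 1 / 20 * g * 3 := by gcongr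
        _ = _ := by ring
    have hcond3 : η * ‖gram A‖ + n ≤ 1 / 40 * g := by linarith [hsm.le_half]
    -- the two kinds of steps are instances of the same averaged step
    have key : ∀ w, ∃ j, 5 / 8 * sigma (gram A) k *
          ‖V.starProjection ((Z t j).toEuclideanLin w)‖ ≤
        ‖V.starProjection ((Y (t + 1) i).toEuclideanLin w)‖ ∧
      ‖(Y (t + 1) i).toEuclideanLin w - V.starProjection ((Y (t + 1) i).toEuclideanLin w)‖ ≤
        angleBound A I N N' η χ (t + 1) *
          ‖V.starProjection ((Y (t + 1) i).toEuclideanLin w)‖ := by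
      intro w
      by_cases hI : t + 1 ∈ I
      · refine ⟨b, averaged_step hM hgap (weight_nonneg s) (sum_weight hs b) (B := localGram A) hη
          (z := fun j => (Z t j * D (t + 1) j).toEuclideanLin w)
          (n := ((∑ j, weight s j • N (t + 1) j) + N' (t + 1)).toEuclideanLin w) (ω := ‖w‖) (ρ := ρ)
          ha0 hsm.error_nonneg hn0 hsm.rho_nonneg ?_ ?_ ?_ ((hIH b).norm_le w) ?_ hcond1 hcond2
          hcond3⟩
        · intro j
          simp only [toEuclideanLin_mul_apply]
          exact (hIH j).tan_le _
        · intro j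
          rw [← LinearMap.sub_apply, ← map_sub]
          refine (norm_toEuclideanLin_le _ w).trans ?_
          gcongr
          exact (le_residual j).trans (hρ t (by omega))
        · refine (norm_toEuclideanLin_le _ w).trans ?_
          gcongr
          rw [stepNoise, if_pos hI]
          rfl
        · rw [h.step_sync t hI i]
          simp only [smul_add, Finset.sum_add_distrib, map_add, LinearMap.add_apply, map_sum,
            LinearMap.sum_apply, map_smul, LinearMap.smul_apply, toEuclideanLin_mul_apply]
          rw [add_assoc]
      · have hn1 : n = 0 := by rw [hn, stepNoise, if_neg hI]
        refine ⟨i, averaged_step hM hgap (ι := Unit) (q := fun _ => 1) (fun _ => zero_le_one)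
          (by simp) (B := fun _ => localGram A i) (fun _ => hη i)
          (z := fun _ => (Z t i).toEuclideanLin w) (n := 0) (ω := ‖w‖) (ρ := ρ)
          ha0 hsm.error_nonneg hn0 hsm.rho_nonneg (fun _ => (hIH i).tan_le w) ?_ ?_
          ((hIH i).norm_le w) ?_ hcond1 hcond2 hcond3⟩
        · intro _
          rw [sub_self, norm_zero]
          exact mul_nonneg hsm.rho_nonneg (norm_nonneg _)
        · rw [norm_zero]
          exact mul_nonneg hn0 (norm_nonneg _)
        · rw [h.step_local t hI i, toEuclideanLin_mul_apply]
          simp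
    refine NearSubspace.of_isOrth (h.orth t i) (fun w hw => ?_) fun w => ?_
    · obtain ⟨j, hj, -⟩ := key w
      rw [hw, map_zero, norm_zero] at hj
      have h1 := (hIH j).norm_le w
      have h2 : ‖V.starProjection ((Z t j).toEuclideanLin w)‖ = 0 :=
        le_antisymm (nonpos_of_mul_nonpos_right hj (by positivity)) (norm_nonneg _)
      rw [h2, mul_zero] at h1
      exact norm_le_zero_iff.mp h1
    · obtain ⟨j, -, hj⟩ := key w
      exact hj

/-- The residual error is bounded by the angles to the global eigenspace: all the iterates are
compared with one orthonormal basis of it. -/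
theorem IsRun.residual_le_two_mul (h : IsRun (orthMat k) A b I Z Y D N N')
    (hgap : sigma (gram A) (k + 1) < sigma (gram A) k) {t : ℕ} {a : ℝ} (ha : 0 ≤ a)
    (hZ : ∀ i, NearSubspace (topEigenspace (gram A) k) a (Z t i)) :
    residual b Z D t ≤ 2 * a := by
  rcases Nat.eq_zero_or_pos t with rfl | ht
  · exact (h.residual_eq_zero (by simp [orthMat]) h.init).trans (by positivity)
  obtain ⟨E, hE1, hE2⟩ :=
    exists_orthonormal_colSpace_eq _ (finrank_topEigenspace (gram_posSemidef A) hgap)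
  have hal : ∀ i, AlignedWithin a (Z t i) E := fun i =>
    alignedWithin_of_tan (h.orthonormal ht i) hE1 ha fun w => by
      rw [hE2]
      exact (hZ i).tan_le w
  refine residual_le b fun i => ?_
  have h1 := (h.align t i).norm_le_of_alignedWithin (h.orthonormal ht i) (h.orthonormal ht b)
    ((hal i).trans (hal b).symm)
  linarith

/-- The angles to the local eigenspaces differ from the one to the global eigenspace by the distance
of these eigenspaces. -/
theorem tanTheta_localGram_le (hk : 1 ≤ k) (hη : LocalApprox A η) (hsm : SmallError A k η χ ν ρ)
    {a : ℝ} (ha : 0 ≤ a) (haχ : (1 + a) * χ ≤ 3) {X : Matrix (Fin d) (Fin k) ℝ}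
    (hX : NearSubspace (topEigenspace (gram A) k) a X) (i : Fin m) :
    tanTheta (colSpace X) (topEigenspace (localGram A i) k) ≤ ENNReal.ofReal
      (4 * a + 4 * (η * ‖gram A‖ / (sigma (gram A) k - sigma (gram A) (k + 1)))) := by
  set g := sigma (gram A) k - sigma (gram A) (k + 1) with hg
  have hg0 : 0 < g := hsm.gap_pos
  set δ := η * ‖gram A‖ / g with hδ
  have he := hsm.error_nonneg
  have hδ0 : 0 ≤ δ := by positivity
  have hh := hsm.le_half
  have hc := hsm.le_chi
  have hν := hsm.noise_nonneg
  have hδ1 : δ ≤ 1 / 40 := by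
    rw [hδ, div_le_iff₀ hg0]
    linarith
  have hδχ : δ ≤ 1 / 20 * χ := by
    rw [hδ, div_le_iff₀ hg0]
    linarith
  have hδa : δ * (1 + a) ≤ 3 / 20 := by
    calc _ ≤ 1 / 20 * χ * (1 + a) := mul_le_mul_of_nonneg_right hδχ (by linarith)
      _ = 1 / 20 * ((1 + a) * χ) := by ring
      _ ≤ 1 / 20 * 3 := by gcongr
      _ = _ := by norm_num
  have hgi := sigma_localGram_gap hk hη (show 2 * (η * ‖gram A‖) < g by linarith) i
  have hdimi := finrank_topEigenspace (localGram_posSemidef A i) hgi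
  have hdim := finrank_topEigenspace (gram_posSemidef A) (sub_pos.mp hg0)
  have hsin : sinTheta (topEigenspace (gram A) k) (topEigenspace (localGram A i) k) ≤ 2 * δ :=
    sinTheta_le (hdim.trans hdimi.symm) (by positivity) (by linarith) fun u hu =>
      davis_kahan_gram hk hη (by linarith) hg0 i hu
  refine tanTheta_le (hX.finrank_colSpace.trans hdimi.symm) (by positivity) ?_
  rintro _ ⟨w, rfl⟩
  have h1 := hX.tan_le w
  set z := X.toEuclideanLin w
  set P := (topEigenspace (gram A) k).starProjection
  set P' := (topEigenspace (localGram A i) k).starProjection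
  set x := ‖P z‖
  have hx : 0 ≤ x := norm_nonneg _
  have hz : ‖z‖ ≤ (1 + a) * x := by
    have := norm_add_le (P z) (z - P z)
    rw [add_sub_cancel] at this
    linarith
  have hPP : ‖P z - P' z‖ ≤ 2 * δ * ((1 + a) * x) := by
    have h2 := (P - P').le_opNorm z
    rw [_root_.sub_apply] at h2
    refine h2.trans (mul_le_mul hsin hz (norm_nonneg _) (by positivity))
  have hx2 : x ≤ 2 * ‖P' z‖ := by
    have h2 := norm_sub_norm_le (P z) (P' z)
    have h3 : 2 * δ * ((1 + a) * x) = 2 * (δ * (1 + a)) * x := by ring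
    have h4 : 2 * (δ * (1 + a)) * x ≤ 2 * (3 / 20) * x := by gcongr
    linarith
  have h5 : ‖z - P' z‖ ≤ (a + 2 * δ * (1 + a)) * x := by
    have h6 : z - P' z = (z - P z) + (P z - P' z) := by abel
    rw [h6]
    refine (norm_add_le _ _).trans ?_
    linarith
  refine h5.trans ?_
  have h7 : a + 2 * δ * (1 + a) ≤ 2 * a + 2 * δ := by nlinarith
  calc _ ≤ (2 * a + 2 * δ) * (2 * ‖P' z‖) := by gcongr
    _ = _ := by ring

theorem IsRun.angleTerm_le (h : IsRun (orthMat k) A b I Z Y D N N') (hk : 1 ≤ k)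
    (hs : ∀ i, 0 < s i) (hη : LocalApprox A η) (hsm : SmallError A k η χ ν ρ)
    (hχ : ∀ w : EuclideanSpace ℝ (Fin k), χ * max 1 ‖Z 0 b‖ * ‖w‖ ≤
      ‖(topEigenspace (gram A) k).starProjection ((Z 0 b).toEuclideanLin w)‖) {T : ℕ}
    (hN : ∀ u ∈ I, 1 ≤ u → u ≤ T → noiseNorm s N N' u ≤ ν)
    (hρ : ∀ u ≤ T, residual b Z D u ≤ ρ) (t : ℕ) (ht : t ≤ T) :
    angleTerm A I Z t ≤ ENNReal.ofReal (4 * angleBound A I N N' η χ (lastSync I t) +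
      4 * (η * ‖gram A‖ / (sigma (gram A) k - sigma (gram A) (k + 1)))) :=
  have hle := (lastSync_le I t).trans ht
  iSup_le fun i => tanTheta_localGram_le hk hη hsm (hsm.angleBound_nonneg _)
    (hsm.one_add_angleBound_le hN hle) (h.nearSubspace hk hs hη hsm hχ hN hρ _ hle i) i

theorem tendsto_lastSync {I : Set ℕ} (hI : I.Infinite) :
    Tendsto (fun t => lastSync I t) atTop atTop := by
  refine tendsto_atTop.mpr fun n => ?_
  obtain ⟨u, huI, hu⟩ := hI.exists_gt n
  filter_upwards [eventually_ge_atTop u] with t ht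
  exact hu.le.trans (le_lastSync huI ht)

theorem limsup_ofReal_le_of_tendsto {f : ℕ → ℝ≥0∞} {c : ℕ → ℝ} {L : ℝ}
    (hf : ∀ᶠ t in atTop, f t ≤ ENNReal.ofReal (c t)) (hc : Tendsto c atTop (nhds L)) :
    limsup f atTop ≤ ENNReal.ofReal L := by
  have h1 : Tendsto (fun t => ENNReal.ofReal (c t)) atTop (nhds (ENNReal.ofReal L)) :=
    (ENNReal.continuous_ofReal.tendsto L).comp hc
  rw [← h1.limsup_eq]
  exact limsup_le_limsup hf

/-- The bounds at a finite time. -/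
theorem IsRun.finite_time_bounds (h : IsRun (orthMat k) A b I Z Y D N N') (hk : 1 ≤ k)
    (hs : ∀ i, 0 < s i) (hη : LocalApprox A η) (hsm : SmallError A k η χ ν ρ)
    (hχ : ∀ w : EuclideanSpace ℝ (Fin k), χ * max 1 ‖Z 0 b‖ * ‖w‖ ≤
      ‖(topEigenspace (gram A) k).starProjection ((Z 0 b).toEuclideanLin w)‖) {T : ℕ}
    (hN : ∀ u ∈ I, 1 ≤ u → u ≤ T → noiseNorm s N N' u ≤ ν)
    (hρ : ∀ u ≤ T, residual b Z D u ≤ ρ) (t : ℕ) (ht : t ≤ T) :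
    angleTerm A I Z t ≤ ENNReal.ofReal
        (40 * ((η * ‖gram A‖ + ν) / (sigma (gram A) k - sigma (gram A) (k + 1)) +
          (1 - (sigma (gram A) k - sigma (gram A) (k + 1)) / (2 * sigma (gram A) k)) ^
            lastSync I t / χ)) ∧
      residual b Z D t ≤ 40 * ((η * ‖gram A‖ + ν) / (sigma (gram A) k - sigma (gram A) (k + 1)) +
        (1 - (sigma (gram A) k - sigma (gram A) (k + 1)) / (2 * sigma (gram A) k)) ^
          lastSync I t / χ) := by
  set g := sigma (gram A) k - sigma (gram A) (k + 1) with hg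
  set r := 1 - g / (2 * sigma (gram A) k) with hr
  have hg0 : 0 < g := hsm.gap_pos
  have hχ0 := hsm.chi_pos
  have hr0 : 0 ≤ r := hsm.rate_nonneg
  have hle := lastSync_le I t
  have hF : η * ‖gram A‖ / g ≤ (η * ‖gram A‖ + ν) / g := by
    have := hsm.noise_nonneg
    gcongr
    linarith
  have hF0 : 0 ≤ η * ‖gram A‖ / g := div_nonneg hsm.error_nonneg hg0.le
  have hpow0 : 0 ≤ r ^ lastSync I t / χ := by positivity
  constructor
  · refine (h.angleTerm_le hk hs hη hsm hχ hN hρ t ht).trans (ENNReal.ofReal_le_ofReal ?_)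
    have h1 := hsm.angleBound_le (χ := χ) hN (hle.trans ht)
    rw [← hg, ← hr] at h1
    linarith
  · have h1 := h.residual_le_two_mul (sub_pos.mp hg0) (hsm.angleBound_nonneg t)
      fun i => h.nearSubspace hk hs hη hsm hχ hN hρ t ht i
    have h2 := hsm.angleBound_le (χ := χ) hN ht
    rw [← hg, ← hr] at h2
    have h3 : r ^ t / χ ≤ r ^ lastSync I t / χ :=
      div_le_div_of_nonneg_right (pow_le_pow_of_le_one hr0 hsm.rate_lt_one.le hle) hχ0.le
    linarith

/-- The bounds in the limit: the contribution of the initial angle and of the early noise is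
forgotten at a geometric rate. -/
theorem IsRun.limit_bounds (h : IsRun (orthMat k) A b I Z Y D N N') (hk : 1 ≤ k)
    (hs : ∀ i, 0 < s i) (hη : LocalApprox A η) (hsm : SmallError A k η χ ν ρ)
    (hχ : ∀ w : EuclideanSpace ℝ (Fin k), χ * max 1 ‖Z 0 b‖ * ‖w‖ ≤
      ‖(topEigenspace (gram A) k).starProjection ((Z 0 b).toEuclideanLin w)‖)
    (hI : I.Infinite) (hN : ∀ u ∈ I, 1 ≤ u → noiseNorm s N N' u ≤ ν)
    (hρ : ∀ u, residual b Z D u ≤ ρ) {ν' : ℝ}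
    (hN' : ∀ᶠ u in atTop, u ∈ I → noiseNorm s N N' u ≤ ν') :
    limsup (fun t => angleTerm A I Z t) atTop ≤ ENNReal.ofReal
        (40 * (η * ‖gram A‖ + ν') / (sigma (gram A) k - sigma (gram A) (k + 1))) ∧
      limsup (fun t => ENNReal.ofReal (residual b Z D t)) atTop ≤ ENNReal.ofReal
        (40 * (η * ‖gram A‖ + ν') / (sigma (gram A) k - sigma (gram A) (k + 1))) := by
  set g := sigma (gram A) k - sigma (gram A) (k + 1) with hg
  set r := 1 - g / (2 * sigma (gram A) k) with hr
  have hg0 : 0 < g := hsm.gap_pos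
  have hr0 : 0 ≤ r := hsm.rate_nonneg
  have hr1 : r < 1 := hsm.rate_lt_one
  obtain ⟨t₀, ht₀⟩ := eventually_atTop.mp hN'
  have hν' : 0 ≤ ν' := by
    obtain ⟨u, huI, hu⟩ := hI.exists_gt t₀
    exact (norm_nonneg _).trans (ht₀ u hu.le huI)
  set L := 8 * ((η * ‖gram A‖ + ν') / g) with hL
  set a := angleBound A I N N' η χ with ha
  -- the explicit bound on the angles from time `t₀` on
  have hbound : ∀ t, t₀ ≤ t → a t ≤ r ^ (t - t₀) * a t₀ + L := by
    intro t ht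
    have h1 := angleSeq_add_le (χ := χ) (n := stepNoise s I N N') hsm.sigma_pos hsm.gap_pos
      hsm.gap_le hsm.error_nonneg hν' t₀ (t - t₀) fun u hu _ =>
        stepNoise_le hν' fun huI => ht₀ u hu.le huI
    rwa [Nat.add_sub_cancel' ht] at h1
  have hlim : Tendsto (fun t => r ^ (t - t₀) * a t₀ + L) atTop (nhds L) := by
    have h1 : Tendsto (fun t : ℕ => r ^ (t - t₀)) atTop (nhds 0) :=
      (tendsto_pow_atTop_nhds_zero_of_lt_one hr0 hr1).comp (tendsto_sub_atTop_nat t₀)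
    simpa using (h1.mul_const (a t₀)).add_const L
  have hF : η * ‖gram A‖ / g ≤ (η * ‖gram A‖ + ν') / g := by
    gcongr
    linarith
  have hF0 : 0 ≤ η * ‖gram A‖ / g := div_nonneg hsm.error_nonneg hg0.le
  have hK : 40 * (η * ‖gram A‖ + ν') / g = 40 * ((η * ‖gram A‖ + ν') / g) := mul_div_assoc _ _ _
  constructor
  · have h1 := limsup_ofReal_le_of_tendsto (f := fun t => angleTerm A I Z t)
      (c := fun t => 4 * (r ^ (lastSync I t - t₀) * a t₀ + L) + 4 * (η * ‖gram A‖ / g))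
      (L := 4 * L + 4 * (η * ‖gram A‖ / g)) ?_ ?_
    · refine h1.trans (ENNReal.ofReal_le_ofReal ?_)
      rw [hK]
      linarith
    · filter_upwards [(tendsto_lastSync hI).eventually_ge_atTop t₀] with t ht
      refine (h.angleTerm_le hk hs hη hsm hχ (T := t) (fun u hu h1 _ => hN u hu h1)
        (fun u _ => hρ u) t le_rfl).trans (ENNReal.ofReal_le_ofReal ?_)
      have := hbound _ ht
      linarith
    · exact ((hlim.comp (tendsto_lastSync hI)).const_mul 4).add_const _
  · have h1 := limsup_ofReal_le_of_tendsto (f := fun t => ENNReal.ofReal (residual b Z D t))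
      (c := fun t => 2 * (r ^ (t - t₀) * a t₀ + L)) (L := 2 * L) ?_ (hlim.const_mul 2)
    · refine h1.trans (ENNReal.ofReal_le_ofReal ?_)
      rw [hK]
      linarith
    · filter_upwards [eventually_ge_atTop t₀] with t ht
      refine ENNReal.ofReal_le_ofReal ?_
      have h2 := h.residual_le_two_mul (sub_pos.mp hg0) (hsm.angleBound_nonneg t) fun i =>
        h.nearSubspace hk hs hη hsm hχ (T := t) (fun u hu h1 _ => hN u hu h1) (fun u _ => hρ u) t
          le_rfl i
      have := hbound t ht
      linarith

end Convergence

/-! ### The worst case and the main statement -/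

/-- The worst-case residual error is monotone: a larger `η` admits more data. -/
theorem monotone_worstResidual {m d k : ℕ} (F : Set (Matrix (Fin k) (Fin k) ℝ)) (s : Fin m → ℕ)
    (M : Matrix (Fin d) (Fin d) ℝ) (b : Fin m) (I : Set ℕ) (t : ℕ) :
    Monotone (worstResidual F s M b I t) := by
  intro η η' hle
  refine sSup_le_sSup ?_
  rintro x ⟨A, Z, Y, D, N, N', hA, hη, hrest⟩
  exact ⟨A, Z, Y, D, N, N', hA,
    fun i => (hη i).trans (mul_le_mul_of_nonneg_right hle (norm_nonneg _)), hrest⟩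

end FedPower

open FedPower in
theorem mainTheorem4 :
    -- monotonicity in `η`, with and without alignment
    (∀ (m d k : ℕ) (s : Fin m → ℕ) (M : Matrix (Fin d) (Fin d) ℝ) (b : Fin m) (I : Set ℕ) (t : ℕ),
      Monotone (worstResidual (orthMat k) s M b I t) ∧
      Monotone (worstResidual ({1} : Set (Matrix (Fin k) (Fin k) ℝ)) s M b I t)) ∧
    -- the bounds; the constants `c₀`, `c`, `K` are absolute
    ∃ c₀ c K : ℝ, 0 < c₀ ∧ 0 < c ∧ 0 < K ∧
      ∀ (m d k : ℕ) (s : Fin m → ℕ) (A : (i : Fin m) → Matrix (Fin (s i)) (Fin d) ℝ)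
        (b : Fin m) (I : Set ℕ) (η : ℝ) (Mdag : Matrix (Fin d) (Fin d) ℝ) (κ σ₁ gap : ℝ)
        (Z Y : ℕ → Fin m → Matrix (Fin d) (Fin k) ℝ)
        (D : ℕ → Fin m → Matrix (Fin k) (Fin k) ℝ)
        (N : ℕ → Fin m → Matrix (Fin d) (Fin k) ℝ)
        (N' : ℕ → Matrix (Fin d) (Fin k) ℝ),
        1 ≤ k → (∀ i, 0 < s i) →
        IsMoorePenrose (gram A) Mdag → κ = ‖gram A‖ * ‖Mdag‖ →
        σ₁ = sigma (gram A) 1 → gap = sigma (gram A) k - sigma (gram A) (k + 1) →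
        LocalApprox A η → η * κ ≤ 1 / 3 →
        -- with orthogonal Procrustes alignment
        (IsRun (orthMat k) A b I Z Y D N N' →
          (∀ t p : ℕ, p = t - lastSync I t → η * p ≤ 1 → FullRankUpTo Y t →
            ENNReal.ofReal (residual b Z D t) ≤
              min (ENNReal.ofReal (2 * Real.exp 1 ^ 2 * κ ^ p * p * η))
                (ENNReal.ofReal (η * σ₁) / ENNReal.ofReal (c * gap) +
                  2 * ENNReal.ofReal (gammaRatio A k ^ ((p : ℝ) / 4)) * angleTerm A I Z t)) ∧
          -- the size of the quantities in the second bound when `ε'` is small enough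
          (∀ χ ν ρmax : ℝ, 0 < gap → 0 < χ → 0 ≤ ν → 0 ≤ ρmax →
            (1 - weight s b) * ρmax < 1 →
            (∀ w : EuclideanSpace ℝ (Fin k), χ * max 1 ‖Z 0 b‖ * ‖w‖ ≤
              ‖(topEigenspace (gram A) k).starProjection (Matrix.toEuclideanLin (Z 0 b) w)‖) →
            epsPrime A b k η ν ρmax ≤ c₀ * min (1 / 2) χ →
            -- the ratio lies in `(0, 1)`
            (gammaRatio A k < 1 ∧ (0 < sigma (gram A) (k + 1) → 0 < gammaRatio A k)) ∧
            -- up to a finite time `T`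
            (∀ T : ℕ, (∀ u ∈ I, 1 ≤ u → u ≤ T → noiseNorm s N N' u ≤ ν) →
              (∀ u ≤ T, residual b Z D u ≤ ρmax) →
              ∀ t ≤ T,
                angleTerm A I Z t ≤ ENNReal.ofReal (K * ((η * σ₁ + ν) / gap +
                  (1 - gap / (2 * sigma (gram A) k)) ^ lastSync I t / χ)) ∧
                residual b Z D t ≤ K * ((η * σ₁ + ν) / gap +
                  (1 - gap / (2 * sigma (gram A) k)) ^ lastSync I t / χ)) ∧
            -- in the limit `t → ∞`
            (I.Infinite → (∀ u ∈ I, 1 ≤ u → noiseNorm s N N' u ≤ ν) →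
              (∀ u, residual b Z D u ≤ ρmax) →
              ∀ ν' : ℝ, (∀ᶠ u in atTop, u ∈ I → noiseNorm s N N' u ≤ ν') →
                limsup (fun t => angleTerm A I Z t) atTop ≤
                  ENNReal.ofReal (K * (η * σ₁ + ν') / gap) ∧
                limsup (fun t => ENNReal.ofReal (residual b Z D t)) atTop ≤
                  ENNReal.ofReal (K * (η * σ₁ + ν') / gap)))) ∧
        -- without alignment
        (IsRun {1} A b I Z Y D N N' →
          ∀ t p : ℕ, p = t - lastSync I t → η * p ≤ 1 → FullRankUpTo Y t →
            residual b Z D t ≤ 4 * Real.exp 1 * √k * p * κ ^ p * η) := by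
  refine ⟨fun m d k s M b I t => ⟨monotone_worstResidual _ s M b I t,
    monotone_worstResidual _ s M b I t⟩, 1 / 20, 1 / 16, 40, by norm_num, by norm_num, by norm_num,
    ?_⟩
  intro m d k s A b I η Mdag κ σ₁ gap Z Y D N N' hk hs hM hκ hσ hgap hη _
  have hσ' : σ₁ = ‖gram A‖ := by rw [hσ, norm_eq_sigma_one (gram_posSemidef A)]
  subst hσ' hκ hgap
  refine ⟨fun h => ⟨?_, ?_⟩, ?_⟩
  · rintro t _ rfl _ hr
    exact le_min (ENNReal.ofReal_le_ofReal (h.residual_le_of_aligned hk hs hM hη hr))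
      (h.residual_le_angle hk hs hM hη hr)
  · intro χ ν ρ hgap0 hχ0 hν hρ hρ1 hχ hε
    have hsm := smallError_of_epsPrime hk hs hη hgap0 hχ0 (chi_le_one hk _ _ hχ) hν hρ hρ1 hε
    refine ⟨⟨gammaRatio_lt_one b hk hη ?_ hgap0, fun hpos => ?_⟩, ?_, ?_⟩
    · linarith [hsm.le_half]
    · exact lt_max_of_lt_right (div_pos hpos hsm.sigma_pos)
    · exact fun T hN hρT t ht => h.finite_time_bounds hk hs hη hsm hχ hN hρT t ht
    · exact fun hI hN hρT ν' hN' => h.limit_bounds hk hs hη hsm hχ hI hN hρT hN'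
  · rintro h t _ rfl _ hr
    exact h.residual_le_of_unaligned hk hs hM hη hr
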